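/- **Conventions.** All languages are relational and all structures are countable. For an $L$-structure $\mathbf M$ on a set $M$, a set $A\subseteq M$ and tuples $x,y$, write $\mathrm{tp}_L(x/A)=\mathrm{tp}_L(y/A)$ if some automorphism of $\mathbf M$ fixes $A$ pointwise and maps $x$ to $y$; a type is an equivalence class of this relation, its members are its realizations, and it is non-algebraic if it has infinitely many of them. Write $g^a=a^{-1}ga$, $\mathrm{Fix}(A)$ for the pointwise stabiliser of $A$, and $AB$ for $A\cup B$; a tuple is identified with the set of its entries where a set is expected. If $A^+=f(A)$, then $f(\mathrm{tp}(x/A))$ denotes $\mathrm{tp}(f(x)/A^+)$. **Expansions.** Let $\mathbf M_1,\mathbf M_2$ be countable homogeneous structures on the same set $M$ in disjoint languages $L_1,L_2$. The $L_1\cup L_2$-structure $\mathbf M^*$ on $M$ with $\mathbf M^*{\restriction}L_i=\mathbf M_i$ is their free fusion if every non-algebraic $L_1$-type and every non-algebraic $L_2$-type, each in one variable and over a finite set, have a common realization. It is an *order expansion* of $\mathbf M_1$ if $\mathbf M_2\cong(\mathbb Q,<)$, and a *tournament expansion* of $\mathbf M_1$ if $\mathbf M_2$ is the random tournament (a countable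 tournament such that for all disjoint finite $A,B$ there is $x\notin A\cup B$ with $x\to a$ for all $a\in A$ and $b\to x$ for all $b\in B$). Put $G=\mathrm{Aut}(\mathbf M^*)$; types without a subscript are types in $\mathbf M^*$. **Base structures and independence.** Let $\mathbf M=\mathbf M_1$ be one of the following. 1. The Fraïssé limit of a Fraïssé class in a relational language that is closed under free amalgams, such that $\mathrm{Aut}(\mathbf M)$ is transitive on $M$ and $\mathbf M$ is not an indiscernible set (i.e. not all tuples of distinct elements of the same length have the same type). Here $A\perp_B C$ means that $A\cap C\subseteq B$ and no relation of $\mathbf M$ holds of a tuple from $A\cup B\cup C$ that has an entry in $A\setminus B$ and an entry in $C\setminus B$. 2. The bounded rational Urysohn space, i.e. the countable metric space with rational distances in $[0,1]$ that contains an isometric copy of each finite metric space of this kind and in which every isometry between finite subspaces extends to an isometry of the whole space onto itself; it is a structure with one binary relation for each rational distance. Here $A\perp_B C$ means that for all $a\in A$, $c\in C$ either $d(a,c)=1$ or there is $b\in B$ with $d(a,c)=d(a,b)+d(b,c)$. Write $A\perp_{C;D}B$ if $AC\perp_D B$ and $A\perp_C BD$. **Moving maximally.** An element $g\in G$ *moves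 maximally* if $\mathrm{tp}_{L_2}(x\,g(x))=\mathrm{tp}_{L_2}(y\,g(y))$ for all $x,y\in M$, and every non-algebraic type of a finite tuple over a finite set $X$ has a realization $x$ with $x\perp_{X;g(X)}g(x)$. **Compatible.** A set $X$ is *full* for $g\in G$ if, with $Y=g(X)$, for all finite tuples $x,y$ of the same length with $g(\mathrm{tp}(x/X))=\mathrm{tp}(y/Y)$, $\mathrm{tp}_{L_2}(y^i/x^i)=\mathrm{tp}_{L_2}(g(x^i)/x^i)$ for all $i$, and $x\perp_{X;Y}y$, there is $a\in\mathrm{Fix}(XY)$ with $g^a(x)=y$. An element $g\in G$ that moves maximally is *compatible* if every finite $X_0\subseteq M$ is contained in a finite set $X$ that is full for $g$ and satisfies the following with $Y=g(X)$: whenever $b\in G$, $Z$ is a finite set with $g^b(Z)=Y$, and $x,z$ are tuples of the same finite length with $g^b(\mathrm{tp}(z/Z))=g(\mathrm{tp}(x/X))$, $z\perp_Z YX$ and $x\perp_X YZ$, there are $b'\in\mathrm{Fix}(YZ)$ and a finite set $Z^+\supseteq Z$ that is full for $g^b$ such that, with $Y^+=g^b(Z^+)$, $$\mathrm{tp}(g^{bb'}(z)/Y)=\mathrm{tp}(g^b(z)/Y),\qquad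 g^{bb'}(z)\perp_Y (b')^{-1}(Y^+),\qquad b'(z)\perp_{Z^+}Y^+,$$ and some tuple in $M$ realizes $$\mathrm{tp}_{L_2}\bigl(g^{bb'}(z)/(b')^{-1}(Y^+)\bigr)\cup\bigcup_i\mathrm{tp}_{L_2}(g(x^i)/x^i)\cup\bigcup_i\mathrm{tp}_{L_2}(g^{bb'}(z^i)/z^i).$$ **Proposition.** Let $\mathbf M^*$ be an order or tournament expansion of a structure $\mathbf M$ as in 1 or 2, and let $G=\mathrm{Aut}(\mathbf M^*)$. Then for every $h\in G$ with $h\neq\mathrm{id}$ the normal closure of $h$ in $G$ contains an element $g$ that moves maximally and is compatible. In the case of an order expansion, $g$ can moreover be chosen unboundedly increasing: $g(x)>x$ for all $x\in M$, and for all $a<b$ in $M$ there is $m\in\mathbb N$ with $g^m(a)>b$. -/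

import Mathlib

open FirstOrder CategoryTheory

universe u v u' v' w

namespace Fusion

section Types

variable (L : FirstOrder.Language.{u, v}) {M : Type w} [L.Structure M]

/-- The automorphism group of the `L`-structure `M`, as a group of permutations of `M`. -/
def autGroup (M : Type w) [L.Structure M] : Subgroup (Equiv.Perm M) where
  carrier := {σ | ∃ φ : M ≃[L] M, φ.toEquiv = σ}
  mul_mem' := by
    rintro _ _ ⟨φ, rfl⟩ ⟨ψ, rfl⟩
    exact ⟨φ.comp ψ, rfl⟩
  one_mem' := ⟨FirstOrder.Language.Equiv.refl L M, rfl⟩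
  inv_mem' := by
    rintro _ ⟨φ, rfl⟩
    exact ⟨φ.symm, rfl⟩

/-- `tp_L(x/A) = tp_L(y/A)` for tuples `x`, `y`: some `L`-automorphism fixes `A` pointwise and
maps `x` to `y`. -/
def SameType (A : Set M) {n : ℕ} (x y : Fin n → M) : Prop :=
  ∃ σ ∈ autGroup L M, (∀ a ∈ A, σ a = a) ∧ ∀ i, σ (x i) = y i

/-- `tp_L(x/A)` is non-algebraic: it has infinitely many realizations. -/
def NonAlgebraic (A : Set M) {n : ℕ} (x : Fin n → M) : Prop :=
  {y : Fin n → M | SameType L A x y}.Infinite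

/-- `Aut(M)` is transitive on `M`. -/
def IsTransitive (M : Type w) [L.Structure M] : Prop :=
  ∀ a b : M, ∃ σ ∈ autGroup L M, σ a = b

/-- `M` is an indiscernible set: any two tuples of distinct elements of the same length have the
same type over the empty set. -/
def IsIndiscernibleSet (M : Type w) [L.Structure M] : Prop :=
  ∀ (n : ℕ) (x y : Fin n → M), x.Injective → y.Injective → SameType L (∅ : Set M) x y

end Types

section FreeAmalgamation

variable {L : FirstOrder.Language.{u, v}}

/-- The structure `D`, with embeddings `f : A → D` and `g : C → D` that agree on `B`, is the free
amalgam of `A` and `C` over `B`: `D` is the union of the two images, these meet exactly in the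
image of `B`, and every relation of `D` lives inside one of the two images. -/
def IsFreeAmalgam {A B C D : Bundled.{w} L.Structure} (i : B ↪[L] A) (j : B ↪[L] C)
    (f : A ↪[L] D) (g : C ↪[L] D) : Prop :=
  f.comp i = g.comp j ∧
  Set.range f ∪ Set.range g = Set.univ ∧
  Set.range f ∩ Set.range g = Set.range (f.comp i) ∧
  ∀ (n : ℕ) (R : L.Relations n) (d : Fin n → D), FirstOrder.Language.Structure.RelMap R d →
    (∀ k, d k ∈ Set.range f) ∨ (∀ k, d k ∈ Set.range g)

/-- A free amalgamation class: a Fraïssé class that contains the free amalgam of `A` and `C` over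
`B` for all its members `A`, `B`, `C` and embeddings of `B` into `A` and `C`. -/
def IsFreeAmalgamationClass (K : Set (Bundled.{w} L.Structure)) : Prop :=
  FirstOrder.Language.IsFraisse K ∧
  ∀ (A B C : Bundled.{w} L.Structure) (i : B ↪[L] A) (j : B ↪[L] C), A ∈ K → B ∈ K → C ∈ K →
    ∃ (D : Bundled.{w} L.Structure) (f : A ↪[L] D) (g : C ↪[L] D),
      D ∈ K ∧ IsFreeAmalgam i j f g

/-- Free independence. `FreeIndep L A B C` says that `A` is independent from `C` over `B`, i.e.
that `ABC` is the free amalgam of `AB` and `BC` over `B`. -/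
def FreeIndep (L : FirstOrder.Language.{u, v}) {M : Type w} [L.Structure M] (A B C : Set M) : Prop :=
  A ∩ C ⊆ B ∧
  ∀ (n : ℕ) (R : L.Relations n) (d : Fin n → M), (∀ k, d k ∈ A ∪ B ∪ C) →
    (∃ k, d k ∈ A \ B) → (∃ k, d k ∈ C \ B) → ¬ FirstOrder.Language.Structure.RelMap R d

end FreeAmalgamation

section Urysohn

/-- A binary relation symbol for each rational distance. -/
inductive DistRel : ℕ → Type
  | dist (q : ℚ) : DistRel 2

/-- The relational language of rational metric spaces. -/
def distLang : FirstOrder.Language := ⟨fun _ => Empty, DistRel⟩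

/-- A metric space as a relational structure: the symbol of `q` holds of `x`, `y` if and only if
the distance of `x` and `y` is `q`. -/
instance metricStructure (M : Type w) [MetricSpace M] : distLang.Structure M where
  funMap := fun f => f.elim
  RelMap := fun R x => match R with
    | DistRel.dist q => Dist.dist (x 0) (x 1) = (q : ℝ)

/-- All distances are rational numbers in `[0, 1]`. -/
def IsRationalBounded (M : Type w) [MetricSpace M] : Prop :=
  ∀ x y : M, dist x y ≤ 1 ∧ ∃ q : ℚ, dist x y = (q : ℝ)

/-- The bounded rational Urysohn space: the countable metric space with rational distances in
`[0, 1]` that contains every finite such space isometrically and in which every isometric map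
defined on a finite subspace extends to an isometry of the whole space onto itself. -/
structure IsBoundedRationalUrysohn (M : Type w) [MetricSpace M] : Prop where
  countable : Countable M
  rational : IsRationalBounded M
  universal : ∀ (N : Type) [Finite N] [MetricSpace N], IsRationalBounded N →
    ∃ f : N → M, Isometry f
  homogeneous : ∀ (S : Set M), S.Finite → ∀ f : S → M, Isometry f →
    ∃ e : M ≃ᵢ M, ∀ s : S, e s = f s

/-- Metric independence in a space of diameter one. `MetricIndep A B C` says that `A` is
independent from `C` over `B`: all distances between `A` and `C` are as large as the distances to
`B` and the bound one permit. -/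
def MetricIndep {M : Type w} [MetricSpace M] (A B C : Set M) : Prop :=
  ∀ a ∈ A, ∀ c ∈ C, dist a c = 1 ∨ ∃ b ∈ B, dist a c = dist a b + dist b c

end Urysohn

section FreeFusion

variable (L₁ : FirstOrder.Language.{u, v}) (L₂ : FirstOrder.Language.{u', v'})

/-- The `L₁ ∪ L₂`-structure on `M` is the free fusion of two countable homogeneous structures:
any non-algebraic `L₁`-type over a finite set and any non-algebraic `L₂`-type over a finite set
(both in one variable) have a common realization. -/
structure IsFreeFusion (M : Type w) [L₁.Structure M] [L₂.Structure M] : Prop where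
  countable : Countable M
  homogeneous₁ : L₁.IsUltrahomogeneous M
  homogeneous₂ : L₂.IsUltrahomogeneous M
  realize : ∀ (A₁ A₂ : Set M), A₁.Finite → A₂.Finite → ∀ (p₁ p₂ : M),
    NonAlgebraic L₁ A₁ ![p₁] → NonAlgebraic L₂ A₂ ![p₂] →
    ∃ c : M, SameType L₁ A₁ ![p₁] ![c] ∧ SameType L₂ A₂ ![p₂] ![c]

/-- One binary relation symbol. -/
inductive BinRel : ℕ → Type
  | rel : BinRel 2

/-- The relational language with one binary relation symbol. -/
def binLang : FirstOrder.Language := ⟨fun _ => Empty, BinRel⟩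

/-- The binary relation of a `binLang`-structure. -/
def binRel (M : Type w) [binLang.Structure M] (x y : M) : Prop :=
  FirstOrder.Language.Structure.RelMap (L := binLang) BinRel.rel ![x, y]

/-- Order expansion: free fusion with a linear order isomorphic to the rationals. -/
def IsOrderExpansion (M : Type w) [L₁.Structure M] [binLang.Structure M] : Prop :=
  IsFreeFusion L₁ binLang M ∧
  Nonempty (RelIso (binRel M) (fun p q : ℚ => p < q))

/-- The relation is a tournament, and any two disjoint finite sets `A`, `B` admit a vertex
`x ∉ A ∪ B` with `x → a` for `a ∈ A` and `b → x` for `b ∈ B`. -/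
structure IsRandomTournament {M : Type w} (r : M → M → Prop) : Prop where
  countable : Countable M
  irrefl : ∀ x, ¬ r x x
  asymm : ∀ x y, r x y → ¬ r y x
  total : ∀ x y, x ≠ y → r x y ∨ r y x
  extension : ∀ A B : Set M, A.Finite → B.Finite → Disjoint A B →
    ∃ x, x ∉ A ∪ B ∧ (∀ a ∈ A, r x a) ∧ ∀ b ∈ B, r b x

/-- Tournament expansion: free fusion with a random tournament. -/
def IsTournamentExpansion (M : Type w) [L₁.Structure M] [binLang.Structure M] : Prop :=
  IsFreeFusion L₁ binLang M ∧ IsRandomTournament (binRel M)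

end FreeFusion

section Automorphisms

variable (L₁ : FirstOrder.Language.{u, v}) (L₂ : FirstOrder.Language.{u', v'})
variable {M : Type w} [L₁.Structure M] [L₂.Structure M]

/-- `A` is independent from `B` over the pair `C; D`: `AC` is independent from `B` over `D`, and
`A` is independent from `BD` over `C`. Here `I A B C` means that `A` is independent from `C`
over `B`. -/
def IndepPair (I : Set M → Set M → Set M → Prop) (A C D B : Set M) : Prop :=
  I (A ∪ C) D B ∧ I A C (B ∪ D)

variable (I : Set M → Set M → Set M → Prop)

/-- `g` is `L₂`-homogeneous: all pairs `(x, g x)` have the same `L₂`-type. -/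
def IsHomogeneousAut (g : autGroup (L₁.sum L₂) M) : Prop :=
  ∀ x y : M, SameType L₂ (∅ : Set M) ![x, g.1 x] ![y, g.1 y]

/-- `g` moves maximally. -/
def MovesMaximally (g : autGroup (L₁.sum L₂) M) : Prop :=
  IsHomogeneousAut L₁ L₂ g ∧
  ∀ (X : Set M), X.Finite → ∀ (n : ℕ) (p : Fin n → M), NonAlgebraic (L₁.sum L₂) X p →
    ∃ x : Fin n → M, SameType (L₁.sum L₂) X p x ∧
      IndepPair I (Set.range x) X (g.1 '' X) (Set.range (g.1 ∘ x))

/-- The conjugate `g ^ a = a⁻¹ g a`. -/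
def conj {G : Type*} [Group G] (g a : G) : G := a⁻¹ * g * a

/-- `a` fixes `S` pointwise. -/
def Fixes {L : FirstOrder.Language.{u, v}} {M : Type w} [L.Structure M] (a : autGroup L M) (S : Set M) :
    Prop :=
  ∀ s ∈ S, a.1 s = s

/-- The set `X` is full for `g`. -/
def IsFull (g : autGroup (L₁.sum L₂) M) (X : Set M) : Prop :=
  ∀ (n : ℕ) (x y : Fin n → M),
    SameType (L₁.sum L₂) (g.1 '' X) (g.1 ∘ x) y →
    (∀ i, SameType L₂ {x i} ![g.1 (x i)] ![y i]) →
    IndepPair I (Set.range x) X (g.1 '' X) (Set.range y) →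
    ∃ a : autGroup (L₁.sum L₂) M, Fixes a (X ∪ g.1 '' X) ∧ ∀ i, (conj g a).1 (x i) = y i

/-- The second condition of compatibility, for the finite set `X` and `Y = g(X)`. The tuple `v`
realizes the union of `L₂`-types that has to be consistent. -/
def HasTransfer (g : autGroup (L₁.sum L₂) M) (X : Set M) : Prop :=
  ∀ (b : autGroup (L₁.sum L₂) M) (Z : Set M), Z.Finite → (conj g b).1 '' Z = g.1 '' X →
  ∀ (n : ℕ) (x z : Fin n → M),
    SameType (L₁.sum L₂) (g.1 '' X) ((conj g b).1 ∘ z) (g.1 ∘ x) →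
    I (Set.range z) Z (g.1 '' X ∪ X) →
    I (Set.range x) X (g.1 '' X ∪ Z) →
    ∃ (b' : autGroup (L₁.sum L₂) M) (Z' : Set M),
      Fixes b' (g.1 '' X ∪ Z) ∧ Z'.Finite ∧ Z ⊆ Z' ∧ IsFull L₁ L₂ I (conj g b) Z' ∧
      SameType (L₁.sum L₂) (g.1 '' X) ((conj g (b * b')).1 ∘ z) ((conj g b).1 ∘ z) ∧
      I (Set.range ((conj g (b * b')).1 ∘ z)) (g.1 '' X) (b'⁻¹.1 '' ((conj g b).1 '' Z')) ∧
      I (Set.range (b'.1 ∘ z)) Z' ((conj g b).1 '' Z') ∧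
      ∃ v : Fin n → M,
        SameType L₂ (b'⁻¹.1 '' ((conj g b).1 '' Z')) ((conj g (b * b')).1 ∘ z) v ∧
        (∀ i, SameType L₂ {x i} ![g.1 (x i)] ![v i]) ∧
        ∀ i, SameType L₂ {z i} ![(conj g (b * b')).1 (z i)] ![v i]

/-- `g` is compatible: it moves maximally, and every finite set has a finite extension that is
full for `g` and satisfies the second condition. -/
def IsCompatible (g : autGroup (L₁.sum L₂) M) : Prop :=
  MovesMaximally L₁ L₂ I g ∧
  ∀ X₀ : Set M, X₀.Finite → ∃ X : Set M, X.Finite ∧ X₀ ⊆ X ∧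
    IsFull L₁ L₂ I g X ∧ HasTransfer L₁ L₂ I g X

/-- A permutation is unboundedly increasing with respect to the strict order `r`. -/
def IsUnboundedlyIncreasing {M : Type w} (r : M → M → Prop) (g : Equiv.Perm M) : Prop :=
  (∀ x, r x (g x)) ∧ ∀ a b, r a b → ∃ m : ℕ, r b ((g ^ m) a)

end Automorphisms

end Fusion

open Fusion

namespace Fusion

/-! ### Permutation groups with an independence relation, and their free fusion -/

section Abstract

variable {M : Type w}

/-! The argument runs in two permutation groups `G₁`, `G₂` on `M`. The first carries a stationary
independence relation (`IsIndependence`), the second is the automorphism group of a homogeneous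
tournament, a linear order being one (`IsHomogeneousTournament`), and types of the two groups that
are not realized in their bases have common realizations (`IsFusionPair`). Back and forth makes `G₁
⊓ G₂` homogeneous (`exists_mem_inf`). Its elements can therefore be built by finite approximations
in which the two types of each new point are chosen separately.

Moving maximally. If `h` and `k⁻¹` move a realization of every type as far as a relation `R` says,
then for generic `a` the product `k * (a⁻¹ * h * a)` moves one further (`exists_moves_mul_conj`).
With `k = h⁻¹` or `k = h` this stays in the normal closure. For free amalgamation one step leads
from "not fixed" to "independent"; in the Urysohn space each step doubles the distance until it
reaches one (`MoveChain`). Independence of single points from their images passes to tuples by a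
construction point by point (`exists_indepPair_image`).

The second structure. In a tournament, two more commutators yield a `g` without fixed points and
then one with `x → g x` throughout. In an order, `h` moves all realizations of some type, so some
commutator moves points up arbitrarily far out in both directions. Its product with its conjugate by
an element that shifts a sequence of irrational cuts is unboundedly increasing. This property
survives products and conjugation, so the chain of movement relations is then climbed with products
`g * (a⁻¹ * g * a)`.

Fullness. For the first structure, stationarity identifies a prescribed pair with any sufficiently
independent copy (`exists_conj_eq`); relations of the second structure are controlled while the copy
is built. In a tournament the demands on a new point are consistent if `X` is convex on `g`-orbits.
In an order `X` is a block of orbit segments. The prescribed map extends to an unboundedly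
increasing automorphism agreeing with `g` on `X`, and the two are conjugate by a map fixing `X` and
`g(X)`; the copy only has to follow that map up to small perturbations.

Transfer. The element `b'` puts the tuples into general position, and only the common realization in
the second structure remains. In a tournament it always exists. In an order a point has to be raised
above another one without crossing a given finite set. This is possible because the gaps of `g(X)`
are at most one step of `g` long, and because points beyond `g(X)` can be placed close to it. -/

theorem perm_inv_apply (σ : Equiv.Perm M) (x : M) : σ⁻¹ (σ x) = x := σ.symm_apply_apply x

theorem perm_apply_inv (σ : Equiv.Perm M) (x : M) : σ (σ⁻¹ x) = x := σ.apply_symm_apply x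

/-- The elements `x` and `y` have the same type over `A` with respect to the permutation
group `H`. -/
def TypeEq (H : Subgroup (Equiv.Perm M)) (A : Set M) (x y : M) : Prop :=
  ∃ σ ∈ H, (∀ a ∈ A, σ a = a) ∧ σ x = y

namespace TypeEq

variable {H : Subgroup (Equiv.Perm M)} {A B : Set M} {x y z : M}

theorem refl (H : Subgroup (Equiv.Perm M)) (A : Set M) (x : M) : TypeEq H A x x :=
  ⟨1, H.one_mem, fun _ _ => rfl, rfl⟩

theorem symm (h : TypeEq H A x y) : TypeEq H A y x := by
  obtain ⟨σ, hσ, hA, rfl⟩ := h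
  exact ⟨σ⁻¹, H.inv_mem hσ, fun a ha => by rw [Equiv.Perm.inv_eq_iff_eq, hA a ha], by simp⟩

theorem trans (h : TypeEq H A x y) (h' : TypeEq H A y z) : TypeEq H A x z := by
  obtain ⟨σ, hσ, hA, rfl⟩ := h
  obtain ⟨τ, hτ, hA', rfl⟩ := h'
  exact ⟨τ * σ, H.mul_mem hτ hσ, fun a ha => by simp [hA a ha, hA' a ha], rfl⟩

theorem mono (h : TypeEq H A x y) (hB : B ⊆ A) : TypeEq H B x y := by
  obtain ⟨σ, hσ, hA, e⟩ := h
  exact ⟨σ, hσ, fun a ha => hA a (hB ha), e⟩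

theorem eq_of_mem (h : TypeEq H A x y) (hx : x ∈ A) : y = x := by
  obtain ⟨σ, hσ, hA, rfl⟩ := h
  exact hA x hx

theorem notMem (h : TypeEq H A x y) (hx : x ∉ A) : y ∉ A := fun hy =>
  hx (by rw [h.symm.eq_of_mem hy]; exact hy)

theorem map {g : Equiv.Perm M} (hg : g ∈ H) (h : TypeEq H A x y) :
    TypeEq H (g '' A) (g x) (g y) := by
  obtain ⟨σ, hσ, hA, rfl⟩ := h
  refine ⟨g * σ * g⁻¹, H.mul_mem (H.mul_mem hg hσ) (H.inv_mem hg), ?_, by simp⟩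
  rintro _ ⟨a, ha, rfl⟩
  simp [hA a ha]

end TypeEq

/-- An independence relation that is invariant under the permutation group `H`, symmetric,
monotone and transitive, and in which types have unique independent extensions. -/
structure IsIndependence (H : Subgroup (Equiv.Perm M)) (I : Set M → Set M → Set M → Prop) :
    Prop where
  map : ∀ {σ : Equiv.Perm M}, σ ∈ H → ∀ {A B C : Set M}, I A B C →
    I (σ '' A) (σ '' B) (σ '' C)
  symm : ∀ {A B C : Set M}, I A B C → I C B A
  mono_right : ∀ {A B C C' : Set M}, I A B C → C' ⊆ C → I A B C'
  trans_right : ∀ {A B C D : Set M}, I A B D → I A (B ∪ D) C → I A B (D ∪ C)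
  base_right : ∀ {A B C D : Set M}, I A B (D ∪ C) → I A (B ∪ D) C
  self : ∀ (B C : Set M), I B B C
  disj : ∀ {A B C : Set M} {x : M}, I A B C → x ∈ A → x ∈ C → x ∈ B
  exist : ∀ {B C : Set M}, B.Finite → C.Finite → ∀ p : M,
    ∃ q, TypeEq H B p q ∧ I {q} B C
  stat : ∀ {B C : Set M}, B.Finite → C.Finite → ∀ {p q : M}, TypeEq H B p q →
    I {p} B C → I {q} B C → TypeEq H (B ∪ C) p q

namespace IsIndependence

variable {H : Subgroup (Equiv.Perm M)} {I : Set M → Set M → Set M → Prop}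
variable (hI : IsIndependence H I) {A A' B B' C C' D : Set M}

include hI

theorem mono (h : I A B C) (hA : A' ⊆ A ∪ B) (hC : C' ⊆ C ∪ B) : I A' B C' := by
  have key : ∀ {A C C' : Set M}, I A B C → C' ⊆ B ∪ C → I A B C' := fun {A C C'} h hC => by
    refine hI.mono_right (hI.trans_right (hI.symm (hI.self B A)) ?_) hC
    rwa [Set.union_self]
  rw [Set.union_comm] at hA hC
  exact hI.symm (key (hI.symm (key h hC)) hA)

theorem trans (h : I A B D) (h' : I A B' C) (h₁ : B ⊆ B') (h₂ : B' ⊆ B ∪ D)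
    (h₃ : C' ⊆ B' ∪ C) : I A B C' := by
  have e : B ∪ B' = B' := Set.union_eq_self_of_subset_left h₁
  have h4 : I A B B' := hI.mono h Set.subset_union_left (by rwa [Set.union_comm])
  exact hI.mono_right (hI.trans_right h4 (by rwa [e])) h₃

theorem base (h : I A B C) (h₁ : B ⊆ B') (h₂ : B' ⊆ B ∪ C) : I A B' C := by
  have h3 : I A B (B' ∪ C) := hI.mono h Set.subset_union_left (by
    intro z hz; have := @h₂ z; simp only [Set.mem_union] at hz this ⊢; tauto)
  have := hI.base_right h3
  rwa [Set.union_eq_self_of_subset_left h₁] at this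

theorem mono_left (h : I A B C) (hA : A' ⊆ A) : I A' B C :=
  hI.symm (hI.mono_right (hI.symm h) hA)

/-- Left transitivity. -/
theorem trans_left (h : I D B C) (h' : I A B' C) (h₁ : B ⊆ B') (h₂ : B' ⊆ B ∪ D)
    (h₃ : A' ⊆ B' ∪ A) : I A' B C :=
  hI.symm (hI.trans (hI.symm h) (hI.symm h') h₁ h₂ h₃)

/-- Left base monotonicity. -/
theorem base_left (h : I A B C) (h₁ : B ⊆ B') (h₂ : B' ⊆ B ∪ A) : I A B' C :=
  hI.symm (hI.base (hI.symm h) h₁ h₂)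

/-- Stationarity for finite sets in place of single elements. -/
theorem stat_set (hB : B.Finite) (hC : C.Finite) (hA : A.Finite) {σ : Equiv.Perm M}
    (hσ : σ ∈ H) (hfix : ∀ b ∈ B, σ b = b) (h : I A B C) (h' : I (σ '' A) B C) :
    ∃ τ ∈ H, (∀ b ∈ B ∪ C, τ b = b) ∧ ∀ a ∈ A, τ a = σ a := by
  induction A, hA using Set.Finite.induction_on with
  | empty => exact ⟨1, H.one_mem, fun _ _ => rfl, by simp⟩
  | @insert a A ha hA ih =>
    obtain ⟨τ, hτ, hτB, hτA⟩ := ih (hI.mono_left h (Set.subset_insert _ _))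
      (hI.mono_left h' (Set.image_mono (Set.subset_insert _ _)))
    have himg : τ '' A = σ '' A := Set.image_congr hτA
    have hτb : τ '' B = B := by
      have : Set.EqOn τ id B := fun b hb => hτB b (Or.inl hb)
      rw [this.image_eq, Set.image_id]
    have hτc : τ '' C = C := by
      have : Set.EqOn τ id C := fun b hb => hτB b (Or.inr hb)
      rw [this.image_eq, Set.image_id]
    have h1 : I {a} (B ∪ A) C := hI.mono_left
      (hI.base_left h (B' := B ∪ A) Set.subset_union_left (by
        intro z hz; simp only [Set.mem_union, Set.mem_insert_iff] at hz ⊢; tauto)) (by simp)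
    have h2 : I {τ a} (B ∪ σ '' A) C := by
      have := hI.map hτ h1
      rwa [Set.image_singleton, Set.image_union, hτb, hτc, himg] at this
    have h3 : I {σ a} (B ∪ σ '' A) C := hI.mono_left
      (hI.base_left h' (B' := B ∪ σ '' A) Set.subset_union_left (by
        rw [Set.image_insert_eq]
        intro z hz; simp only [Set.mem_union, Set.mem_insert_iff] at hz ⊢; tauto)) (by
        rw [Set.image_insert_eq]; simp)
    -- By induction `τ` agrees with `σ` on `A`. The points `τ a` and `σ a` thus have the same type
    -- over `B ∪ σ '' A` and are both independent from `C` over it, so stationarity for single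
    -- points corrects `τ`.
    have h4 : TypeEq H (B ∪ σ '' A) (τ a) (σ a) := by
      refine ⟨σ * τ⁻¹, H.mul_mem hσ (H.inv_mem hτ), ?_, by simp⟩
      rintro b (hb | ⟨a', ha', rfl⟩)
      · have : τ⁻¹ b = b := by rw [Equiv.Perm.inv_eq_iff_eq, hτB b (Or.inl hb)]
        rw [Equiv.Perm.mul_apply, this, hfix b hb]
      · rw [← hτA a' ha', Equiv.Perm.mul_apply, perm_inv_apply, hτA a' ha']
    obtain ⟨ρ, hρ, hρB, hρa⟩ := hI.stat (hB.union (hA.image _)) hC h4 h2 h3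
    refine ⟨ρ * τ, H.mul_mem hρ hτ, ?_, ?_⟩
    · intro b hb
      rw [Equiv.Perm.mul_apply, hτB b hb]
      apply hρB
      rcases hb with hb | hb
      · exact Or.inl (Or.inl hb)
      · exact Or.inr hb
    · rintro b (rfl | hb)
      · exact hρa
      · rw [Equiv.Perm.mul_apply, hτA b hb]
        exact hρB _ (Or.inl (Or.inr ⟨b, hb, rfl⟩))

end IsIndependence
/-- A generic sequence of finite approximations determines a permutation. -/
theorem exists_perm_of_conditions [Countable M] {P : Type*} [Preorder P] (dom : P → Set M)
    (val : P → Equiv.Perm M)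
    (hle : ∀ {c d : P}, c ≤ d → dom c ⊆ dom d ∧ Set.EqOn (val d) (val c) (dom c))
    (hdom : ∀ (c : P) (x : M), ∃ d, c ≤ d ∧ x ∈ dom d)
    (hran : ∀ (c : P) (y : M), ∃ d, c ≤ d ∧ y ∈ val d '' dom d)
    {ι : Type*} [Countable ι] (T : ι → P → Prop) (hT : ∀ i (c : P), ∃ d, c ≤ d ∧ T i d) (c₀ : P) :
    ∃ π : Equiv.Perm M,
      (∀ A : Set M, A.Finite → ∃ c, A ⊆ dom c ∧ Set.EqOn π (val c) (dom c)) ∧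
      (∀ i, ∃ c, T i c ∧ Set.EqOn π (val c) (dom c)) ∧ Set.EqOn π (val c₀) (dom c₀) := by
  classical
  -- The permutation is read off an ideal of conditions that meets countably many cofinal sets: one
  -- for each requirement `T i`, for each point of the domain and for each point of the range.
  let D : ι ⊕ (M ⊕ M) → Order.Cofinal P := fun k => match k with
    | Sum.inl i => ⟨{c | T i c}, fun c => let ⟨d, h, h'⟩ := hT i c; ⟨d, h', h⟩⟩
    | Sum.inr (Sum.inl x) => ⟨{c | x ∈ dom c}, fun c => let ⟨d, h, h'⟩ := hdom c x; ⟨d, h', h⟩⟩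
    | Sum.inr (Sum.inr y) =>
      ⟨{c | y ∈ val c '' dom c}, fun c => let ⟨d, h, h'⟩ := hran c y; ⟨d, h', h⟩⟩
  have : Encodable (ι ⊕ (M ⊕ M)) := Encodable.ofCountable _
  let J := Order.idealOfCofinals c₀ D
  have hJ : ∀ k, ∃ c, c ∈ D k ∧ c ∈ J := Order.cofinal_meets_idealOfCofinals c₀ D
  have agree : ∀ c ∈ J, ∀ d ∈ J, ∀ x, x ∈ dom c → x ∈ dom d → val c x = val d x := by
    intro c hc d hd x hxc hxd
    obtain ⟨e, _, hce, hde⟩ := J.directed c hc d hd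
    rw [← (hle hce).2 hxc, ← (hle hde).2 hxd]
  have ex : ∀ x, ∃ c ∈ J, x ∈ dom c := fun x =>
    let ⟨c, h, h'⟩ := hJ (Sum.inr (Sum.inl x)); ⟨c, h', h⟩
  choose cx hcx hxcx using ex
  let φ : M → M := fun x => val (cx x) x
  have hφ : ∀ c ∈ J, Set.EqOn φ (val c) (dom c) := fun c hc x hx =>
    agree _ (hcx x) c hc x (hxcx x) hx
  have hinj : Function.Injective φ := by
    intro x y hxy
    obtain ⟨e, he, h1, h2⟩ := J.directed _ (hcx x) _ (hcx y)
    rw [hφ e he ((hle h1).1 (hxcx x)), hφ e he ((hle h2).1 (hxcx y))] at hxy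
    exact (val e).injective hxy
  have hsurj : Function.Surjective φ := by
    intro y
    obtain ⟨c, ⟨x, hx, hxy⟩, hc⟩ := hJ (Sum.inr (Sum.inr y))
    exact ⟨x, by rw [hφ c hc hx, hxy]⟩
  refine ⟨Equiv.ofBijective φ ⟨hinj, hsurj⟩, ?_, ?_, ?_⟩
  · intro A hA
    suffices ∃ c ∈ J, A ⊆ dom c by
      obtain ⟨c, hc, h⟩ := this
      exact ⟨c, h, hφ c hc⟩
    induction A, hA using Set.Finite.induction_on with
    | empty => exact ⟨c₀, Order.mem_idealOfCofinals c₀ D, by simp⟩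
    | @insert a A _ _ ih =>
      obtain ⟨c, hc, h⟩ := ih
      obtain ⟨e, he, h1, h2⟩ := J.directed _ hc _ (hcx a)
      exact ⟨e, he, Set.insert_subset ((hle h2).1 (hxcx a)) (h.trans (hle h1).1)⟩
  · intro i
    obtain ⟨c, h, hc⟩ := hJ (Sum.inl i)
    exact ⟨c, h, hφ c hc⟩
  · exact hφ c₀ (Order.mem_idealOfCofinals c₀ D)

/-- The free fusion of two permutation groups: both are closed, and types over finite sets that
are not realized in these sets have a common realization. -/
structure IsFusionPair (G₁ G₂ : Subgroup (Equiv.Perm M)) : Prop where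
  closed₁ : ∀ π : Equiv.Perm M, (∀ A : Set M, A.Finite → ∃ σ ∈ G₁, Set.EqOn π σ A) → π ∈ G₁
  closed₂ : ∀ π : Equiv.Perm M, (∀ A : Set M, A.Finite → ∃ σ ∈ G₂, Set.EqOn π σ A) → π ∈ G₂
  realize : ∀ {A₁ A₂ : Set M}, A₁.Finite → A₂.Finite → ∀ {p₁ p₂ : M}, p₁ ∉ A₁ → p₂ ∉ A₂ →
    ∃ c, TypeEq G₁ A₁ p₁ c ∧ TypeEq G₂ A₂ p₂ c

namespace IsFusionPair

variable {G₁ G₂ : Subgroup (Equiv.Perm M)} {I : Set M → Set M → Set M → Prop}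

/-- A pair of permutations from the two groups that agree on a finite set. -/
structure AgreeingPair (G₁ G₂ : Subgroup (Equiv.Perm M)) where
  dom : Set M
  fst : Equiv.Perm M
  snd : Equiv.Perm M
  finite : dom.Finite
  fst_mem : fst ∈ G₁
  snd_mem : snd ∈ G₂
  eqOn : Set.EqOn fst snd dom

instance : Preorder (AgreeingPair G₁ G₂) where
  le c d := c.dom ⊆ d.dom ∧ Set.EqOn d.fst c.fst c.dom
  le_refl c := ⟨subset_rfl, fun _ _ => rfl⟩
  le_trans c d e h h' := ⟨h.1.trans h'.1, fun x hx => (h'.2 (h.1 hx)).trans (h.2 hx)⟩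

/-- The one-point step of back and forth. The images `σ₁ x` and `σ₂ x` may differ, but neither lies
in the common image of `A`, so joint realization supplies a single point with both types over it. -/
theorem exists_extend (hF : IsFusionPair G₁ G₂) {A : Set M} (hA : A.Finite)
    {σ₁ σ₂ : Equiv.Perm M} (h₁ : σ₁ ∈ G₁) (h₂ : σ₂ ∈ G₂) (h : Set.EqOn σ₁ σ₂ A) (x : M) :
    ∃ τ₁ ∈ G₁, ∃ τ₂ ∈ G₂, Set.EqOn τ₁ σ₁ A ∧ Set.EqOn τ₂ σ₂ A ∧ τ₁ x = τ₂ x := by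
  by_cases hx : x ∈ A
  · exact ⟨σ₁, h₁, σ₂, h₂, fun _ _ => rfl, fun _ _ => rfl, h hx⟩
  have n₁ : σ₁ x ∉ σ₁ '' A := by simpa using hx
  have n₂ : σ₂ x ∉ σ₁ '' A := by rw [h.image_eq]; simpa using hx
  obtain ⟨c, ⟨ρ₁, m₁, f₁, e₁⟩, ⟨ρ₂, m₂, f₂, e₂⟩⟩ :=
    hF.realize (hA.image σ₁) (hA.image σ₁) n₁ n₂
  refine ⟨ρ₁ * σ₁, G₁.mul_mem m₁ h₁, ρ₂ * σ₂, G₂.mul_mem m₂ h₂, ?_, ?_, ?_⟩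
  · intro a ha; exact f₁ _ ⟨a, ha, rfl⟩
  · intro a ha; exact f₂ _ ⟨a, ha, h ha⟩
  · simp [e₁, e₂]

/-- The fusion is homogeneous. -/
theorem exists_mem_inf [Countable M] (hF : IsFusionPair G₁ G₂) {A : Set M} (hA : A.Finite)
    {σ₁ σ₂ : Equiv.Perm M} (h₁ : σ₁ ∈ G₁) (h₂ : σ₂ ∈ G₂) (h : Set.EqOn σ₁ σ₂ A) :
    ∃ g ∈ G₁ ⊓ G₂, Set.EqOn g σ₁ A := by
  obtain ⟨π, hπ, -, hπA⟩ := exists_perm_of_conditions (P := AgreeingPair G₁ G₂)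
    AgreeingPair.dom AgreeingPair.fst (fun h => h)
    (fun c x => by
      obtain ⟨τ₁, m₁, τ₂, m₂, e₁, e₂, e⟩ := hF.exists_extend c.finite c.fst_mem c.snd_mem c.eqOn x
      refine ⟨⟨insert x c.dom, τ₁, τ₂, c.finite.insert x, m₁, m₂, ?_⟩, ⟨?_, e₁⟩, ?_⟩
      · rintro y (rfl | hy)
        · exact e
        · rw [e₁ hy, e₂ hy, c.eqOn hy]
      · exact Set.subset_insert _ _
      · exact Set.mem_insert _ _)
    (fun c y => by
      have hinv : Set.EqOn (c.fst⁻¹ : Equiv.Perm M) (c.snd⁻¹ : Equiv.Perm M) (c.fst '' c.dom) := by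
        rintro _ ⟨a, ha, rfl⟩
        rw [c.eqOn ha, perm_inv_apply, ← c.eqOn ha, perm_inv_apply]
      obtain ⟨τ₁, m₁, τ₂, m₂, e₁, e₂, e⟩ := hF.exists_extend (c.finite.image _)
        (G₁.inv_mem c.fst_mem) (G₂.inv_mem c.snd_mem) hinv y
      have k₁ : Set.EqOn (τ₁⁻¹ : Equiv.Perm M) c.fst c.dom := fun a ha => by
        rw [Equiv.Perm.inv_eq_iff_eq, e₁ ⟨a, ha, rfl⟩, perm_inv_apply]
      have k₂ : Set.EqOn (τ₂⁻¹ : Equiv.Perm M) c.snd c.dom := fun a ha => by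
        rw [Equiv.Perm.inv_eq_iff_eq, ← c.eqOn ha, e₂ ⟨a, ha, rfl⟩,
          c.eqOn ha, perm_inv_apply]
      refine ⟨⟨insert (τ₁ y) c.dom, τ₁⁻¹, τ₂⁻¹, c.finite.insert _, G₁.inv_mem m₁,
        G₂.inv_mem m₂, ?_⟩, ⟨Set.subset_insert _ _, k₁⟩, ⟨τ₁ y, Set.mem_insert _ _, by simp⟩⟩
      rintro z (rfl | hz)
      · rw [perm_inv_apply, e, perm_inv_apply]
      · rw [k₁ hz, k₂ hz, c.eqOn hz])
    (ι := Empty) (fun _ _ => True) (fun i => i.elim) ⟨A, σ₁, σ₂, hA, h₁, h₂, h⟩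
  refine ⟨π, ⟨hF.closed₁ π fun B hB => ?_, hF.closed₂ π fun B hB => ?_⟩, hπA⟩
  · obtain ⟨c, hc, hc'⟩ := hπ B hB
    exact ⟨c.fst, c.fst_mem, hc'.mono hc⟩
  · obtain ⟨c, hc, hc'⟩ := hπ B hB
    exact ⟨c.snd, c.snd_mem, (hc'.trans c.eqOn).mono hc⟩

variable (hF : IsFusionPair G₁ G₂) (hI : IsIndependence G₁ I)
include hF

/-- Types of the fusion are given by pairs of types. -/
theorem typeEq_inf [Countable M] {A : Set M} (hA : A.Finite) {x y : M} (h₁ : TypeEq G₁ A x y)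
    (h₂ : TypeEq G₂ A x y) : TypeEq (G₁ ⊓ G₂) A x y := by
  obtain ⟨σ₁, m₁, f₁, e₁⟩ := h₁
  obtain ⟨σ₂, m₂, f₂, e₂⟩ := h₂
  obtain ⟨g, hg, hgA⟩ := hF.exists_mem_inf (hA.insert x) m₁ m₂ (by
    rintro a (rfl | ha)
    · rw [e₁, e₂]
    · rw [f₁ a ha, f₂ a ha])
  exact ⟨g, hg, fun a ha => by rw [hgA (Or.inr ha), f₁ a ha], by
    rw [hgA (Or.inl rfl), e₁]⟩

include hI

/-- A type of the second structure has realizations outside any finite set. -/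
theorem exists_fresh {A E : Set M} (hA : A.Finite) (hE : E.Finite) {x : M} (hx : x ∉ A) :
    ∃ q, TypeEq G₂ A x q ∧ q ∉ E := by
  obtain ⟨p, hp, hpE⟩ := hI.exist hA hE x
  have hpA : p ∉ A := hp.notMem hx
  have hpE' : p ∉ A ∪ E := fun h => hpA (h.elim id fun h => hI.disj hpE rfl h)
  -- The first structure ensures avoidance: over `A ∪ E` the point `c` has the first type of `p`,
  -- which is not in this set.
  obtain ⟨c, hc₁, hc₂⟩ := hF.realize (hA.union hE) hA hpE' hx
  exact ⟨c, hc₂, fun h => hc₁.notMem hpE' (Or.inr h)⟩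

/-- A type over `A` has a realization that is independent from `E` in the first structure and has
a prescribed type over `A ∪ E` in the second structure. -/
theorem exists_indep [Countable M] {A E : Set M} (hA : A.Finite) (hE : E.Finite) {x q : M} (hx : x ∉ A)
    (hq : TypeEq G₂ A x q) (hqE : q ∉ E) :
    ∃ c, TypeEq (G₁ ⊓ G₂) A x c ∧ I {c} A E ∧ TypeEq G₂ (A ∪ E) q c := by
  obtain ⟨p, hp, hpE⟩ := hI.exist hA hE x
  have hpA : p ∉ A := hp.notMem hx
  have hpE' : p ∉ A ∪ E := fun h => hpA (h.elim id fun h => hI.disj hpE rfl h)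
  have hqA : q ∉ A := hq.notMem hx
  have hqE' : q ∉ A ∪ E := fun h => h.elim hqA hqE
  obtain ⟨c, hc₁, hc₂⟩ := hF.realize (hA.union hE) (hA.union hE) hpE' hqE'
  refine ⟨c, hF.typeEq_inf hA (hp.trans (hc₁.mono Set.subset_union_left))
    (hq.trans (hc₂.mono Set.subset_union_left)), ?_, hc₂⟩
  obtain ⟨σ, hσ, hσf, rfl⟩ := hc₁
  have := hI.map hσ hpE
  rwa [Set.image_singleton, Set.EqOn.image_eq_self fun b hb => hσf b (Or.inl hb),
    Set.EqOn.image_eq_self fun b hb => hσf b (Or.inr hb)] at this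

end IsFusionPair

end Abstract

/-! ### Moving the realizations of types, and generic conjugates -/

section Moving

variable {M : Type w}

theorem image_eq_of_fix {σ : Equiv.Perm M} {A : Set M} (h : ∀ a ∈ A, σ a = a) : σ '' A = A :=
  Set.EqOn.image_eq_self h

/-- Every type over a finite set `W` that is not realized in `W` has a realization `y` such that
`y` and `h y` are related by `R` over `W`. -/
def Moves (G : Subgroup (Equiv.Perm M)) (R : Set M → M → M → Prop) (h : Equiv.Perm M) : Prop :=
  ∀ W : Set M, W.Finite → ∀ x ∉ W, ∃ y, TypeEq G W x y ∧ R W y (h y)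

/-- The properties of a relation `R` that are needed to measure how far elements are moved. -/
structure IsMoveRel (G : Subgroup (Equiv.Perm M)) (I : Set M → Set M → Set M → Prop)
    (R : Set M → M → M → Prop) : Prop where
  map : ∀ {σ : Equiv.Perm M}, σ ∈ G → ∀ {W : Set M} {x y : M}, R W x y → R (σ '' W) (σ x) (σ y)
  symm : ∀ {W : Set M} {x y : M}, R W x y → R W y x
  reduce : ∀ {W D : Set M} {x y : M}, R D x y → I {x} W D → W ⊆ D → R W x y
  ne : ∀ {W : Set M} {x y : M}, R W x y → x ∉ W → x ≠ y

variable {G₁ G₂ : Subgroup (Equiv.Perm M)} {I : Set M → Set M → Set M → Prop}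
variable {R R' : Set M → M → M → Prop} {h k : Equiv.Perm M}

/-- Independence itself measures movement. -/
theorem IsIndependence.isMoveRel (hI : IsIndependence G₁ I) :
    IsMoveRel (G₁ ⊓ G₂) I fun W x y => I {x} W {y} where
  map {σ} hσ {W x y} h := by
    have := hI.map hσ.1 h
    rwa [Set.image_singleton, Set.image_singleton] at this
  symm h := hI.symm h
  reduce {W D x y} h h' hW := hI.trans h' h hW Set.subset_union_right Set.subset_union_right
  ne {W x y} h hx := by
    rintro rfl
    exact hx (hI.disj h rfl rfl)

section

variable [Countable M] (hF : IsFusionPair G₁ G₂) (hI : IsIndependence G₁ I)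
include hF hI

/-- The independent realization is found first and then replaced by a moved one of the same type
over `A ∪ E`, which preserves all that was achieved. The property `reduce` brings the movement back
from `A ∪ E` to `A`. -/
theorem Moves.exists_indep (hR : IsMoveRel (G₁ ⊓ G₂) I R) (hm : Moves (G₁ ⊓ G₂) R h)
    {A E : Set M} (hA : A.Finite) (hE : E.Finite) {x q : M} (hx : x ∉ A)
    (hq : TypeEq G₂ A x q) (hqE : q ∉ E) :
    ∃ c, TypeEq (G₁ ⊓ G₂) A x c ∧ I {c} A E ∧ TypeEq G₂ (A ∪ E) q c ∧ R (A ∪ E) c (h c) ∧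
      R A c (h c) := by
  obtain ⟨c, hc, hcI, hcq⟩ := hF.exists_indep hI hA hE hx hq hqE
  have hcA : c ∉ A ∪ E := hcq.notMem fun h => h.elim (hq.notMem hx) hqE
  obtain ⟨d, hd, hdR⟩ := hm (A ∪ E) (hA.union hE) c hcA
  have hdI : I {d} A E := by
    obtain ⟨σ, hσ, hσf, rfl⟩ := hd
    have := hI.map hσ.1 hcI
    rwa [Set.image_singleton, image_eq_of_fix fun b hb => hσf b (Or.inl hb),
      image_eq_of_fix fun b hb => hσf b (Or.inr hb)] at this
  have hd₂ : TypeEq G₂ (A ∪ E) c d := by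
    obtain ⟨σ, hσ, hσf⟩ := hd
    exact ⟨σ, hσ.2, hσf⟩
  refine ⟨d, hc.trans (hd.mono Set.subset_union_left), hdI, hcq.trans hd₂, hdR, ?_⟩
  exact hR.reduce hdR (hI.mono hdI Set.subset_union_left (by rw [Set.union_comm]))
    Set.subset_union_left

/-- If `c` realizes the type transported by `h⁻¹` and is moved by `h`, then `h c` realizes the
original type and `h⁻¹` takes it back to `c`. Symmetry of `R` turns the pair around; the base
changes from `h⁻¹(W)` to `W` by passing through the union `D` of both. -/
theorem Moves.inv (hR : IsMoveRel (G₁ ⊓ G₂) I R) (hh : h ∈ G₁ ⊓ G₂)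
    (hm : Moves (G₁ ⊓ G₂) R h) : Moves (G₁ ⊓ G₂) R h⁻¹ := by
  intro W hW x hx
  set h' : Equiv.Perm M := h⁻¹ with hh'
  set D : Set M := W ∪ h' '' W with hD
  have hDf : D.Finite := hW.union (hW.image _)
  have hx' : h' x ∉ h' '' W := by simpa using hx
  obtain ⟨q, hq, hqE⟩ := hF.exists_fresh hI (hW.image h') (hDf.union (hDf.image h')) hx'
  obtain ⟨c, hc, hcI, -, hcR, -⟩ := hm.exists_indep hF hI hR (hW.image h')
    (hDf.union (hDf.image h')) hx' hq hqE
  have hWD : h' '' W ⊆ D := Set.subset_union_right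
  have e : ∀ A : Set M, h '' (h' '' A) = A := fun A => by
    rw [Set.image_image]; simp [hh']
  have h1 : R D c (h c) := by
    refine hR.reduce hcR (hI.mono (hI.base hcI (B' := D) hWD (fun z hz => Or.inr (Or.inl hz)))
      Set.subset_union_left ?_) ?_
    · rintro z (hz | hz)
      · exact Or.inr (hWD hz)
      · exact Or.inl hz
    · exact fun z hz => Or.inr (Or.inl hz)
  have h2 : I {h c} W D := by
    have := hI.map hh.1 hcI
    rw [Set.image_singleton, e, Set.image_union, e] at this
    exact hI.mono_right this Set.subset_union_right
  refine ⟨h c, ?_, ?_⟩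
  · have := hc.map hh
    rw [e, hh', perm_apply_inv] at this
    exact this
  · rw [hh', perm_inv_apply]
    exact hR.reduce (hR.symm h1) h2 Set.subset_union_left

end

/-- A finite approximation to an element of the group `G` that satisfies `Good`. -/
structure Approximation (G : Subgroup (Equiv.Perm M)) (Good : Set M → Equiv.Perm M → Prop) where
  dom : Set M
  val : Equiv.Perm M
  finite : dom.Finite
  mem : val ∈ G
  good : Good dom val

instance (G : Subgroup (Equiv.Perm M)) (Good : Set M → Equiv.Perm M → Prop) :
    Preorder (Approximation G Good) where
  le c d := c.dom ⊆ d.dom ∧ Set.EqOn d.val c.val c.dom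
  le_refl c := ⟨subset_rfl, fun _ _ => rfl⟩
  le_trans c d e h h' := ⟨h.1.trans h'.1, fun x hx => (h'.2 (h.1 hx)).trans (h.2 hx)⟩

/-- Construction of group elements by finite approximations. -/
theorem exists_of_approximations [Countable M] (hF : IsFusionPair G₁ G₂)
    {Good : Set M → Equiv.Perm M → Prop}
    (hdom : ∀ (c : Approximation (G₁ ⊓ G₂) Good) (x : M), ∃ d, c ≤ d ∧ x ∈ d.dom)
    (hran : ∀ (c : Approximation (G₁ ⊓ G₂) Good) (y : M), ∃ d, c ≤ d ∧ y ∈ d.val '' d.dom)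
    {ι : Type*} [Countable ι] (T : ι → Approximation (G₁ ⊓ G₂) Good → Prop)
    (hT : ∀ i c, ∃ d, c ≤ d ∧ T i d) (init : Good ∅ 1) :
    ∃ a ∈ G₁ ⊓ G₂,
      (∀ A : Set M, A.Finite →
        ∃ c : Approximation (G₁ ⊓ G₂) Good, A ⊆ c.dom ∧ Set.EqOn a c.val c.dom) ∧
      ∀ i, ∃ c, T i c ∧ Set.EqOn a c.val c.dom := by
  obtain ⟨π, h₁, h₂, -⟩ := exists_perm_of_conditions Approximation.dom Approximation.val
    (fun h => h) hdom hran T hT ⟨∅, 1, Set.finite_empty, one_mem _, init⟩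
  refine ⟨π, ⟨hF.closed₁ π fun B hB => ?_, hF.closed₂ π fun B hB => ?_⟩, h₁, h₂⟩
  · obtain ⟨c, hc, hc'⟩ := h₁ B hB
    exact ⟨c.val, c.mem.1, hc'.mono hc⟩
  · obtain ⟨c, hc, hc'⟩ := h₁ B hB
    exact ⟨c.val, c.mem.2, hc'.mono hc⟩

/-- `Good` can be preserved when an element `x` is added to the domain of an approximation, by
prescribing the type of the image of `x` in the second structure. -/
def ExtendsForward (G₁ G₂ : Subgroup (Equiv.Perm M)) (h : Equiv.Perm M)
    (Good : Set M → Equiv.Perm M → Prop) : Prop :=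
  ∀ (A : Set M) (a : Equiv.Perm M) (x : M) (F : Set M), A.Finite → a ∈ G₁ ⊓ G₂ → Good A a →
    x ∉ A → F.Finite → ∃ (E : Set M) (q : M), E.Finite ∧ F ⊆ E ∧ q ∉ E ∧
      TypeEq G₂ (a '' A) (a x) q ∧ ∀ a' ∈ G₁ ⊓ G₂, Set.EqOn a' a A → TypeEq G₂ E q (a' x) →
        h (a' x) ≠ a' x → Good (insert x A) a'

/-- `Good` can be preserved when an element `y` is added to the range of an approximation. -/
def ExtendsBackward (G₁ G₂ : Subgroup (Equiv.Perm M)) (h : Equiv.Perm M)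
    (Good : Set M → Equiv.Perm M → Prop) : Prop :=
  ∀ (A : Set M) (a : Equiv.Perm M) (y : M) (F : Set M), A.Finite → a ∈ G₁ ⊓ G₂ → Good A a →
    y ∉ a '' A → F.Finite → ∃ (E : Set M) (q : M), E.Finite ∧ F ⊆ E ∧ q ∉ E ∧
      TypeEq G₂ A (a⁻¹ y) q ∧ ∀ a' ∈ G₁ ⊓ G₂, Set.EqOn a' a A → TypeEq G₂ E q (a'⁻¹ y) →
        h (a'⁻¹ y) ≠ a'⁻¹ y → Good (insert (a'⁻¹ y) A) a'

section

variable [Countable M] (hF : IsFusionPair G₁ G₂) (hI : IsIndependence G₁ I)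
variable {Good : Set M → Equiv.Perm M → Prop}
include hF hI

/-- Since `Good` constrains the new image only through its type in the second structure and through
its being moved by `h`, the first structure remains free to make it independent from `F`. -/
theorem ExtendsForward.exists_extension (hR : IsMoveRel (G₁ ⊓ G₂) I R)
    (hm : Moves (G₁ ⊓ G₂) R h) (fwd : ExtendsForward G₁ G₂ h Good) {A F : Set M}
    {a : Equiv.Perm M} {x : M} (hA : A.Finite) (ha : a ∈ G₁ ⊓ G₂) (hgood : Good A a)
    (hx : x ∉ A) (hFf : F.Finite) :
    ∃ a' ∈ G₁ ⊓ G₂, Set.EqOn a' a A ∧ Good (insert x A) a' ∧ R (a '' A) (a' x) (h (a' x)) ∧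
      I {a' x} (a '' A) F ∧ a' x ∉ F := by
  obtain ⟨E, q, hE, hFE, hqE, hq, hgood'⟩ := fwd A a x F hA ha hgood hx hFf
  have hx' : a x ∉ a '' A := by simpa using hx
  obtain ⟨c, ⟨σ, hσ, hσf, hσx⟩, hcI, hcq, -, hcR⟩ :=
    hm.exists_indep hF hI hR (hA.image a) hE hx' hq hqE
  have hEq : Set.EqOn (σ * a : Equiv.Perm M) a A := fun z hz => hσf _ ⟨z, hz, rfl⟩
  have hcE : c ∉ E := (hcq.mono Set.subset_union_right).notMem hqE
  have hcA : c ∉ a '' A := (hcq.mono Set.subset_union_left).notMem (hq.notMem hx')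
  refine ⟨σ * a, mul_mem hσ ha, hEq, ?_, ?_, ?_, ?_⟩
  · refine hgood' _ (mul_mem hσ ha) hEq ?_ ?_
    · rw [Equiv.Perm.mul_apply, hσx]; exact hcq.mono Set.subset_union_right
    · rw [Equiv.Perm.mul_apply, hσx]; exact (hR.ne hcR hcA).symm
  · rw [Equiv.Perm.mul_apply, hσx]; exact hcR
  · rw [Equiv.Perm.mul_apply, hσx]; exact hI.mono_right hcI hFE
  · rw [Equiv.Perm.mul_apply, hσx]; exact fun h => hcE (hFE h)

theorem ExtendsBackward.exists_extension (hR : IsMoveRel (G₁ ⊓ G₂) I R)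
    (hm : Moves (G₁ ⊓ G₂) R h) (bwd : ExtendsBackward G₁ G₂ h Good) {A F : Set M}
    {a : Equiv.Perm M} {y : M} (hA : A.Finite) (ha : a ∈ G₁ ⊓ G₂) (hgood : Good A a)
    (hy : y ∉ a '' A) (hFf : F.Finite) :
    ∃ a' ∈ G₁ ⊓ G₂, Set.EqOn a' a A ∧ Good (insert (a'⁻¹ y) A) a' ∧
      I {a'⁻¹ y} A F ∧ a'⁻¹ y ∉ F := by
  obtain ⟨E, q, hE, hFE, hqE, hq, hgood'⟩ := bwd A a y F hA ha hgood hy hFf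
  have hy' : a⁻¹ y ∉ A := fun h => hy ⟨_, h, perm_apply_inv a y⟩
  obtain ⟨c, ⟨σ, hσ, hσf, hσx⟩, hcI, hcq, -, hcR⟩ :=
    hm.exists_indep hF hI hR hA hE hy' hq hqE
  have hcE : c ∉ E := (hcq.mono Set.subset_union_right).notMem hqE
  have hcA : c ∉ A := (hcq.mono Set.subset_union_left).notMem (hq.notMem hy')
  have hmem : a * σ⁻¹ ∈ G₁ ⊓ G₂ := mul_mem ha (inv_mem hσ)
  have hEq : Set.EqOn (a * σ⁻¹ : Equiv.Perm M) a A := fun z hz => by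
    have : σ⁻¹ z = z := by rw [Equiv.Perm.inv_eq_iff_eq, hσf z hz]
    rw [Equiv.Perm.mul_apply, this]
  have hv : (a * σ⁻¹ : Equiv.Perm M)⁻¹ y = c := by
    rw [mul_inv_rev, inv_inv, Equiv.Perm.mul_apply, hσx]
  refine ⟨a * σ⁻¹, hmem, hEq, ?_, ?_, ?_⟩
  · refine hgood' _ hmem hEq ?_ ?_
    · rw [hv]; exact hcq.mono Set.subset_union_right
    · rw [hv]; exact (hR.ne hcR hcA).symm
  · rw [hv]; exact hI.mono_right hcI hFE
  · rw [hv]; exact fun h => hcE (hFE h)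

/-- For a generic element `a`, the product of `k` and the conjugate of `h` by `a` moves elements
further than `h` and `k` do. -/
theorem exists_moves_mul_conj (hR : IsMoveRel (G₁ ⊓ G₂) I R) (hR' : IsMoveRel (G₁ ⊓ G₂) I R')
    (comp : ∀ {A : Set M} {x y z : M}, R A x y → R A x z → I {z} (insert x A) {y} → R' A z y)
    (hk : k ∈ G₁ ⊓ G₂) (mh : Moves (G₁ ⊓ G₂) R h)
    (mk : Moves (G₁ ⊓ G₂) R k⁻¹) (congr : ∀ (A : Set M) (a a' : Equiv.Perm M), Set.EqOn a a' A → Good A a → Good A a')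
    (init : Good ∅ 1) (fwd : ExtendsForward G₁ G₂ h Good) (bwd : ExtendsBackward G₁ G₂ h Good) :
    ∃ a ∈ G₁ ⊓ G₂, Moves (G₁ ⊓ G₂) R' (k * (a⁻¹ * h * a)) ∧
      ∀ A : Set M, A.Finite → ∃ B, A ⊆ B ∧ Good B a := by
  have hdom : ∀ (c : Approximation (G₁ ⊓ G₂) Good) (x : M), ∃ d, c ≤ d ∧ x ∈ d.dom := by
    intro c x
    by_cases hx : x ∈ c.dom
    · exact ⟨c, le_rfl, hx⟩
    obtain ⟨a', ha', hEq, hg, -⟩ := fwd.exists_extension hF hI hR mh c.finite c.mem c.good hx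
      Set.finite_empty
    exact ⟨⟨insert x c.dom, a', c.finite.insert x, ha', hg⟩, ⟨Set.subset_insert _ _, hEq⟩,
      Set.mem_insert _ _⟩
  have hran : ∀ (c : Approximation (G₁ ⊓ G₂) Good) (y : M), ∃ d, c ≤ d ∧ y ∈ d.val '' d.dom := by
    intro c y
    by_cases hy : y ∈ c.val '' c.dom
    · exact ⟨c, le_rfl, hy⟩
    obtain ⟨a', ha', hEq, hg, -⟩ := bwd.exists_extension hF hI hR mh c.finite c.mem c.good hy
      Set.finite_empty
    exact ⟨⟨insert (a'⁻¹ y) c.dom, a', c.finite.insert _, ha', hg⟩, ⟨Set.subset_insert _ _, hEq⟩,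
      ⟨_, Set.mem_insert _ _, perm_apply_inv a' y⟩⟩
  have hdomset : ∀ (c : Approximation (G₁ ⊓ G₂) Good) (S : Set M), S.Finite →
      ∃ d, c ≤ d ∧ S ⊆ d.dom := by
    intro c S hS
    induction S, hS using Set.Finite.induction_on with
    | empty => exact ⟨c, le_rfl, by simp⟩
    | @insert s S _ _ ih =>
      obtain ⟨d, hd, hSd⟩ := ih
      obtain ⟨e, he, hs⟩ := hdom d s
      exact ⟨e, hd.trans he, Set.insert_subset hs (hSd.trans he.1)⟩
  -- This requirement decides the value of the product at a realization `x`: the point `r` will be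
  -- `a⁻¹ (h (a x))`.
  let T : Finset M × M → Approximation (G₁ ⊓ G₂) Good → Prop := fun i c =>
    i.2 ∉ i.1 → ∃ x r, TypeEq (G₁ ⊓ G₂) (i.1 : Set M) i.2 x ∧ x ∈ c.dom ∧ r ∈ c.dom ∧
      c.val r = h (c.val x) ∧ R' i.1 x (k r)
  have hT : ∀ i c, ∃ d, c ≤ d ∧ T i d := by
    rintro ⟨W₀, x₀⟩ c₀
    by_cases hx₀ : x₀ ∈ W₀
    · exact ⟨c₀, le_rfl, fun h => (h hx₀).elim⟩
    set W : Set M := (W₀ : Set M) with hWdef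
    have hW : W.Finite := W₀.finite_toSet
    have hx₀W : x₀ ∉ W := by simpa [hWdef] using hx₀
    -- The movement is first found over `A` and then transported by `k`, so that `W` must lie in
    -- both `A` and `k '' A`.
    obtain ⟨c, hc₀, hWc⟩ := hdomset c₀ (W ∪ (k⁻¹ : Equiv.Perm M) '' W) (hW.union (hW.image _))
    set A := c.dom with hAdef
    have hA : A.Finite := c.finite
    have hWA : W ⊆ A := fun z hz => hWc (Or.inl hz)
    have hWkA : W ⊆ k '' A := fun z hz =>
      ⟨k⁻¹ z, hWc (Or.inr ⟨z, hz, rfl⟩), perm_apply_inv k z⟩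
    obtain ⟨q, hq, hqE⟩ := hF.exists_fresh hI hW (hA.union (hA.image k)) hx₀W
    obtain ⟨x₁, hx₁, hx₁I, hx₁q⟩ :=
      hF.exists_indep hI hW (hA.union (hA.image k)) hx₀W hq hqE
    have hx₁A : x₁ ∉ A := fun h =>
      (hx₁q.mono Set.subset_union_right).notMem hqE (Or.inl h)
    obtain ⟨q', hq', hqE'⟩ := hF.exists_fresh hI hA (hA.image k) hx₁A
    -- The point `x` is far from `k⁻¹ x` over `A`; its independence from `k '' A` over `W` allows
    -- the final reduction of the base to `W`.
    obtain ⟨x, hx, hxI, -, -, hxR⟩ :=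
      mk.exists_indep hF hI hR hA (hA.image k) hx₁A hq' hqE'
    have hxA : x ∉ A := hx.notMem hx₁A
    have hxW : I {x} W A := by
      obtain ⟨σ, hσ, hσf, rfl⟩ := hx
      have := hI.map hσ.1 (hI.mono_right hx₁I Set.subset_union_left)
      rwa [Set.image_singleton, image_eq_of_fix fun b hb => hσf b (hWA hb),
        image_eq_of_fix hσf] at this
    have hxWk : I {x} W (k '' A) :=
      hI.trans hxW hxI hWA Set.subset_union_right Set.subset_union_right
    -- the image `t` of `x`
    obtain ⟨a', ha', hEq, hg, htR, -, htF⟩ := fwd.exists_extension hF hI hR mh hA c.mem c.good hxA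
      ((hA.image c.val).image (h⁻¹ : Equiv.Perm M))
    have hshift : h (a' x) ∉ a' '' insert x A := by
      rintro ⟨z, rfl | hz, hz'⟩
      · refine hR.ne htR ?_ hz'
        rw [← hEq.image_eq]
        simpa using hxA
      · exact htF ⟨a' z, ⟨z, hz, (hEq hz).symm⟩, by rw [hz', perm_inv_apply]⟩
    -- The preimage `r` of `h (a' x)` is taken independent from `k⁻¹ x` over `A` and `x`, as `comp`
    -- requires.
    obtain ⟨a'', ha'', hEq', hg', hrI, -⟩ := bwd.exists_extension hF hI hR mh (hA.insert x) ha' hg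
      hshift (Set.finite_singleton (k⁻¹ x))
    set r := a''⁻¹ (h (a' x)) with hr
    have hxr : R A x r := by
      have := hR.map (inv_mem ha'') htR
      have e1 : (a''⁻¹ : Equiv.Perm M) '' (c.val '' A) = A := by
        rw [← hEq.image_eq, ← (hEq'.mono (Set.subset_insert x A)).image_eq, Set.image_image]
        simp
      have e2 : a''⁻¹ (a' x) = x := by
        rw [← hEq' (Set.mem_insert x A), perm_inv_apply]
      rwa [e1, e2] at this
    -- Both `k⁻¹ x` and `r` are far from the middle point `x`, hence further from each other.
    -- Applying `k` compares `x` with `k r`, its image under the product.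
    have h1 : R' A r (k⁻¹ x) := comp hxR hxr hrI
    have h2 : R' (k '' A) x (k r) := by
      have := hR'.symm (hR'.map hk h1)
      rwa [perm_apply_inv] at this
    have h3 : R' W x (k r) := hR'.reduce h2 hxWk hWkA
    refine ⟨⟨insert r (insert x A), a'', (hA.insert x).insert r, ha'', hg'⟩, hc₀.trans ⟨?_, ?_⟩,
      fun _ => ⟨x, r, hx₁.trans (hx.mono hWA), ?_, ?_, ?_, h3⟩⟩
    · exact (Set.subset_insert _ _).trans (Set.subset_insert _ _)
    · intro z hz
      exact (hEq' (Set.mem_insert_of_mem _ hz)).trans (hEq hz)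
    · exact Or.inr (Or.inl rfl)
    · exact Or.inl rfl
    · change a'' r = h (a'' x)
      rw [hr, perm_apply_inv, hEq' (Set.mem_insert x A)]
  obtain ⟨a, ha, h₁, h₂⟩ := exists_of_approximations hF hdom hran T hT init
  refine ⟨a, ha, ?_, ?_⟩
  · intro W hW x hx
    obtain ⟨c, hc, hEq⟩ := h₂ (hW.toFinset, x)
    obtain ⟨y, r, hy, hyc, hrc, hyr, hyR⟩ := hc (by simpa using hx)
    rw [Set.Finite.coe_toFinset] at hy hyR
    refine ⟨y, hy, ?_⟩
    have : (k * (a⁻¹ * h * a)) y = k r := by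
      simp only [Equiv.Perm.mul_apply]
      rw [hEq hyc, ← hyr, ← hEq hrc, perm_inv_apply]
    rwa [this]
  · intro A hA
    obtain ⟨c, hc, hEq⟩ := h₁ A hA
    exact ⟨c.dom, hc, congr _ _ _ (fun z hz => (hEq hz).symm) c.good⟩

end

end Moving

/-! ### Independent copies of finite sets, and fullness -/

section Full

variable {M : Type w}
variable {G₁ G₂ : Subgroup (Equiv.Perm M)} {I : Set M → Set M → Set M → Prop}
variable {g : Equiv.Perm M} {X S : Set M}

/-- Let `g` move every type to an independent one. Then a finite set `S` that is independent from
`g(X)` over `X` has a copy over `X ∪ g(X)` that is independent from its image under `g`. The copy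
is constructed point by point, and the predicate `Q` may be used to control it in the second
structure. -/
theorem exists_indepPair_image [Countable M] (hF : IsFusionPair G₁ G₂) (hI : IsIndependence G₁ I)
    (hg : g ∈ G₁ ⊓ G₂) (hm : Moves (G₁ ⊓ G₂) (fun W x y => I {x} W {y}) g)
    (hX : X.Finite) (hS : S.Finite) (hSX : I S X (g '' X)) (Q : Set M → Equiv.Perm M → Prop)
    (hQ₀ : Q ∅ 1)
    (hQX : ∀ (S' : Set M) (a : Equiv.Perm M) (s : M), S' ⊆ S → s ∈ S → s ∈ X → a ∈ G₁ ⊓ G₂ →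
      (∀ z ∈ X ∪ g '' X, a z = z) → Q S' a → Q (insert s S') a)
    (hQ : ∀ (S' : Set M) (a : Equiv.Perm M) (s : M) (F : Set M), S' ⊆ S → s ∈ S → s ∉ S' →
      s ∉ X ∪ g '' X → a ∈ G₁ ⊓ G₂ → (∀ z ∈ X ∪ g '' X, a z = z) → Q S' a → F.Finite →
      I (a '' S' ∪ X) (g '' X) (g '' (a '' S')) →
      ∃ (E : Set M) (q : M), E.Finite ∧ F ⊆ E ∧ q ∉ E ∧
        TypeEq G₂ (X ∪ g '' X ∪ a '' S') (a s) q ∧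
        ∀ a' ∈ G₁ ⊓ G₂, (∀ z ∈ X ∪ g '' X, a' z = z) → Set.EqOn a' a S' → TypeEq G₂ E q (a' s) →
          Q (insert s S') a') :
    ∃ a ∈ G₁ ⊓ G₂, (∀ z ∈ X ∪ g '' X, a z = z) ∧ I (a '' S) X (g '' (a '' S) ∪ g '' X) ∧
      I (a '' S ∪ X) (g '' X) (g '' (a '' S)) ∧ Q S a := by
  set Y : Set M := g '' X with hYdef
  have hY : Y.Finite := hX.image _
  have key : ∀ S' : Set M, S'.Finite → S' ⊆ S → ∃ a ∈ G₁ ⊓ G₂, (∀ z ∈ X ∪ Y, a z = z) ∧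
      I (a '' S') X (g '' (a '' S') ∪ Y) ∧ I (a '' S' ∪ X) Y (g '' (a '' S')) ∧ Q S' a := by
    intro S' hS'
    induction S', hS' using Set.Finite.induction_on with
    | empty =>
      intro _
      refine ⟨1, one_mem _, fun _ _ => rfl, ?_, ?_, hQ₀⟩
      · rw [Set.image_empty]
        exact hI.mono_left (hI.self X _) (Set.empty_subset _)
      · rw [Set.image_empty, Set.image_empty]
        exact hI.mono_right (hI.symm (hI.self Y _)) (Set.empty_subset _)
    | @insert s S' hsS' hS' ih =>
      intro hsub
      obtain ⟨a, ha, hafix, h₁, h₂, hQa⟩ := ih ((Set.subset_insert _ _).trans hsub)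
      have hS'S : S' ⊆ S := (Set.subset_insert _ _).trans hsub
      have hs : s ∈ S := hsub (Set.mem_insert _ _)
      set U : Set M := a '' S' with hU
      set V : Set M := g '' U with hV
      by_cases hsX : s ∈ X
      · refine ⟨a, ha, hafix, ?_, ?_, hQX S' a s hS'S hs hsX ha hafix hQa⟩
        · rw [Set.image_insert_eq, hafix s (Or.inl hsX), Set.image_insert_eq]
          refine hI.mono h₁ (Set.insert_subset (Or.inr hsX) Set.subset_union_left) ?_
          rintro z ((rfl | hz) | hz)
          · exact Or.inl (Or.inr ⟨_, hsX, rfl⟩)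
          · exact Or.inl (Or.inl hz)
          · exact Or.inl (Or.inr hz)
        · rw [Set.image_insert_eq, hafix s (Or.inl hsX), Set.image_insert_eq]
          refine hI.mono h₂ ?_ ?_
          · rintro z ((rfl | hz) | hz)
            · exact Or.inl (Or.inr hsX)
            · exact Or.inl (Or.inl hz)
            · exact Or.inl (Or.inr hz)
          · rintro z (rfl | hz)
            · exact Or.inr ⟨_, hsX, rfl⟩
            · exact Or.inl hz
      have hsXY : s ∉ X ∪ Y := fun h => h.elim hsX fun h => hsX (hI.disj hSX hs h)
      have hUf : U.Finite := hS'.image _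
      have hVf : V.Finite := hUf.image _
      set E₀ : Set M := X ∪ Y ∪ U ∪ V with hE₀
      have hE₀f : E₀.Finite := ((hX.union hY).union hUf).union hVf
      have hXE : X ⊆ E₀ := fun z hz => Or.inl (Or.inl (Or.inl hz))
      have hYE : Y ⊆ E₀ := fun z hz => Or.inl (Or.inl (Or.inr hz))
      have hUE : U ⊆ E₀ := fun z hz => Or.inl (Or.inr hz)
      have hVE : V ⊆ E₀ := fun z hz => Or.inr hz
      -- The set `g⁻¹(E₀)` is included because independence of `u` from it becomes, after applying
      -- `g`, independence of `g u` from `E₀`.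
      obtain ⟨E, q, hE, hFE, hqE, hq, hQ'⟩ := hQ S' a s (E₀ ∪ (g⁻¹ : Equiv.Perm M) '' E₀)
        hS'S hs hsS' hsXY ha hafix hQa (hE₀f.union (hE₀f.image _)) h₂
      have hE₀E : E₀ ⊆ E := Set.subset_union_left.trans hFE
      have hgE : E₀ ⊆ g '' E := fun z hz =>
        ⟨g⁻¹ z, hFE (Or.inr ⟨z, hz, rfl⟩), perm_apply_inv g z⟩
      have hbf : (X ∪ Y ∪ U).Finite := (hX.union hY).union hUf
      have has : a s ∉ X ∪ Y ∪ U := by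
        rintro (h | ⟨z, hz, hz'⟩)
        · exact hsXY (a.injective (hafix _ h) ▸ h)
        · exact hsS' (a.injective hz' ▸ hz)
      obtain ⟨u, ⟨c, hc, hcfix, hcu⟩, huI, huq, huR, -⟩ := hm.exists_indep hF hI hI.isMoveRel hbf hE
        has hq hqE
      -- The set `Y` can be dropped from the base because `S` is independent from `Y` over `X`,
      -- which passes to the copy.
      have hXU : I {u} (X ∪ U) (X ∪ Y ∪ U) := by
        have h1 : I {s} (X ∪ S') Y := hI.mono_left (hI.base_left (hI.mono_left hSX hsub)
          (B' := X ∪ S') Set.subset_union_left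
          (by rintro z (hz | hz); exacts [Or.inl hz, Or.inr (Or.inr hz)])) (by simp)
        have h2 := hI.map (mul_mem hc ha).1 h1
        have hX' : (c * a : Equiv.Perm M) '' X = X := image_eq_of_fix fun z hz => by
          rw [Equiv.Perm.mul_apply, hafix z (Or.inl hz), hcfix z (Or.inl (Or.inl hz))]
        have hY' : (c * a : Equiv.Perm M) '' Y = Y := image_eq_of_fix fun z hz => by
          rw [Equiv.Perm.mul_apply, hafix z (Or.inr hz), hcfix z (Or.inl (Or.inr hz))]
        have hU' : (c * a : Equiv.Perm M) '' S' = U := Set.image_congr fun z hz => by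
          rw [Equiv.Perm.mul_apply, hcfix _ (Or.inr ⟨z, hz, rfl⟩)]
        rw [Set.image_singleton, Equiv.Perm.mul_apply, hcu, Set.image_union, hX', hY', hU'] at h2
        refine hI.mono h2 Set.subset_union_left ?_
        rintro z ((hz | hz) | hz)
        exacts [Or.inr (Or.inl hz), Or.inl hz, Or.inr (Or.inr hz)]
      have hsub₁ : X ∪ U ⊆ X ∪ Y ∪ U := by
        rintro z (hz | hz)
        exacts [Or.inl (Or.inl hz), Or.inr hz]
      -- `u` is independent from everything over `X ∪ U`
      have hA : I {u} (X ∪ U) (E ∪ {g u}) := by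
        refine hI.trans hXU (hI.trans huI huR Set.subset_union_left subset_rfl
          (C' := E ∪ {g u}) ?_) hsub₁ Set.subset_union_right Set.subset_union_right
        rintro z (hz | hz)
        exacts [Or.inl (Or.inr hz), Or.inr hz]
      have hB₀ : I {g u} (Y ∪ V) E₀ := by
        have := hI.map hg.1 (hI.mono_right hA Set.subset_union_left)
        rw [Set.image_singleton, Set.image_union] at this
        exact hI.mono_right this hgE
      have hE₀u : I {g u} E₀ {u} := by
        refine hI.symm (hI.mono_right (hI.base hA (B' := E₀) (Set.union_subset hXE hUE) ?_)
          Set.subset_union_right)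
        exact fun z hz => Or.inr (Or.inl (hE₀E hz))
      have hB : I {g u} (Y ∪ V) (E₀ ∪ {u}) :=
        hI.trans hB₀ hE₀u (Set.union_subset hYE hVE) Set.subset_union_right subset_rfl
      have hEq : Set.EqOn (c * a : Equiv.Perm M) a S' := fun z hz =>
        hcfix _ (Or.inr ⟨z, hz, rfl⟩)
      have hfix : ∀ z ∈ X ∪ Y, (c * a) z = z := fun z hz => by
        rw [Equiv.Perm.mul_apply, hafix z hz, hcfix z (Or.inl hz)]
      have himg : (c * a : Equiv.Perm M) '' insert s S' = insert u U := by
        rw [Set.image_insert_eq, hEq.image_eq, Equiv.Perm.mul_apply, hcu]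
      refine ⟨c * a, mul_mem hc ha, hfix, ?_, ?_, hQ' _ (mul_mem hc ha) hfix hEq ?_⟩
      · rw [himg, Set.image_insert_eq]
        have k₁ : I (V ∪ Y ∪ {g u}) X U := by
          refine hI.trans_left (hI.symm h₁) (B' := X ∪ (V ∪ Y)) (A := {g u})
            (hI.mono_right (hI.base hB (B' := X ∪ (V ∪ Y)) ?_ ?_) (C' := U) ?_)
            Set.subset_union_left subset_rfl ?_
          · rintro z (hz | hz)
            exacts [Or.inr (Or.inr hz), Or.inr (Or.inl hz)]
          · rintro z (hz | hz | hz)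
            exacts [Or.inr (Or.inl (hXE hz)), Or.inl (Or.inr hz), Or.inl (Or.inl hz)]
          · exact fun z hz => Or.inl (hUE hz)
          · rintro z (hz | hz)
            exacts [Or.inl (Or.inr hz), Or.inr hz]
        have k₂ : I (V ∪ Y ∪ {g u}) (X ∪ U) {u} := by
          refine hI.symm (hI.mono_right hA ?_)
          rintro z ((hz | hz) | hz)
          exacts [Or.inl (hE₀E (hVE hz)), Or.inl (hE₀E (hYE hz)), Or.inr hz]
        refine hI.mono (hI.symm (hI.trans k₁ k₂ Set.subset_union_left subset_rfl
          (C' := insert u U) ?_)) Set.subset_union_left ?_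
        · rintro z (rfl | hz)
          exacts [Or.inr rfl, Or.inl (Or.inr hz)]
        · rintro z ((rfl | hz) | hz)
          exacts [Or.inl (Or.inr rfl), Or.inl (Or.inl (Or.inl hz)), Or.inl (Or.inl (Or.inr hz))]
      · rw [himg, Set.image_insert_eq]
        have k₁ : I V Y (insert u U ∪ X) := by
          refine hI.trans (hI.symm h₂) (B' := Y ∪ (U ∪ X)) (C := {u})
            (hI.symm (hI.mono_right (hI.base hA (B' := Y ∪ (U ∪ X)) ?_ ?_) (C' := V) ?_))
            Set.subset_union_left subset_rfl ?_
          · rintro z (hz | hz)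
            exacts [Or.inr (Or.inr hz), Or.inr (Or.inl hz)]
          · rintro z (hz | hz | hz)
            exacts [Or.inr (Or.inl (hE₀E (hYE hz))), Or.inl (Or.inr hz), Or.inl (Or.inl hz)]
          · exact fun z hz => Or.inl (hE₀E (hVE hz))
          · rintro z ((rfl | hz) | hz)
            exacts [Or.inr rfl, Or.inl (Or.inr (Or.inl hz)), Or.inl (Or.inr (Or.inr hz))]
        refine hI.trans (hI.symm k₁) (B' := Y ∪ V) (C := {g u})
          (hI.symm (hI.mono_right hB ?_)) Set.subset_union_left subset_rfl ?_
        · rintro z ((rfl | hz) | hz)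
          exacts [Or.inr rfl, Or.inl (hUE hz), Or.inl (hXE hz)]
        · rintro z (rfl | hz)
          exacts [Or.inr rfl, Or.inl (Or.inr hz)]
      · rw [Equiv.Perm.mul_apply, hcu]
        exact huq.mono Set.subset_union_right
  exact key S hS subset_rfl

/-- The tuple version of moving independently, for finite sets in place of tuples. -/
theorem Moves.exists_indepPair [Countable M] (hF : IsFusionPair G₁ G₂) (hI : IsIndependence G₁ I)
    (hg : g ∈ G₁ ⊓ G₂) (hm : Moves (G₁ ⊓ G₂) (fun W x y => I {x} W {y}) g)
    (hX : X.Finite) (hS : S.Finite) :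
    ∃ a ∈ G₁ ⊓ G₂, (∀ z ∈ X, a z = z) ∧
      IndepPair I (a '' S) X (g '' X) (g '' (a '' S)) := by
  -- A first copy over `X` provides the hypothesis of `exists_indepPair_image`. Nothing has to be
  -- controlled in the second structure, so `Q` is trivial there.
  obtain ⟨b, hb, hbX, hbI⟩ : ∃ b ∈ G₁ ⊓ G₂, (∀ z ∈ X, b z = z) ∧ I (b '' S) X (g '' X) := by
    induction S, hS using Set.Finite.induction_on with
    | empty =>
      refine ⟨1, one_mem _, fun _ _ => rfl, ?_⟩
      rw [Set.image_empty]
      exact hI.mono_left (hI.self X _) (Set.empty_subset _)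
    | @insert s S hsS hS ih =>
      obtain ⟨b, hb, hbX, hbI⟩ := ih
      by_cases hs : b s ∈ X ∪ b '' S
      · refine ⟨b, hb, hbX, hI.mono hbI ?_ Set.subset_union_left⟩
        rw [Set.image_insert_eq]
        exact Set.insert_subset (by rwa [Set.union_comm]) Set.subset_union_left
      have hf : (X ∪ b '' S).Finite := hX.union (hS.image _)
      obtain ⟨q, hq, hqE⟩ := hF.exists_fresh hI hf (hX.image g) hs
      obtain ⟨c, ⟨σ, hσ, hσf, rfl⟩, hcI, -⟩ := hF.exists_indep hI hf (hX.image g) hs hq hqE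
      refine ⟨σ * b, mul_mem hσ hb, fun z hz => ?_, ?_⟩
      · rw [Equiv.Perm.mul_apply, hbX z hz, hσf z (Or.inl hz)]
      · refine hI.trans_left hbI hcI Set.subset_union_left subset_rfl ?_
        rw [Set.image_insert_eq, Equiv.Perm.mul_apply]
        rintro z (rfl | ⟨s', hs', rfl⟩)
        · exact Or.inr rfl
        · rw [Equiv.Perm.mul_apply, hσf _ (Or.inr ⟨s', hs', rfl⟩)]
          exact Or.inl (Or.inr ⟨s', hs', rfl⟩)
  obtain ⟨a, ha, hafix, h₁, h₂, -⟩ := exists_indepPair_image hF hI hg hm hX (hS.image b) hbI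
    (fun _ _ => True) trivial (fun _ _ _ _ _ _ _ _ _ => trivial)
    (fun S' a s F _ _ hsS' hsX ha hfix _ hFf _ => by
      by_cases hfin : S'.Finite
      · obtain ⟨q, hq, hqF⟩ := hF.exists_fresh hI
          ((hX.union (hX.image g)).union (hfin.image a)) hFf (x := a s) (by
            rintro (h | ⟨z, hz, hz'⟩)
            · exact hsX (a.injective (hfix _ h) ▸ h)
            · exact hsS' (a.injective hz' ▸ hz))
        exact ⟨F, q, hFf, subset_rfl, hqF, hq, fun _ _ _ _ _ => trivial⟩
      · exact (hfin ((hS.image b).subset ‹_›)).elim)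
  refine ⟨a * b, mul_mem ha hb, fun z hz => ?_, ?_⟩
  · rw [Equiv.Perm.mul_apply, hbX z hz, hafix z (Or.inl hz)]
  · rw [Equiv.Perm.coe_mul, Set.image_comp]
    exact ⟨h₂, h₁⟩

/-- The relation `r` is a tournament, `G₂` is its automorphism group, and isomorphisms between
finite subtournaments extend to automorphisms. -/
structure IsHomogeneousTournament (G₂ : Subgroup (Equiv.Perm M)) (r : M → M → Prop) : Prop where
  irrefl : ∀ x, ¬ r x x
  asymm : ∀ {x y}, r x y → ¬ r y x
  total : ∀ {x y}, x ≠ y → r x y ∨ r y x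
  mem_iff : ∀ {σ : Equiv.Perm M}, σ ∈ G₂ ↔ ∀ x y, r (σ x) (σ y) ↔ r x y
  extend : ∀ {A : Set M}, A.Finite → ∀ φ : M → M, Set.InjOn φ A →
    (∀ x ∈ A, ∀ y ∈ A, r x y → r (φ x) (φ y)) → ∃ σ ∈ G₂, Set.EqOn σ φ A

namespace IsHomogeneousTournament

variable {r : M → M → Prop} (hr : IsHomogeneousTournament G₂ r)
include hr

theorem not_iff {x y : M} (h : x ≠ y) : ¬ r x y ↔ r y x :=
  ⟨fun h' => (hr.total h).resolve_left h', fun h' => hr.asymm h'⟩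

theorem ne {x y : M} (h : r x y) : x ≠ y := by
  rintro rfl
  exact hr.irrefl _ h

/-- Types over a finite set are determined by the relation to its elements. -/
theorem typeEq {A : Set M} (hA : A.Finite) {x y : M} (hx : x ∉ A) (hy : y ∉ A)
    (h : ∀ a ∈ A, r x a ↔ r y a) : TypeEq G₂ A x y := by
  classical
  have hne : ∀ a ∈ A, a ≠ x := fun a ha e => hx (e ▸ ha)
  have hne' : ∀ a ∈ A, a ≠ y := fun a ha e => hy (e ▸ ha)
  obtain ⟨φ, hφx, hφ⟩ : ∃ φ : M → M, φ x = y ∧ ∀ a ∈ A, φ a = a :=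
    ⟨fun z => if z = x then y else z, if_pos rfl, fun a ha => if_neg (hne a ha)⟩
  obtain ⟨σ, hσ, hσA⟩ := hr.extend (hA.insert x) φ (by
    rintro z (rfl | hz) z' (rfl | hz') e
    · rfl
    · rw [hφx, hφ _ hz'] at e
      exact (hne' _ hz' e.symm).elim
    · rw [hφx, hφ _ hz] at e
      exact (hne' _ hz e).elim
    · rwa [hφ _ hz, hφ _ hz'] at e) (by
    rintro z (rfl | hz) z' (rfl | hz') e
    · exact (hr.irrefl _ e).elim
    · rw [hφx, hφ _ hz']
      exact (h _ hz').1 e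
    · rw [hφx, hφ _ hz]
      rw [← hr.not_iff (hne' _ hz).symm, ← h _ hz, hr.not_iff (hne _ hz).symm]
      exact e
    · rwa [hφ _ hz, hφ _ hz'])
  exact ⟨σ, hσ, fun a ha => by rw [hσA (Or.inr ha), hφ a ha], by rw [hσA (Or.inl rfl), hφx]⟩

theorem iff_of_typeEq {A : Set M} {x y a : M} (h : TypeEq G₂ A x y) (ha : a ∈ A) :
    r x a ↔ r y a := by
  obtain ⟨σ, hσ, hσA, rfl⟩ := h
  conv_rhs => rw [← hσA a ha]
  exact (hr.mem_iff.1 hσ x a).symm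

theorem iff_of_typeEq' {A : Set M} {x y a : M} (h : TypeEq G₂ A x y) (ha : a ∈ A) :
    r a x ↔ r a y := by
  obtain ⟨σ, hσ, hσA, rfl⟩ := h
  conv_rhs => rw [← hσA a ha]
  exact (hr.mem_iff.1 hσ a x).symm

end IsHomogeneousTournament

/-- Let `S` be independent from its image under `τ g`, where `τ` fixes `g(X)`. If a copy `a(S)` of
`S` is independent from its image under `g` and has the right relations to it in the second
structure, then the two pairs have the same type. -/
theorem exists_conj_eq [Countable M] (hF : IsFusionPair G₁ G₂) (hI : IsIndependence G₁ I)
    {r : M → M → Prop} (hr : IsHomogeneousTournament G₂ r)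
    (hg : g ∈ G₁ ⊓ G₂) (hX : X.Finite) (hS : S.Finite) {τ a : Equiv.Perm M} (hτ : τ ∈ G₁ ⊓ G₂)
    (hτf : ∀ z ∈ g '' X, τ z = z) (hpair : IndepPair I S X (g '' X) ((τ * g) '' S))
    (ha : a ∈ G₁ ⊓ G₂) (haf : ∀ z ∈ X ∪ g '' X, a z = z)
    (h₂ : I (a '' S ∪ X) (g '' X) (g '' (a '' S)))
    (hQ : ∀ s ∈ S, ∀ c ∈ X ∪ S, r ((τ * g) s) c → r (g (a s)) (a c))
    (hQ' : ∀ s ∈ S, ∀ c ∈ X ∪ S, r c ((τ * g) s) → r (a c) (g (a s))) :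
    ∃ b ∈ G₁ ⊓ G₂, (∀ z ∈ X ∪ g '' X, b z = z) ∧ ∀ s ∈ S, g (b s) = b ((τ * g) s) := by
  set Y : Set M := g '' X with hYdef
  have hY : Y.Finite := hX.image _
  set η : Equiv.Perm M := τ * g with hη
  -- This element fixes `Y` and takes `a (η s)` to `g (a s)`. Both `a (η S)` and `g (a S)` are
  -- independent from `a S ∪ X` over `Y`, so stationarity yields a `σ` in `G₁` that acts in the same
  -- way and also fixes `a S ∪ X`.
  set ψ : Equiv.Perm M := g * a * g⁻¹ * τ⁻¹ * a⁻¹ with hψ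
  have hψG : ψ ∈ G₁ ⊓ G₂ :=
    mul_mem (mul_mem (mul_mem (mul_mem hg ha) (inv_mem hg)) (inv_mem hτ)) (inv_mem ha)
  have hψη : ∀ s, ψ (a (η s)) = g (a s) := fun s => by
    simp [hψ, hη]
  have hψY : ∀ y ∈ Y, ψ y = y := by
    rintro _ ⟨x, hx, rfl⟩
    have e1 : a⁻¹ (g x) = g x := by
      rw [Equiv.Perm.inv_eq_iff_eq, haf _ (Or.inr ⟨x, hx, rfl⟩)]
    have e2 : τ⁻¹ (g x) = g x := by
      rw [Equiv.Perm.inv_eq_iff_eq, hτf _ ⟨x, hx, rfl⟩]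
    simp only [hψ, Equiv.Perm.mul_apply]
    rw [e1, e2, perm_inv_apply, haf x (Or.inl hx)]
  have haX : a '' X = X := image_eq_of_fix fun z hz => haf z (Or.inl hz)
  have haY : a '' Y = Y := image_eq_of_fix fun z hz => haf z (Or.inr hz)
  have i₁ : I (a '' (η '' S)) Y (a '' S ∪ X) := by
    have := hI.symm (hI.map ha.1 hpair.1)
    rwa [Set.image_union, haX, haY] at this
  have hψimg : ψ '' (a '' (η '' S)) = g '' (a '' S) := by
    simp only [Set.image_image, hψη]
  obtain ⟨σ, hσ, hσf, hσψ⟩ := hI.stat_set hY ((hS.image a).union hX)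
    ((hS.image η).image a) hψG.1 hψY i₁ (by rw [hψimg]; exact hI.symm h₂)
  have mixed : ∀ s ∈ S, ∀ c ∈ Y ∪ (a '' S ∪ X),
      (r (a (η s)) c → r (g (a s)) c) ∧ (r c (a (η s)) → r c (g (a s))) := by
    have key : ∀ s ∈ S, ∀ c ∈ X ∪ S,
        (r (a (η s)) (a c) → r (g (a s)) (a c)) ∧ (r (a c) (a (η s)) → r (a c) (g (a s))) := by
      intro s hs c hc
      rw [hr.mem_iff.1 ha.2, hr.mem_iff.1 ha.2]
      exact ⟨hQ s hs c hc, hQ' s hs c hc⟩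
    rintro s hs c (hc | ⟨c, hc, rfl⟩ | hc)
    · rw [← hψη s]
      constructor
      · intro h
        have := (hr.mem_iff.1 hψG.2 _ _).2 h
        rwa [hψY c hc] at this
      · intro h
        have := (hr.mem_iff.1 hψG.2 _ _).2 h
        rwa [hψY c hc] at this
    · exact key s hs c (Or.inr hc)
    · have := key s hs c (Or.inl hc)
      rwa [haf c (Or.inl hc)] at this
  -- On this set `σ` preserves the tournament too: it is the identity on the first part, it is `ψ`
  -- on the second, and `mixed` treats pairs across. Hence the fusion has an element with the same
  -- action.
  obtain ⟨ρ, hρ, hρσ⟩ := hr.extend (A := (Y ∪ (a '' S ∪ X)) ∪ a '' (η '' S))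
    ((hY.union ((hS.image a).union hX)).union ((hS.image η).image a)) σ σ.injective.injOn (by
      rintro x (hx | hx) y (hy | hy) hxy
      · rwa [hσf x hx, hσf y hy]
      · rw [hσf x hx, hσψ y hy]
        obtain ⟨_, ⟨s, hs, rfl⟩, rfl⟩ := hy
        rw [hψη]
        exact (mixed s hs x hx).2 hxy
      · rw [hσf y hy, hσψ x hx]
        obtain ⟨_, ⟨s, hs, rfl⟩, rfl⟩ := hx
        rw [hψη]
        exact (mixed s hs y hy).1 hxy
      · rw [hσψ x hx, hσψ y hy]
        exact (hr.mem_iff.1 hψG.2 _ _).2 hxy)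
  obtain ⟨b, hb, hbσ⟩ := hF.exists_mem_inf
    ((hY.union ((hS.image a).union hX)).union ((hS.image η).image a)) hσ hρ hρσ.symm
  refine ⟨b * a, mul_mem hb ha, fun z hz => ?_, fun s hs => ?_⟩
  · have hz' : z ∈ Y ∪ (a '' S ∪ X) := hz.elim (fun h => Or.inr (Or.inr h)) Or.inl
    rw [Equiv.Perm.mul_apply, haf z hz, hbσ (Or.inl hz'), hσf z hz']
  · have hs' : a s ∈ Y ∪ (a '' S ∪ X) := Or.inr (Or.inl ⟨s, hs, rfl⟩)
    have hs'' : a (η s) ∈ a '' (η '' S) := ⟨_, ⟨s, hs, rfl⟩, rfl⟩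
    rw [Equiv.Perm.mul_apply, Equiv.Perm.mul_apply, hbσ (Or.inl hs'), hσf _ hs',
      hbσ (Or.inr hs''), hσψ _ hs'', hψη]

/-- The set `X` is full for `g`, formulated for finite sets in place of tuples. -/
def FullFor (G : Subgroup (Equiv.Perm M)) (I : Set M → Set M → Set M → Prop) (r : M → M → Prop)
    (g : Equiv.Perm M) (X : Set M) : Prop :=
  ∀ (S : Set M) (τ : Equiv.Perm M), S.Finite → τ ∈ G → (∀ z ∈ g '' X, τ z = z) →
    (∀ s ∈ S, r s ((τ * g) s)) → IndepPair I S X (g '' X) ((τ * g) '' S) →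
    ∃ b ∈ G, (∀ z ∈ X ∪ g '' X, b z = z) ∧ ∀ s ∈ S, g (b s) = b ((τ * g) s)

/-- In the definition of fullness one may restrict to sets disjoint from `X`. -/
theorem FullFor.of_disjoint (hI : IsIndependence G₁ I) {r : M → M → Prop}
    (h : ∀ (S : Set M) (τ : Equiv.Perm M), S.Finite → S ∩ X = ∅ → τ ∈ G₁ ⊓ G₂ →
      (∀ z ∈ g '' X, τ z = z) → (∀ s ∈ S, r s ((τ * g) s)) →
      IndepPair I S X (g '' X) ((τ * g) '' S) →
      ∃ b ∈ G₁ ⊓ G₂, (∀ z ∈ X ∪ g '' X, b z = z) ∧ ∀ s ∈ S, g (b s) = b ((τ * g) s)) :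
    FullFor (G₁ ⊓ G₂) I r g X := by
  intro S τ hS hτ hτf hr hp
  obtain ⟨b, hb, hbf, hbS⟩ := h (S \ X) τ hS.sdiff (by ext; simp) hτ hτf
    (fun s hs => hr s hs.1)
    ⟨hI.mono_left (hI.mono_right hp.1 (Set.image_mono Set.sdiff_subset))
      (Set.union_subset_union_left _ Set.sdiff_subset),
     hI.mono_left (hI.mono_right hp.2 (Set.union_subset_union_left _
      (Set.image_mono Set.sdiff_subset))) Set.sdiff_subset⟩
  refine ⟨b, hb, hbf, fun s hs => ?_⟩
  by_cases hsX : s ∈ X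
  · have : (τ * g) s = g s := hτf _ ⟨s, hsX, rfl⟩
    rw [this, hbf s (Or.inl hsX), hbf _ (Or.inr ⟨s, hsX, rfl⟩)]
  · exact hbS s ⟨hs, hsX⟩

end Full

/-! ### Fullness in tournament expansions -/

section Tournament

variable {M : Type w}
variable {G₁ G₂ : Subgroup (Equiv.Perm M)} {I : Set M → Set M → Set M → Prop}
variable {r : M → M → Prop} {g h : Equiv.Perm M} {X : Set M}

/-- The extension property of the random tournament. -/
def HasTournamentExtension (r : M → M → Prop) : Prop :=
  ∀ A B : Set M, A.Finite → B.Finite → Disjoint A B →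
    ∃ x, x ∉ A ∪ B ∧ (∀ a ∈ A, r x a) ∧ ∀ b ∈ B, r b x

theorem HasTournamentExtension.exists_point (hext : HasTournamentExtension r) {E : Set M}
    (hE : E.Finite) (D : M → Prop) : ∃ q, q ∉ E ∧ ∀ b ∈ E, (D b → r q b) ∧ (¬ D b → r b q) := by
  obtain ⟨q, hq, h₁, h₂⟩ := hext {b ∈ E | D b} {b ∈ E | ¬ D b} (hE.subset (Set.sep_subset _ _))
    (hE.subset (Set.sep_subset _ _)) (Set.disjoint_left.2 fun b hb hb' => hb'.2 hb.2)
  refine ⟨q, fun h => hq ?_, fun b hb => ⟨fun h => h₁ b ⟨hb, h⟩, fun h => h₂ b ⟨hb, h⟩⟩⟩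
  by_cases hD : D q
  exacts [Or.inl ⟨h, hD⟩, Or.inr ⟨h, hD⟩]

/-- The copy of `S` is built point by point. The image `t` of `s` must relate to `X ∪ Y ∪ U` as `s`
does, `g t` must relate to `X ∪ U` as `η s` does, and `t` must relate to the points `g (a s')` as
`s` does to `η s'`. The second demand is one on the relations of `t` to `g⁻¹(X ∪ U)`. A random
tournament satisfies all of them at once if they agree wherever the three sets meet. -/
theorem fullFor_tournament [Countable M] (hF : IsFusionPair G₁ G₂) (hI : IsIndependence G₁ I)
    (hr : IsHomogeneousTournament G₂ r) (hext : HasTournamentExtension r)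
    (hg : g ∈ G₁ ⊓ G₂) (hm : Moves (G₁ ⊓ G₂) (fun W x y => I {x} W {y}) g)
    (hgr : ∀ x, r x (g x)) (hX : X.Finite) (hnice : ∀ x, x ∈ g '' X → g x ∈ X → x ∈ X) :
    FullFor (G₁ ⊓ G₂) I r g X := by
  refine FullFor.of_disjoint hI fun S τ hS hSX hτ hτf hrS hp => ?_
  set Y : Set M := g '' X with hYdef
  have hY : Y.Finite := hX.image _
  set η : Equiv.Perm M := τ * g with hη
  have hηG : η ∈ G₁ ⊓ G₂ := mul_mem hτ hg
  have hSY : ∀ s ∈ S, s ∉ X ∪ Y := fun s hs h => by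
    have hsX : s ∉ X := fun h' => by
      have : s ∈ S ∩ X := ⟨hs, h'⟩
      rw [hSX] at this
      exact this
    exact h.elim hsX fun h => hsX (hI.disj hp.2 hs (Or.inr h))
  have hgg : ∀ x, g (g x) ≠ x := fun x e => hr.asymm (hgr x) (by
    have := hgr (g x)
    rwa [e] at this)
  have hpres : ∀ x y, r (g x) (g y) ↔ r x y := hr.mem_iff.1 hg.2
  have hpresη : ∀ x y, r (η x) (η y) ↔ r x y := hr.mem_iff.1 hηG.2
  obtain ⟨a, ha, haf, -, h₂, hQa, -⟩ := exists_indepPair_image hF hI hg hm hX hS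
    (hI.mono_right hp.2 Set.subset_union_right)
    -- Only the first clause is wanted in the end. The inequalities in the others keep the demands
    -- made on later points from colliding.
    (fun S' a => (∀ s ∈ S', ∀ c ∈ X ∪ S', (r (η s) c → r (g (a s)) (a c)) ∧
        (r c (η s) → r (a c) (g (a s)))) ∧
      (∀ s ∈ S', a s ∉ g '' Y ∧ g (g (a s)) ∉ X) ∧ ∀ s ∈ S', ∀ c ∈ S', a c ≠ g (g (a s)))
    (by simp)
    (fun S' a s _ hs hsX _ _ _ => (hSY s hs (Or.inl hsX)).elim)
    (by
      intro S' a s F hS'S hs hsS' hsXY ha haf hQa hFf hind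
      obtain ⟨hQ₁, hQ₂, hQ₃⟩ := hQa
      have hS' : S'.Finite := hS.subset hS'S
      have hpresa : ∀ x y, r (a x) (a y) ↔ r x y := hr.mem_iff.1 ha.2
      have haS : ∀ c ∈ S', a c ∉ X ∪ Y := fun c hc h =>
        hSY c (hS'S hc) (a.injective (haf _ h) ▸ h)
      have F13 : ∀ c ∈ X ∪ Y ∪ S', ∀ s' ∈ S', a c ≠ g (a s') := by
        intro c hc s' hs' e
        have hmem : g (a s') ∈ g '' (a '' S') := ⟨_, ⟨s', hs', rfl⟩, rfl⟩
        have hnY : g (a s') ∉ Y := by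
          rintro ⟨x, hx, hx'⟩
          exact haS s' hs' (Or.inl (g.injective hx' ▸ hx))
        rcases hc with (hc | hc) | hc
        · rw [haf c (Or.inl hc)] at e
          exact hnY (hI.disj hind (Or.inr (e ▸ hc)) hmem)
        · rw [haf c (Or.inr hc)] at e
          exact hnY (e ▸ hc)
        · exact hnY (hI.disj hind (Or.inl (e ▸ ⟨c, hc, rfl⟩)) hmem)
      have F23 : ∀ c ∈ X ∪ S', ∀ s' ∈ S', g⁻¹ (a c) ≠ g (a s') := by
        intro c hc s' hs' e
        rw [Equiv.Perm.inv_eq_iff_eq] at e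
        rcases hc with hc | hc
        · rw [haf c (Or.inl hc)] at e
          exact (hQ₂ s' hs').2 (e ▸ hc)
        · exact hQ₃ s' hs' c hc e
      -- The only collision that can occur. For `c₁` in `X` the demands agree because `η` preserves
      -- the tournament and equals `g` on `X`. If `c₁ ∈ Y` and `c ∈ X`, then `hnice` puts `c₁` into
      -- `X`.
      have F12 : ∀ c₁ ∈ X ∪ Y ∪ S', ∀ c ∈ X ∪ S', a c₁ = g⁻¹ (a c) → (r s c₁ ↔ r (η s) c) := by
        intro c₁ hc₁ c hc e
        have e' : g (a c₁) = a c := by rw [e, perm_apply_inv]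
        have caseX : c₁ ∈ X → (r s c₁ ↔ r (η s) c) := by
          intro h₁
          rw [haf c₁ (Or.inl h₁)] at e'
          have hcY : g c₁ ∈ Y := ⟨c₁, h₁, rfl⟩
          have hcc : c = g c₁ := a.injective (by rw [← e', haf _ (Or.inr hcY)])
          have : η c₁ = c := by rw [hcc]; exact hτf _ hcY
          rw [← this, hpresη]
        rcases hc₁ with (h₁ | h₁) | h₁
        · exact caseX h₁
        · rw [haf c₁ (Or.inr h₁)] at e'
          rcases hc with hc | hc
          · rw [haf c (Or.inl hc)] at e'
            exact caseX (hnice c₁ h₁ (e' ▸ hc))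
          · exact ((hQ₂ c hc).1 ⟨c₁, h₁, e'⟩).elim
        · exact (F13 c (hc.elim (fun h => Or.inl (Or.inl h)) Or.inr) c₁ h₁ e'.symm).elim
      -- The points that the new image has to dominate, one clause for each kind of demand. All
      -- other points of `E` will dominate it.
      let D : M → Prop := fun b => (∃ c ∈ X ∪ Y ∪ S', b = a c ∧ r s c) ∨
        (∃ c ∈ X ∪ S', b = g⁻¹ (a c) ∧ r (η s) c) ∨ ∃ s' ∈ S', b = g (a s') ∧ r s (η s')
      set gi : Equiv.Perm M := g⁻¹ with hgi
      set U : Set M := a '' S' with hU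
      have hUf : U.Finite := hS'.image _
      obtain ⟨E, hEdef⟩ : ∃ E : Set M, E = F ∪ (X ∪ Y ∪ U) ∪ gi '' (X ∪ U) ∪ g '' U ∪ g '' Y ∪
        gi '' (gi '' (X ∪ U)) ∪ g '' (g '' U) := ⟨_, rfl⟩
      have hEf : E.Finite := by
        rw [hEdef]
        exact ((((((hFf.union ((hX.union hY).union hUf)).union ((hX.union hUf).image _)).union
          (hUf.image _)).union (hY.image _)).union (((hX.union hUf).image _).image _)).union
          ((hUf.image _).image _))
      have hE₁ : X ∪ Y ∪ U ⊆ E := by rw [hEdef]; intro z hz; simp only [Set.mem_union] at hz ⊢; tauto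
      have hE₂ : gi '' (X ∪ U) ⊆ E := by rw [hEdef]; intro z hz; simp only [Set.mem_union]; tauto
      have hE₃ : g '' U ⊆ E := by rw [hEdef]; intro z hz; simp only [Set.mem_union]; tauto
      have hE₄ : g '' Y ⊆ E := by rw [hEdef]; intro z hz; simp only [Set.mem_union]; tauto
      have hE₅ : gi '' (gi '' (X ∪ U)) ⊆ E := by
        rw [hEdef]; intro z hz; simp only [Set.mem_union]; tauto
      have hE₆ : g '' (g '' U) ⊆ E := by rw [hEdef]; intro z hz; simp only [Set.mem_union]; tauto
      have hac : ∀ c ∈ X ∪ S', a c ∈ X ∪ U := by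
        rintro c (hc | hc)
        · rw [haf c (Or.inl hc)]; exact Or.inl hc
        · exact Or.inr ⟨c, hc, rfl⟩
      have hP : ∀ b ∈ X ∪ Y ∪ U, ∃ c ∈ X ∪ Y ∪ S', b = a c := by
        rintro b (hb | ⟨c, hc, rfl⟩)
        · exact ⟨b, Or.inl hb, (haf b hb).symm⟩
        · exact ⟨c, Or.inr hc, rfl⟩
      obtain ⟨q, hqE, hq⟩ := hext.exists_point hEf D
      refine ⟨E, q, hEf, ?_, hqE, ?_, ?_⟩
      · rw [hEdef]; intro z hz; simp only [Set.mem_union]; tauto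
      · refine hr.typeEq ((hX.union hY).union hUf) ?_ (fun h => hqE (hE₁ h)) ?_
        · rintro (h | ⟨c, hc, e⟩)
          · exact hsXY (a.injective (haf _ h) ▸ h)
          · exact hsS' (a.injective e ▸ hc)
        · intro b hb
          obtain ⟨c, hc, rfl⟩ := hP b hb
          rw [hpresa]
          refine ⟨fun h => (hq _ (hE₁ hb)).1 (Or.inl ⟨c, hc, rfl, h⟩), fun h => ?_⟩
          by_contra hn
          refine hr.asymm h ((hq _ (hE₁ hb)).2 ?_)
          rintro (⟨c', hc', e, h'⟩ | ⟨c', hc', e, h'⟩ | ⟨s', hs', e, h'⟩)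
          · exact hn (a.injective e ▸ h')
          · exact hn ((F12 c hc c' hc' e).2 h')
          · exact F13 c hc s' hs' e
      · intro a' ha' haf' hEq htq
        set t := a' s with ht
        have htE : t ∉ E := htq.notMem hqE
        have h1 : ∀ b ∈ E, D b → r t b := fun b hb h => (hr.iff_of_typeEq htq hb).1 ((hq b hb).1 h)
        have h2 : ∀ b ∈ E, ¬ D b → r b t := fun b hb h =>
          (hr.iff_of_typeEq' htq hb).1 ((hq b hb).2 h)
        have haa : ∀ c ∈ X ∪ S', a' c = a c := by
          rintro c (hc | hc)
          · rw [haf' c (Or.inl hc), haf c (Or.inl hc)]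
          · exact hEq hc
        have main : ∀ c ∈ X ∪ S', (r (η s) c → r (g t) (a c)) ∧ (r c (η s) → r (a c) (g t)) := by
          intro c hc
          have hb : g⁻¹ (a c) ∈ E := hE₂ ⟨a c, hac c hc, rfl⟩
          rw [← perm_apply_inv g (a c), hpres, hpres]
          refine ⟨fun h => h1 _ hb (Or.inr (Or.inl ⟨c, hc, rfl, h⟩)), fun h => h2 _ hb ?_⟩
          rintro (⟨c', hc', e, h'⟩ | ⟨c', hc', e, h'⟩ | ⟨s', hs', e, h'⟩)
          · exact hr.asymm h ((F12 c' hc' c hc e.symm).1 h')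
          · exact hr.asymm h (a.injective (g⁻¹.injective e) ▸ h')
          · exact F23 c hc s' hs' e
        have main' : ∀ s' ∈ S', (r (η s') s → r (g (a s')) t) ∧ (r s (η s') → r t (g (a s'))) := by
          intro s' hs'
          have hb : g (a s') ∈ E := hE₃ ⟨a s', ⟨s', hs', rfl⟩, rfl⟩
          refine ⟨fun h => h2 _ hb ?_, fun h => h1 _ hb (Or.inr (Or.inr ⟨s', hs', rfl, h⟩))⟩
          rintro (⟨c', hc', e, h'⟩ | ⟨c', hc', e, h'⟩ | ⟨s'', hs'', e, h'⟩)
          · exact F13 c' hc' s' hs' e.symm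
          · exact F23 c' hc' s' hs' e.symm
          · exact hr.asymm h (a.injective (g.injective e) ▸ h')
        refine ⟨?_, ?_, ?_⟩
        · rintro s₁ (rfl | hs₁) c hc
          · rcases hc with hc | rfl | hc
            · rw [haa c (Or.inl hc)]; exact main c (Or.inl hc)
            · exact ⟨fun h => (hr.asymm (hrS _ hs) h).elim, fun _ => hgr _⟩
            · rw [haa c (Or.inr hc)]; exact main c (Or.inr hc)
          · rw [hEq hs₁]
            rcases hc with hc | rfl | hc
            · rw [haa c (Or.inl hc)]; exact hQ₁ s₁ hs₁ c (Or.inl hc)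
            · exact main' s₁ hs₁
            · rw [haa c (Or.inr hc)]; exact hQ₁ s₁ hs₁ c (Or.inr hc)
        · rintro s₁ (rfl | hs₁)
          · refine ⟨fun h => htE (hE₄ h), fun h => htE (hE₅ ?_)⟩
            exact ⟨g t, ⟨g (g t), Or.inl h, perm_inv_apply g _⟩, perm_inv_apply g _⟩
          · rw [hEq hs₁]; exact hQ₂ s₁ hs₁
        · rintro s₁ (rfl | hs₁) c (rfl | hc)
          · exact (hgg _).symm
          · rw [hEq hc]
            intro e
            refine htE (hE₅ ⟨g t, ⟨g (g t), ?_, perm_inv_apply g _⟩, perm_inv_apply g _⟩)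
            exact Or.inr (e ▸ ⟨c, hc, rfl⟩)
          · rw [hEq hs₁]
            intro e
            exact htE (hE₆ ⟨g (a s₁), ⟨a s₁, ⟨s₁, hs₁, rfl⟩, rfl⟩, e.symm⟩)
          · rw [hEq hs₁, hEq hc]
            exact hQ₃ s₁ hs₁ c hc)
  exact exists_conj_eq hF hI hr hg hX hS hτ hτf hp ha haf h₂
    (fun s hs c hc => (hQa s hs c hc).1) (fun s hs c hc => (hQa s hs c hc).2)

end Tournament

/-! ### General position of finite sets, and sets convex on orbits -/

section TransferPieces

variable {M : Type w}
variable {G₁ G₂ : Subgroup (Equiv.Perm M)} {I : Set M → Set M → Set M → Prop}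
variable {r : M → M → Prop} {g h : Equiv.Perm M} {X : Set M}

/-- A finite set can be moved over `B` by an automorphism of the second structure such that it
avoids `C` outside of `B`. -/
theorem exists_avoiding (hF : IsFusionPair G₁ G₂) (hI : IsIndependence G₁ I) {B C T : Set M}
    (hB : B.Finite) (hC : C.Finite) (hT : T.Finite) :
    ∃ β ∈ G₂, (∀ b ∈ B, β b = b) ∧ ∀ t ∈ T, β t ∈ C → t ∈ B := by
  induction T, hT using Set.Finite.induction_on with
  | empty => exact ⟨1, one_mem _, fun _ _ => rfl, by simp⟩
  | @insert t T htT hT ih =>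
    obtain ⟨β, hβ, hβB, hβT⟩ := ih
    by_cases htB : t ∈ B
    · refine ⟨β, hβ, hβB, ?_⟩
      rintro s (rfl | hs) h
      exacts [htB, hβT s hs h]
    have hn : β t ∉ B ∪ β '' T := by
      rintro (h | ⟨s, hs, e⟩)
      · exact htB (β.injective (hβB _ h) ▸ h)
      · exact htT (β.injective e ▸ hs)
    obtain ⟨q, ⟨σ, hσ, hσf, rfl⟩, hq⟩ := hF.exists_fresh hI (hB.union (hT.image β)) hC hn
    refine ⟨σ * β, mul_mem hσ hβ, fun b hb => ?_, ?_⟩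
    · rw [Equiv.Perm.mul_apply, hβB b hb, hσf b (Or.inl hb)]
    · rintro s (rfl | hs) h
      · exact (hq h).elim
      · rw [Equiv.Perm.mul_apply, hσf _ (Or.inr ⟨s, hs, rfl⟩)] at h
        exact hβT s hs h

/-- A finite set has an independent copy with a prescribed type in the second structure. -/
theorem exists_indep_set [Countable M] (hF : IsFusionPair G₁ G₂) (hI : IsIndependence G₁ I)
    {B C T : Set M} (hB : B.Finite) (hC : C.Finite) (hT : T.Finite) {β : Equiv.Perm M}
    (hβ : β ∈ G₂) (hβB : ∀ b ∈ B, β b = b) (hβT : ∀ t ∈ T, β t ∈ C → t ∈ B) :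
    ∃ b ∈ G₁ ⊓ G₂, (∀ z ∈ B, b z = z) ∧ I (b '' T) B C ∧
      ∃ κ ∈ G₂, (∀ z ∈ B ∪ C, κ z = z) ∧ ∀ t ∈ T, κ (β t) = b t := by
  induction T, hT using Set.Finite.induction_on with
  | empty =>
    refine ⟨1, one_mem _, fun _ _ => rfl, ?_, 1, one_mem _, fun _ _ => rfl, by simp⟩
    rw [Set.image_empty]
    exact hI.mono_left (hI.self B _) (Set.empty_subset _)
  | @insert t T htT hT ih =>
    obtain ⟨b, hb, hbB, hbI, κ, hκ, hκf, hκT⟩ := ih fun s hs => hβT s (Or.inr hs)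
    by_cases htB : t ∈ B
    · refine ⟨b, hb, hbB, ?_, κ, hκ, hκf, ?_⟩
      · rw [Set.image_insert_eq, hbB t htB]
        exact hI.mono hbI (Set.insert_subset (Or.inr htB) Set.subset_union_left)
          Set.subset_union_left
      · rintro s (rfl | hs)
        · rw [hβB s htB, hbB s htB, hκf s (Or.inl htB)]
        · exact hκT s hs
    have hn : b t ∉ B ∪ b '' T := by
      rintro (h | ⟨s, hs, e⟩)
      · exact htB (b.injective (hbB _ h) ▸ h)
      · exact htT (b.injective e ▸ hs)
    -- The map `κ` witnesses that `β` and `b` agree so far up to a second type over `B ∪ C`. So `κ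
    -- (β t)` has the second type that the next image must take.
    have hq : TypeEq G₂ (B ∪ b '' T) (b t) (κ (β t)) := by
      refine ⟨κ * β * b⁻¹, mul_mem (mul_mem hκ hβ) (inv_mem hb.2), ?_, by simp⟩
      rintro z (hz | ⟨s, hs, rfl⟩)
      · have : b⁻¹ z = z := by rw [Equiv.Perm.inv_eq_iff_eq, hbB z hz]
        rw [Equiv.Perm.mul_apply, Equiv.Perm.mul_apply, this, hβB z hz, hκf z (Or.inl hz)]
      · rw [Equiv.Perm.mul_apply, Equiv.Perm.mul_apply, perm_inv_apply, hκT s hs]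
    have hqC : κ (β t) ∉ C := fun h => by
      have e := κ.injective (hκf _ (Or.inr h))
      rw [e] at h
      exact htB (hβT t (Or.inl rfl) h)
    obtain ⟨c, ⟨σ, hσ, hσf, hσc⟩, hcI, ρ, hρ, hρf, hρc⟩ :=
      hF.exists_indep hI (hB.union (hT.image b)) hC hn hq hqC
    refine ⟨σ * b, mul_mem hσ hb, fun z hz => ?_, ?_, ρ * κ, mul_mem hρ hκ, fun z hz => ?_, ?_⟩
    · rw [Equiv.Perm.mul_apply, hbB z hz, hσf z (Or.inl hz)]
    · refine hI.trans_left hbI hcI Set.subset_union_left subset_rfl ?_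
      rintro _ ⟨s, rfl | hs, rfl⟩
      · exact Or.inr hσc
      · rw [Equiv.Perm.mul_apply, hσf _ (Or.inr ⟨s, hs, rfl⟩)]
        exact Or.inl (Or.inr ⟨s, hs, rfl⟩)
    · rw [Equiv.Perm.mul_apply, hκf z hz]
      exact hρf z (hz.elim (fun h => Or.inl (Or.inl h)) Or.inr)
    · rintro s (rfl | hs)
      · rw [Equiv.Perm.mul_apply, hρc, Equiv.Perm.mul_apply, hσc]
      · rw [Equiv.Perm.mul_apply, hκT s hs, Equiv.Perm.mul_apply,
          hσf _ (Or.inr ⟨s, hs, rfl⟩), hρf _ (Or.inl (Or.inr ⟨s, hs, rfl⟩))]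

/-- In the random tournament, a finite set can be moved over `B` such that all its elements
outside of `B` are dominated by a given finite set. -/
theorem exists_dominated (hr : IsHomogeneousTournament G₂ r) (hext : HasTournamentExtension r)
    {B V K : Set M} (hB : B.Finite) (hV : V.Finite) (hK : K.Finite) (hBK : ∀ p ∈ K, p ∉ B) :
    ∃ ρ ∈ G₂, (∀ b ∈ B, ρ b = b) ∧ ∀ v ∈ V, v ∉ B → ∀ p ∈ K, r p (ρ v) := by
  induction V, hV using Set.Finite.induction_on with
  | empty => exact ⟨1, one_mem _, fun _ _ => rfl, by simp⟩
  | @insert v V hvV hV ih =>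
    obtain ⟨ρ, hρ, hρB, hρV⟩ := ih
    by_cases hvB : v ∈ B
    · refine ⟨ρ, hρ, hρB, ?_⟩
      rintro s (rfl | hs) h
      exacts [(h hvB).elim, hρV s hs h]
    have hfin : (B ∪ ρ '' V).Finite := hB.union (hV.image _)
    have hKB : ∀ p ∈ K, p ∉ B ∪ ρ '' V := by
      rintro p hp (h | ⟨s, hs, rfl⟩)
      · exact hBK p hp h
      · by_cases hsB : s ∈ B
        · rw [hρB s hsB] at hp
          exact hBK s hp hsB
        · exact hr.irrefl _ (hρV s hs hsB _ hp)
    have hn : ρ v ∉ B ∪ ρ '' V := by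
      rintro (h | ⟨s, hs, e⟩)
      · exact hvB (ρ.injective (hρB _ h) ▸ h)
      · exact hvV (ρ.injective e ▸ hs)
    -- The point `q` copies the relations of `ρ v` to `B ∪ ρ '' V` and is dominated by everything
    -- else; since `K` is disjoint from that set, this includes `K`.
    obtain ⟨q, hq, hqD⟩ := hext.exists_point (hfin.union hK)
      (fun b => b ∈ B ∪ ρ '' V ∧ r (ρ v) b)
    obtain ⟨σ, hσ, hσf, hσv⟩ := hr.typeEq hfin hn (fun h => hq (Or.inl h)) fun b hb =>
      ⟨fun h => (hqD b (Or.inl hb)).1 ⟨hb, h⟩, fun h => by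
        by_contra hn
        exact hr.asymm h ((hqD b (Or.inl hb)).2 fun h' => hn h'.2)⟩
    refine ⟨σ * ρ, mul_mem hσ hρ, fun b hb => ?_, ?_⟩
    · rw [Equiv.Perm.mul_apply, hρB b hb, hσf b (Or.inl hb)]
    · rintro s (rfl | hs) hsB p hp
      · rw [Equiv.Perm.mul_apply, hσv]
        exact (hqD p (Or.inr hp)).2 fun h => hKB p hp h.1
      · rw [Equiv.Perm.mul_apply, hσf _ (Or.inr ⟨s, hs, rfl⟩)]
        exact hρV s hs hsB p hp

/-- Every finite set is contained in a finite set that is convex on the orbits of `g`. -/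
theorem exists_orbit_convex (g : Equiv.Perm M) {X₀ : Set M} (hX₀ : X₀.Finite) :
    ∃ X : Set M, X.Finite ∧ X₀ ⊆ X ∧ ∀ x, x ∈ g '' X → g x ∈ X → x ∈ X := by
  -- The set will be the union of `g ^ i '' X₀` for `i ≤ N`. Convexity can only fail at `(g ^ (N +
  -- 1)) u` if `g` maps it to a point `v` of `X₀`. For fixed `u` and `v` at most one `N` is bad,
  -- because for a larger one `(g ^ (N + 1)) u` repeats an earlier point of the orbit.
  have hbad : ∀ u v : M,
      {N : ℕ | v = (g ^ (N + 2)) u ∧ ∀ i ≤ N, (g ^ (N + 1)) u ≠ (g ^ i) u}.Subsingleton := by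
    have key : ∀ u v : M, ∀ N N' : ℕ, N < N' → v = (g ^ (N + 2)) u → v = (g ^ (N' + 2)) u →
        ¬ ∀ i ≤ N', (g ^ (N' + 1)) u ≠ (g ^ i) u := by
      intro u v N N' hlt h h' hall
      refine hall (N + 1) hlt (g.injective ?_)
      rw [← Equiv.Perm.mul_apply, ← pow_succ', ← Equiv.Perm.mul_apply, ← pow_succ']
      exact h'.symm.trans h
    intro u v N hN N' hN'
    rcases lt_trichotomy N N' with hlt | heq | hlt
    · exact (key u v N N' hlt hN.1 hN'.1 hN'.2).elim
    · exact heq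
    · exact (key u v N' N hlt hN'.1 hN.1 hN.2).elim
  have hfin : (⋃ u ∈ X₀, ⋃ v ∈ X₀,
      {N : ℕ | v = (g ^ (N + 2)) u ∧ ∀ i ≤ N, (g ^ (N + 1)) u ≠ (g ^ i) u}).Finite :=
    hX₀.biUnion fun u _ => hX₀.biUnion fun v _ => (hbad u v).finite
  obtain ⟨N, hN⟩ := hfin.exists_notMem
  refine ⟨⋃ i ∈ Set.Iic N, (g ^ i) '' X₀, (Set.finite_Iic N).biUnion fun i _ => hX₀.image _, ?_, ?_⟩
  · intro x hx
    exact Set.mem_biUnion (show 0 ∈ Set.Iic N from Nat.zero_le N) ⟨x, hx, rfl⟩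
  · rintro _ ⟨x, hx, rfl⟩ hgx
    obtain ⟨i, hi, u, hu, rfl⟩ := Set.mem_iUnion₂.1 hx
    obtain ⟨j, hj, v, hv, hvj⟩ := Set.mem_iUnion₂.1 hgx
    have e1 : g ((g ^ i) u) = (g ^ (i + 1)) u := by
      rw [pow_succ', Equiv.Perm.mul_apply]
    rcases Nat.lt_or_ge i N with hlt | hge
    · exact Set.mem_biUnion (show i + 1 ∈ Set.Iic N from hlt) ⟨u, hu, e1.symm⟩
    have hiN : i = N := le_antisymm hi hge
    subst hiN
    rcases j with _ | j
    · rw [e1] at hvj ⊢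
      by_contra hnot
      refine hN (Set.mem_biUnion hu (Set.mem_biUnion hv ⟨?_, fun k hk e => hnot ?_⟩))
      · rw [pow_succ', Equiv.Perm.mul_apply]; exact hvj
      · rw [e]
        exact Set.mem_biUnion (show k ∈ Set.Iic i from hk) ⟨u, hu, rfl⟩
    · refine Set.mem_biUnion (show j ∈ Set.Iic i from (Nat.le_succ j).trans hj) ⟨v, hv, ?_⟩
      apply g.injective
      rw [← hvj, pow_succ', Equiv.Perm.mul_apply]

end TransferPieces

/-! ### Commutators without fixed points, and commutators dominated by their arguments -/

section TournamentSteps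

variable {M : Type w}
variable {G₁ G₂ : Subgroup (Equiv.Perm M)} {I : Set M → Set M → Set M → Prop}
variable {R R' : Set M → M → M → Prop}
variable {r : M → M → Prop} {h : Equiv.Perm M}

section

variable [Countable M] (hF : IsFusionPair G₁ G₂) (hI : IsIndependence G₁ I)
include hF hI

/-- Commutators with `h` can be chosen without fixed points. -/
theorem exists_commutator_fixedPointFree (hR : IsMoveRel (G₁ ⊓ G₂) I R)
    (hR' : IsMoveRel (G₁ ⊓ G₂) I R')
    (comp : ∀ {A : Set M} {x y z : M}, R A x y → R A x z → I {z} (insert x A) {y} → R' A z y)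
    (hh : h ∈ G₁ ⊓ G₂) (mh : Moves (G₁ ⊓ G₂) R h) :
    ∃ a ∈ G₁ ⊓ G₂, Moves (G₁ ⊓ G₂) R' (h⁻¹ * (a⁻¹ * h * a)) ∧
      ∀ x, (h⁻¹ * (a⁻¹ * h * a)) x ≠ x := by
  obtain ⟨a, ha, hm, hgood⟩ := exists_moves_mul_conj hF hI hR hR' comp (inv_mem hh) mh
    (by rwa [inv_inv])
    -- This says that `h⁻¹ * (a⁻¹ * h * a)` does not fix `x`. It is kept by letting the new point
    -- avoid finitely many others; if `h` fixes the new argument, it holds because `h` moves the new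
    -- image.
    (Good := fun A a => ∀ x ∈ A, h x ∈ A → a (h x) ≠ h (a x))
    (fun A a a' hEq hg x hx hx' => by rw [← hEq hx, ← hEq hx']; exact hg x hx hx') (by simp)
    (by
      intro A a x F hA ha hg hx hFf
      obtain ⟨q, hq, hqE⟩ := hF.exists_fresh hI (hA.image a)
        ((hFf.union ((hA.image a).image h)).union ((hA.image a).image (h⁻¹ : Equiv.Perm M)))
        (x := a x) (by simpa using hx)
      refine ⟨_, q, (hFf.union ((hA.image a).image h)).union
        ((hA.image a).image (h⁻¹ : Equiv.Perm M)), ?_, hqE, hq, ?_⟩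
      · exact fun z hz => Or.inl (Or.inl hz)
      intro a' ha' hEq hq' hne
      have hn := hq'.notMem hqE
      rintro y (rfl | hy) hy' e
      · rcases hy' with hy' | hy'
        · rw [hy'] at e
          exact hne e.symm
        · exact hn (Or.inr ⟨a' (h y), ⟨h y, hy', (hEq hy').symm⟩, by rw [e, perm_inv_apply]⟩)
      · rcases hy' with hy' | hy'
        · rw [hy'] at e
          exact hn (Or.inl (Or.inr ⟨a' y, ⟨y, hy, (hEq hy).symm⟩, e.symm⟩))
        · rw [hEq hy, hEq hy'] at e
          exact hg y hy hy' e)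
    (by
      intro A a y F hA ha hg hy hFf
      obtain ⟨q, hq, hqE⟩ := hF.exists_fresh hI hA
        ((hFf.union (hA.image h)).union (hA.image (h⁻¹ : Equiv.Perm M)))
        (x := a⁻¹ y) (fun hmem => hy ⟨_, hmem, perm_apply_inv a y⟩)
      refine ⟨_, q, (hFf.union (hA.image h)).union
        (hA.image (h⁻¹ : Equiv.Perm M)), ?_, hqE, hq, ?_⟩
      · exact fun z hz => Or.inl (Or.inl hz)
      intro a' ha' hEq hq' hne
      have hn := hq'.notMem hqE
      rintro x (rfl | hx) hx' e
      · rcases hx' with hx' | hx'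
        · exact hne hx'
        · exact hn (Or.inr ⟨_, hx', perm_inv_apply h _⟩)
      · rcases hx' with hx' | hx'
        · exact hn (Or.inl (Or.inr ⟨x, hx, hx'⟩))
        · rw [hEq hx, hEq hx'] at e
          exact hg x hx hx' e)
  refine ⟨a, ha, hm, fun x e => ?_⟩
  obtain ⟨B, hB, hBg⟩ := hgood {x, h x} ((Set.finite_singleton _).insert _)
  refine hBg x (hB (Or.inl rfl)) (hB (Or.inr rfl)) ?_
  simp only [Equiv.Perm.mul_apply] at e
  rw [Equiv.Perm.inv_eq_iff_eq, Equiv.Perm.inv_eq_iff_eq] at e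
  exact e.symm

end

/-- The conditions on finite approximations `a` which guarantee that the commutator of `h` and `a`
maps every `x` to an element dominated by `x`. -/
def CommutatorGood (r : M → M → Prop) (h : Equiv.Perm M) (A : Set M) (a : Equiv.Perm M) : Prop :=
  (∀ x ∈ A, h x ∈ A → r (a (h x)) (h (a x))) ∧
  (∀ x ∈ A, ∀ y ∈ A, h (a x) = a y → r (h x) y) ∧
  ∀ x ∈ A, h (h x) ∈ A → a (h (h x)) ≠ h (h (a x))

/-- Passing to `a⁻¹` and reversing the tournament interchanges the first two clauses and preserves
the third, so the backward step is the forward step for the inverse. -/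
theorem CommutatorGood.flip {A : Set M} {a : Equiv.Perm M} (hg : CommutatorGood r h A a) :
    CommutatorGood (fun x y => r y x) h (a '' A) a⁻¹ := by
  obtain ⟨h₁, h₂, h₃⟩ := hg
  refine ⟨?_, ?_, ?_⟩
  · rintro _ ⟨x, hx, rfl⟩ ⟨y, hy, e⟩
    rw [← e, perm_inv_apply, perm_inv_apply]
    exact h₂ x hx y hy e.symm
  · rintro _ ⟨x, hx, rfl⟩ _ ⟨y, hy, rfl⟩ e
    rw [perm_inv_apply, perm_inv_apply] at e
    subst e
    exact h₁ x hx hy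
  · rintro _ ⟨x, hx, rfl⟩ ⟨y, hy, e⟩ e'
    rw [← e, perm_inv_apply, perm_inv_apply] at e'
    subst e'
    exact h₃ x hx hy e

theorem IsHomogeneousTournament.flip (hr : IsHomogeneousTournament G₂ r) :
    IsHomogeneousTournament G₂ fun x y => r y x where
  irrefl := hr.irrefl
  asymm h := hr.asymm h
  total h := (hr.total h).symm
  mem_iff := hr.mem_iff.trans ⟨fun h x y => h y x, fun h x y => h y x⟩
  extend hA φ hφ h := hr.extend hA φ hφ fun x hx y hy hxy => h y hy x hx hxy

theorem HasTournamentExtension.flip (hext : HasTournamentExtension r) :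
    HasTournamentExtension fun x y => r y x := by
  intro A B hA hB hAB
  obtain ⟨x, hx, h₁, h₂⟩ := hext B A hB hA hAB.symm
  exact ⟨x, by rwa [Set.union_comm], h₂, h₁⟩

/-- The image `t` of `x` is constrained by the relations of `x` to `A`, by `t → h (a u)` if `h u =
x`, and by `h⁻¹ (a (h x)) → t` if `h x ∈ A`. The second clause of `CommutatorGood` makes either of
the last two demands consistent with the first, and the third clause excludes that these two concern
the same point. -/
theorem CommutatorGood.exists_point (hr : IsHomogeneousTournament G₂ r)
    (hext : HasTournamentExtension r) (hh : h ∈ G₂) (hfree : ∀ x, h x ≠ x) {A F : Set M}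
    {a : Equiv.Perm M} {x : M} (hA : A.Finite) (ha : a ∈ G₂) (hg : CommutatorGood r h A a)
    (hx : x ∉ A) (hFf : F.Finite) :
    ∃ (E : Set M) (q : M), E.Finite ∧ F ⊆ E ∧ q ∉ E ∧ TypeEq G₂ (a '' A) (a x) q ∧
      ∀ a' : Equiv.Perm M, Set.EqOn a' a A → TypeEq G₂ E q (a' x) →
        CommutatorGood r h (insert x A) a' := by
  obtain ⟨h₁, h₂, h₃⟩ := hg
  have hpres : ∀ x y, r (h x) (h y) ↔ r x y := hr.mem_iff.1 hh
  have hpresa : ∀ x y, r (a x) (a y) ↔ r x y := hr.mem_iff.1 ha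
  have hhh : ∀ x, h (h x) ≠ x := fun x e => by
    rcases hr.total (hfree x) with h' | h'
    · have := (hpres _ _).2 h'
      rw [e] at this
      exact hr.asymm this h'
    · have := (hpres _ _).2 h'
      rw [e] at this
      exact hr.asymm this h'
  set hi : Equiv.Perm M := h⁻¹ with hhi
  set B : Set M := a '' A with hB
  have hBf : B.Finite := hA.image a
  obtain ⟨E, hEdef⟩ : ∃ E : Set M,
    E = F ∪ B ∪ h '' B ∪ hi '' B ∪ h '' (h '' B) ∪ hi '' (hi '' B) := ⟨_, rfl⟩
  have hEf : E.Finite := by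
    rw [hEdef]
    exact ((((hFf.union hBf).union (hBf.image _)).union (hBf.image _)).union
      ((hBf.image _).image _)).union ((hBf.image _).image _)
  have hE₁ : B ⊆ E := by rw [hEdef]; intro z hz; simp only [Set.mem_union]; tauto
  have hE₂ : h '' B ⊆ E := by rw [hEdef]; intro z hz; simp only [Set.mem_union]; tauto
  have hE₃ : hi '' B ⊆ E := by rw [hEdef]; intro z hz; simp only [Set.mem_union]; tauto
  have hE₄ : h '' (h '' B) ⊆ E := by rw [hEdef]; intro z hz; simp only [Set.mem_union]; tauto
  have hE₅ : hi '' (hi '' B) ⊆ E := by rw [hEdef]; intro z hz; simp only [Set.mem_union]; tauto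
  let D : M → Prop := fun b => (∃ y ∈ A, b = a y ∧ r x y) ∨ ∃ u ∈ A, h u = x ∧ b = h (a u)
  obtain ⟨q, hqE, hq⟩ := hext.exists_point hEf D
  refine ⟨E, q, hEf, ?_, hqE, ?_, ?_⟩
  · rw [hEdef]; intro z hz; simp only [Set.mem_union]; tauto
  · refine hr.typeEq hBf (by simpa [hB] using hx) (fun h => hqE (hE₁ h)) ?_
    rintro _ ⟨y, hy, rfl⟩
    have hyE : a y ∈ E := hE₁ ⟨y, hy, rfl⟩
    rw [hpresa]
    refine ⟨fun h => (hq _ hyE).1 (Or.inl ⟨y, hy, rfl, h⟩), fun h => ?_⟩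
    by_contra hn
    refine hr.asymm h ((hq _ hyE).2 ?_)
    rintro (⟨y', hy', e, h'⟩ | ⟨u, hu, e, e'⟩)
    · exact hn (a.injective e ▸ h')
    · exact hn (e ▸ h₂ u hu y hy e'.symm)
  · intro a' hEq htq
    set t := a' x with ht
    have htE : t ∉ E := htq.notMem hqE
    have k1 : ∀ b ∈ E, D b → r t b := fun b hb h => (hr.iff_of_typeEq htq hb).1 ((hq b hb).1 h)
    have k2 : ∀ b ∈ E, ¬ D b → r b t := fun b hb h =>
      (hr.iff_of_typeEq' htq hb).1 ((hq b hb).2 h)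
    refine ⟨?_, ?_, ?_⟩
    · rintro y (rfl | hy) hy'
      · rcases hy' with hy' | hy'
        · exact (hfree _ hy').elim
        · have hb : hi (a (h y)) ∈ E := hE₃ ⟨_, ⟨_, hy', rfl⟩, rfl⟩
          rw [hEq hy', ← perm_apply_inv h (a (h y)), hpres]
          refine k2 _ hb ?_
          rintro (⟨y', hy'', e, h'⟩ | ⟨u, hu, e, e'⟩)
          · rw [Equiv.Perm.inv_eq_iff_eq] at e
            have := h₂ y' hy'' (h y) hy' e.symm
            rw [hpres] at this
            exact hr.asymm h' this
          · rw [Equiv.Perm.inv_eq_iff_eq] at e'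
            subst e
            exact h₃ u hu hy' e'
      · rcases hy' with hy' | hy'
        · rw [hy', hEq hy]
          exact k1 _ (hE₂ ⟨_, ⟨y, hy, rfl⟩, rfl⟩) (Or.inr ⟨y, hy, hy', rfl⟩)
        · rw [hEq hy, hEq hy']
          exact h₁ y hy hy'
    · rintro y (rfl | hy) y' (rfl | hy') e
      · exact (hfree _ e).elim
      · rw [hEq hy'] at e
        exact (htE (hE₃ ⟨a y', ⟨y', hy', rfl⟩, by rw [← e, hhi, perm_inv_apply]⟩)).elim
      · rw [hEq hy] at e
        exact (htE (hE₂ ⟨a y, ⟨y, hy, rfl⟩, e⟩)).elim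
      · rw [hEq hy, hEq hy'] at e
        exact h₂ y hy y' hy' e
    · rintro y (rfl | hy) hy' e
      · rcases hy' with hy' | hy'
        · exact hhh _ hy'
        · rw [hEq hy'] at e
          exact htE (hE₅ ⟨h t, ⟨h (h t), ⟨h (h y), hy', e⟩, perm_inv_apply h _⟩,
            perm_inv_apply h _⟩)
      · rw [hEq hy] at e
        rcases hy' with hy' | hy'
        · rw [hy'] at e
          exact htE (hE₄ ⟨h (a y), ⟨a y, ⟨y, hy, rfl⟩, rfl⟩, e.symm⟩)
        · rw [hEq hy'] at e
          exact h₃ y hy hy' e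

/-- If `h` has no fixed points, then some commutator of `h` maps every `x` to an element dominated
by `x`. -/
theorem exists_commutator_dominated [Countable M] (hF : IsFusionPair G₁ G₂)
    (hI : IsIndependence G₁ I) (hr : IsHomogeneousTournament G₂ r)
    (hext : HasTournamentExtension r) (hR : IsMoveRel (G₁ ⊓ G₂) I R)
    (hR' : IsMoveRel (G₁ ⊓ G₂) I R')
    (comp : ∀ {A : Set M} {x y z : M}, R A x y → R A x z → I {z} (insert x A) {y} → R' A z y)
    (hh : h ∈ G₁ ⊓ G₂) (hfree : ∀ x, h x ≠ x) (mh : Moves (G₁ ⊓ G₂) R h) :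
    ∃ a ∈ G₁ ⊓ G₂, Moves (G₁ ⊓ G₂) R' (h⁻¹ * (a⁻¹ * h * a)) ∧
      ∀ x, r x ((h⁻¹ * (a⁻¹ * h * a)) x) := by
  obtain ⟨a, ha, hm, hgood⟩ := exists_moves_mul_conj hF hI hR hR' comp (inv_mem hh) mh
    (by rwa [inv_inv]) (Good := CommutatorGood r h)
    (fun A a a' hEq hg => by
      refine ⟨fun x hx hx' => ?_, fun x hx y hy => ?_, fun x hx hx' => ?_⟩
      · rw [← hEq hx, ← hEq hx']; exact hg.1 x hx hx'
      · rw [← hEq hx, ← hEq hy]; exact hg.2.1 x hx y hy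
      · rw [← hEq hx, ← hEq hx']; exact hg.2.2 x hx hx')
    ⟨by simp, by simp, by simp⟩
    (by
      intro A a x F hA ha hg hx hFf
      obtain ⟨E, q, hE, hFE, hqE, hq, hfin⟩ :=
        hg.exists_point hr hext hh.2 hfree hA ha.2 hx hFf
      exact ⟨E, q, hE, hFE, hqE, hq, fun a' _ hEq hq' _ => hfin a' hEq hq'⟩)
    (by
      intro A a y F hA ha hg hy hFf
      obtain ⟨E, q, hE, hFE, hqE, hq, hfin⟩ := hg.flip.exists_point hr.flip hext.flip hh.2 hfree
        (hA.image a) (inv_mem ha.2) hy hFf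
      have e : ∀ b : Equiv.Perm M, (b⁻¹ : Equiv.Perm M) '' (b '' A) = A := fun b => by
        rw [Set.image_image]; simp
      rw [e] at hq
      refine ⟨E, q, hE, hFE, hqE, hq, fun a' _ hEq hq' _ => ?_⟩
      have hEq' : Set.EqOn (a'⁻¹ : Equiv.Perm M) (a⁻¹ : Equiv.Perm M) (a '' A) := by
        rintro _ ⟨z, hz, rfl⟩
        rw [perm_inv_apply, ← hEq hz, perm_inv_apply]
      have := (hfin _ hEq' hq').flip
      rw [inv_inv] at this
      rwa [Set.image_insert_eq, ← hEq.image_eq, e] at this)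
  refine ⟨a, ha, hm, fun x => ?_⟩
  obtain ⟨B, hB, hBg⟩ := hgood {x, h x} ((Set.finite_singleton _).insert _)
  have := hBg.1 x (hB (Or.inl rfl)) (hB (Or.inr rfl))
  rw [← hr.mem_iff.1 hh.2, ← hr.mem_iff.1 ha.2]
  simp only [Equiv.Perm.mul_apply]
  rwa [perm_apply_inv, perm_apply_inv]

/-- In a tournament expansion, every type has a realization moved by `h`. -/
theorem exists_moved_tournament [Countable M] (hF : IsFusionPair G₁ G₂)
    (hI : IsIndependence G₁ I) (hr : IsHomogeneousTournament G₂ r)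
    (hext : HasTournamentExtension r) (hh : h ∈ G₁ ⊓ G₂) (hne : h ≠ 1) :
    Moves (G₁ ⊓ G₂) (fun W x y => x = y → x ∈ W) h := by
  obtain ⟨c₀, hc₀⟩ : ∃ c, h c ≠ c := by
    by_contra! hall
    exact hne (Equiv.ext hall)
  -- If `h` fixed `x`, it would turn `x → c` into `x → h c`.
  have moved : ∀ c x, h c ≠ c → r x c → r (h c) x → h x ≠ x := by
    intro c x hc h1 h2 e
    have := (hr.mem_iff.1 hh.2 x c).2 h1
    rw [e] at this
    exact hr.asymm this h2
  have key : ∀ (E : Set M), E.Finite → ∀ c, h c ≠ c → ∃ q, q ∉ E ∧ r q c ∧ r (h c) q := by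
    intro E hE c hc
    obtain ⟨q, hq, hqD⟩ := hext.exists_point ((hE.insert c).insert (h c)) (fun b => b = c)
    exact ⟨q, fun h => hq (Or.inr (Or.inr h)), (hqD c (Or.inr (Or.inl rfl))).1 rfl,
      (hqD (h c) (Or.inl rfl)).2 hc⟩
  intro W hW x hx
  -- A first application of `moved` yields a moved point `c` such that `c` and `h c` both lie
  -- outside `W`. Relations to these two can then be added to any type over `W`.
  obtain ⟨c, hcE, hc₁, hc₂⟩ := key (W ∪ (h⁻¹ : Equiv.Perm M) '' W) (hW.union (hW.image _)) c₀ hc₀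
  have hc : h c ≠ c := moved c₀ c hc₀ hc₁ hc₂
  have hcW : c ∉ W := fun h => hcE (Or.inl h)
  have hhcW : h c ∉ W := fun h' => hcE (Or.inr ⟨h c, h', perm_inv_apply h c⟩)
  obtain ⟨q, hq, hqD⟩ := hext.exists_point (hW.union ((Set.finite_singleton (h c)).insert c))
    (fun b => b = c ∨ (b ∈ W ∧ r x b))
  have hqt : TypeEq G₂ W x q := by
    refine hr.typeEq hW hx (fun h => hq (Or.inl h)) fun b hb => ⟨fun h =>
      (hqD b (Or.inl hb)).1 (Or.inr ⟨hb, h⟩), fun h => ?_⟩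
    by_contra hn
    refine hr.asymm h ((hqD b (Or.inl hb)).2 ?_)
    rintro (rfl | h')
    exacts [hcW hb, hn h'.2]
  obtain ⟨y, hy, -, hyq⟩ := hF.exists_indep hI hW ((Set.finite_singleton (h c)).insert c) hx hqt
    (fun h => hq (Or.inr h))
  refine ⟨y, hy, fun e => (moved c y hc ?_ ?_ e.symm).elim⟩
  · exact (hr.iff_of_typeEq hyq (Or.inr (Or.inl rfl))).1
      ((hqD c (Or.inr (Or.inl rfl))).1 (Or.inl rfl))
  · refine (hr.iff_of_typeEq' hyq (Or.inr (Or.inr rfl))).1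
      ((hqD (h c) (Or.inr (Or.inr rfl))).2 ?_)
    rintro (e | h')
    exacts [hc e, hhcW h'.1]

end TournamentSteps

/-! ### Unboundedly increasing automorphisms of the order, and orbit blocks -/

section Order

variable {M : Type w} [LinearOrder M]
variable {G₁ G₂ : Subgroup (Equiv.Perm M)} {I : Set M → Set M → Set M → Prop}
variable {g f : Equiv.Perm M} {X : Set M}

theorem zpow_strictMono (hinc : ∀ x, x < g x) (p : M) :
    StrictMono fun i : ℤ => (g ^ i) p := by
  refine strictMono_int_of_lt_succ fun i => ?_
  rw [add_comm, zpow_add, zpow_one, Equiv.Perm.mul_apply]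
  exact hinc _

section OrderAutomorphisms

variable (hr : IsHomogeneousTournament G₂ (fun x y : M => x < y))
include hr

theorem lt_iff_of_mem {σ : Equiv.Perm M} (hσ : σ ∈ G₂) {x y : M} : σ x < σ y ↔ x < y :=
  hr.mem_iff.1 hσ x y

theorem le_iff_of_mem {σ : Equiv.Perm M} (hσ : σ ∈ G₂) {x y : M} : σ x ≤ σ y ↔ x ≤ y := by
  rw [← not_lt, ← not_lt, lt_iff_of_mem hr hσ]

theorem lt_inv_iff_of_mem {σ : Equiv.Perm M} (hσ : σ ∈ G₂) {x y : M} : σ x < y ↔ x < σ⁻¹ y := by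
  rw [← lt_iff_of_mem hr hσ (x := x), perm_apply_inv]

theorem inv_lt_iff_of_mem {σ : Equiv.Perm M} (hσ : σ ∈ G₂) {x y : M} : y < σ x ↔ σ⁻¹ y < x := by
  rw [← lt_iff_of_mem hr hσ (y := x), perm_apply_inv]

/-- Order automorphisms form a lattice. -/
theorem exists_sup {σ τ : Equiv.Perm M} (hσ : σ ∈ G₂) (hτ : τ ∈ G₂) :
    ∃ ρ ∈ G₂, ∀ x, ρ x = max (σ x) (τ x) := by
  have hmono : StrictMono fun x => max (σ x) (τ x) := fun x y hxy =>
    max_lt_max ((lt_iff_of_mem hr hσ).2 hxy) ((lt_iff_of_mem hr hτ).2 hxy)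
  -- The inverse is the pointwise minimum of the inverses.
  have hsurj : Function.Surjective fun x => max (σ x) (τ x) := fun y => by
    rcases le_total (σ⁻¹ y) (τ⁻¹ y) with h | h
    · refine ⟨σ⁻¹ y, ?_⟩
      have : τ (σ⁻¹ y) ≤ y := by
        rw [← perm_apply_inv τ y, le_iff_of_mem hr hτ, perm_apply_inv]; exact h
      simpa using this
    · refine ⟨τ⁻¹ y, ?_⟩
      have : σ (τ⁻¹ y) ≤ y := by
        rw [← perm_apply_inv σ y, le_iff_of_mem hr hσ, perm_apply_inv]; exact h
      simpa using this
  exact ⟨Equiv.ofBijective _ ⟨hmono.injective, hsurj⟩, hr.mem_iff.2 fun x y => hmono.lt_iff_lt,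
    fun x => rfl⟩

/-- The intervals between consecutive elements of an orbit cover everything. -/
theorem exists_zpow_le_lt (hg : g ∈ G₂) (hu : IsUnboundedlyIncreasing (fun x y : M => x < y) g)
    (p x : M) : ∃ i : ℤ, (g ^ i) p ≤ x ∧ x < (g ^ (i + 1)) p := by
  have hmono := zpow_strictMono hu.1 p
  have hupper : ∀ p x : M, ∃ m : ℕ, x < (g ^ m) p := fun p x => by
    rcases lt_trichotomy p x with h | rfl | h
    · exact hu.2 p x h
    · exact ⟨1, by simpa using hu.1 p⟩
    · exact ⟨0, by simpa using h⟩
  obtain ⟨m, hm⟩ := hupper p x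
  obtain ⟨n, hn⟩ := hupper x p
  obtain ⟨i, hi, hmax⟩ := Int.exists_greatest_of_bdd (P := fun i : ℤ => (g ^ i) p ≤ x)
    ⟨m, fun z hz => by
      by_contra hlt
      have := hmono (not_le.1 hlt)
      simp only [zpow_natCast] at this
      exact absurd (hm.trans this) (not_lt.2 hz)⟩
    ⟨-n, by
      have hn' := (inv_lt_iff_of_mem hr (G₂.pow_mem hg n)).1 hn
      rw [zpow_neg, zpow_natCast]
      exact hn'.le⟩
  refine ⟨i, hi, ?_⟩
  by_contra hlt
  have := hmax (i + 1) (not_lt.1 hlt)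
  omega

theorem zpow_lt_iff (hg : g ∈ G₂) (i : ℤ) {x y : M} : (g ^ i) x < (g ^ i) y ↔ x < y :=
  lt_iff_of_mem hr (G₂.zpow_mem hg i)

theorem zpow_le_iff (hg : g ∈ G₂) (i : ℤ) {x y : M} : (g ^ i) x ≤ (g ^ i) y ↔ x ≤ y :=
  le_iff_of_mem hr (G₂.zpow_mem hg i)

/-- Two unboundedly increasing automorphisms that agree at `p` are conjugate by an automorphism
that is the identity on the interval from `p` to its image. -/
theorem exists_conjugating (hg : g ∈ G₂) (hf : f ∈ G₂)
    (hgu : IsUnboundedlyIncreasing (fun x y : M => x < y) g)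
    (hfu : IsUnboundedlyIncreasing (fun x y : M => x < y) f) {p : M} (hp : f p = g p) :
    ∃ β ∈ G₂, (∀ x, p ≤ x → x < g p → β x = x) ∧ ∀ x, β (f x) = g (β x) := by
  have hgm := zpow_strictMono hgu.1 p
  have hfm := zpow_strictMono hfu.1 p
  have uniq : ∀ (k : Equiv.Perm M), StrictMono (fun i : ℤ => (k ^ i) p) → ∀ (x : M) (i j : ℤ),
      (k ^ i) p ≤ x → x < (k ^ (i + 1)) p → (k ^ j) p ≤ x → x < (k ^ (j + 1)) p → i = j := by
    intro k hk x i j h1 h2 h3 h4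
    have a1 := hk.lt_iff_lt.1 (h1.trans_lt h4)
    have a2 := hk.lt_iff_lt.1 (h3.trans_lt h2)
    omega
  choose N hN₁ hN₂ using fun x => exists_zpow_le_lt hr hf hfu p x
  have hNeq : ∀ x i, (f ^ i) p ≤ x → x < (f ^ (i + 1)) p → N x = i := fun x i h1 h2 =>
    uniq f hfm x _ _ (hN₁ x) (hN₂ x) h1 h2
  -- The interval from `(f ^ n) p` to `(f ^ (n + 1)) p` is brought back to the fundamental domain by
  -- `f` and carried out again by `g`. The pieces fit because `f p = g p` makes the two fundamental
  -- domains equal.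
  let β : M → M := fun x => (g ^ N x) ((f ^ (-N x)) x)
  -- the representative of `x` in the fundamental domain
  have hrep : ∀ x, p ≤ (f ^ (-N x)) x ∧ (f ^ (-N x)) x < g p := fun x => by
    constructor
    · rw [← zpow_le_iff hr hf (N x), ← Equiv.Perm.mul_apply, ← zpow_add]
      simpa using hN₁ x
    · rw [← hp, ← zpow_lt_iff hr hf (N x), ← Equiv.Perm.mul_apply, ← zpow_add,
        ← Equiv.Perm.mul_apply, ← zpow_add_one]
      simpa using hN₂ x
  have hβ₁ : ∀ x, (g ^ N x) p ≤ β x := fun x => (zpow_le_iff hr hg _).2 (hrep x).1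
  have hβ₂ : ∀ x, β x < (g ^ (N x + 1)) p := fun x => by
    rw [zpow_add_one, Equiv.Perm.mul_apply]
    exact (zpow_lt_iff hr hg _).2 (hrep x).2
  have hmono : StrictMono β := fun x y hxy => by
    have hle : N x ≤ N y := by
      by_contra hlt
      have h1 : N y + 1 ≤ N x := by omega
      have h2 := (hN₂ y).trans_le (hfm.monotone h1)
      exact absurd (hxy.trans h2) (not_lt.2 (hN₁ x))
    rcases hle.eq_or_lt with h | h
    · change (g ^ N x) ((f ^ (-N x)) x) < (g ^ N y) ((f ^ (-N y)) y)
      rw [← h]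
      exact (zpow_lt_iff hr hg _).2 ((zpow_lt_iff hr hf _).2 hxy)
    · have h1 : N x + 1 ≤ N y := by omega
      exact (hβ₂ x).trans_le ((hgm.monotone h1).trans (hβ₁ y))
  have hsurj : Function.Surjective β := fun y => by
    obtain ⟨i, hi₁, hi₂⟩ := exists_zpow_le_lt hr hg hgu p y
    have h1 : p ≤ (g ^ (-i)) y := by
      rw [← zpow_le_iff hr hg i, ← Equiv.Perm.mul_apply, ← zpow_add]
      simpa using hi₁
    have h2 : (g ^ (-i)) y < f p := by
      rw [hp, ← zpow_lt_iff hr hg i, ← Equiv.Perm.mul_apply, ← zpow_add,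
        ← Equiv.Perm.mul_apply, ← zpow_add_one]
      simpa using hi₂
    have hNx : N ((f ^ i) ((g ^ (-i)) y)) = i := hNeq _ _ ((zpow_le_iff hr hf i).2 h1) (by
      rw [zpow_add_one, Equiv.Perm.mul_apply]
      exact (zpow_lt_iff hr hf i).2 h2)
    refine ⟨(f ^ i) ((g ^ (-i)) y), ?_⟩
    change (g ^ N _) ((f ^ (-N _)) _) = y
    rw [hNx, ← Equiv.Perm.mul_apply (f ^ (-i)), ← zpow_add, ← Equiv.Perm.mul_apply]
    simp
  refine ⟨Equiv.ofBijective β ⟨hmono.injective, hsurj⟩, hr.mem_iff.2 fun x y => hmono.lt_iff_lt,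
    fun x h1 h2 => ?_, fun x => ?_⟩
  · have : N x = 0 := hNeq x 0 (by simpa using h1) (by simpa [hp] using h2)
    change (g ^ N x) ((f ^ (-N x)) x) = x
    rw [this]; simp
  · have : N (f x) = N x + 1 := hNeq _ _ (by
      rw [add_comm, zpow_add, zpow_one, Equiv.Perm.mul_apply, le_iff_of_mem hr hf]
      exact hN₁ x) (by
      rw [add_comm, zpow_add, zpow_one, Equiv.Perm.mul_apply, lt_iff_of_mem hr hf]
      exact hN₂ x)
    change (g ^ N (f x)) ((f ^ (-N (f x))) (f x)) = g ((g ^ N x) ((f ^ (-N x)) x))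
    rw [this]
    have e1 : (f ^ (-(N x + 1))) (f x) = (f ^ (-N x)) x := by
      rw [← Equiv.Perm.mul_apply, ← zpow_add_one]
      congr 2
      omega
    rw [e1, add_comm, zpow_add, zpow_one, Equiv.Perm.mul_apply]

end OrderAutomorphisms

/-- A finite union of orbit segments of equal length that start in a fundamental domain of `g`. -/
def IsOrbitBlock (g : Equiv.Perm M) (X : Set M) : Prop :=
  ∃ (p : M) (S₀ : Set M) (k : ℕ), S₀.Finite ∧ p ∈ S₀ ∧ (∀ s ∈ S₀, p ≤ s ∧ s < g p) ∧
    X = ⋃ i ∈ Set.Iic k, (g ^ i) '' S₀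

theorem IsOrbitBlock.finite (h : IsOrbitBlock g X) : X.Finite := by
  obtain ⟨p, S₀, k, hS₀, -, -, rfl⟩ := h
  exact (Set.finite_Iic k).biUnion fun i _ => hS₀.image _

/-- With `p` below all of `X₀`, the points of `X₀` are translated back into the fundamental domain
at `p`, and `k` bounds the exponents needed. -/
theorem exists_orbitBlock [Nonempty M] (hr : IsHomogeneousTournament G₂ (fun x y : M => x < y))
    (hg : g ∈ G₂) (hu : IsUnboundedlyIncreasing (fun x y : M => x < y) g) {X₀ : Set M}
    (hX₀ : X₀.Finite) : ∃ X, IsOrbitBlock g X ∧ X₀ ⊆ X := by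
  obtain ⟨p, hp⟩ : ∃ p, ∀ x ∈ X₀, p ≤ x := by
    rcases X₀.eq_empty_or_nonempty with rfl | hne
    · exact ⟨Classical.arbitrary M, by simp⟩
    · obtain ⟨p, _, hp⟩ := Set.exists_min_image X₀ id hX₀ hne
      exact ⟨p, hp⟩
  have hmono := zpow_strictMono hu.1 p
  have hN : ∀ x, ∃ i : ℕ, x ∈ X₀ → (g ^ i) p ≤ x ∧ x < (g ^ (i + 1)) p := fun x => by
    by_cases hx : x ∈ X₀
    · obtain ⟨i, h1, h2⟩ := exists_zpow_le_lt hr hg hu p x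
      have hi : 0 ≤ i := by
        by_contra hlt
        have h3 : i + 1 ≤ 0 := by omega
        have h4 := h2.trans_le (hmono.monotone h3)
        simp only [zpow_zero, Equiv.Perm.one_apply] at h4
        exact absurd h4 (not_lt.2 (hp x hx))
      lift i to ℕ using hi
      refine ⟨i, fun _ => ⟨by simpa using h1, ?_⟩⟩
      exact_mod_cast h2
    · exact ⟨0, fun h => (hx h).elim⟩
  choose N hN using hN
  obtain ⟨k, hk⟩ := (hX₀.image N).bddAbove
  refine ⟨_, ⟨p, insert p ((fun x => (g ^ N x)⁻¹ x) '' X₀), k, (hX₀.image _).insert p,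
    Set.mem_insert _ _, ?_, rfl⟩, ?_⟩
  · rintro s (rfl | ⟨x, hx, rfl⟩)
    · exact ⟨le_rfl, hu.1 _⟩
    · have hmem := G₂.pow_mem hg (N x)
      constructor
      · rw [← le_iff_of_mem hr hmem, perm_apply_inv]
        exact (hN x hx).1
      · rw [← lt_iff_of_mem hr hmem, perm_apply_inv, ← Equiv.Perm.mul_apply, ← pow_succ]
        exact (hN x hx).2
  · intro x hx
    exact Set.mem_biUnion (show N x ∈ Set.Iic k from hk ⟨x, hx, rfl⟩)
      ⟨(g ^ N x)⁻¹ x, Or.inr ⟨x, hx, rfl⟩, perm_apply_inv _ x⟩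

/-- The gaps of the image of an orbit block are at most as long as a step of `g`. -/
theorem IsOrbitBlock.exists_le_lt (hr : IsHomogeneousTournament G₂ (fun x y : M => x < y))
    (hg : g ∈ G₂) (hu : IsUnboundedlyIncreasing (fun x y : M => x < y) g) (hX : IsOrbitBlock g X)
    {w y₁ y₂ : M} (h₁ : y₁ ∈ g '' X) (h₂ : y₂ ∈ g '' X) (hw₁ : y₁ ≤ w) (hw₂ : w ≤ y₂) :
    ∃ y ∈ g '' X, y ≤ w ∧ w < g y := by
  obtain ⟨p, S₀, k, hS₀, hp, hS, rfl⟩ := hX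
  have hmono := zpow_strictMono hu.1 p
  have hel : ∀ y ∈ g '' ⋃ i ∈ Set.Iic k, (g ^ i) '' S₀, g p ≤ y ∧ y < (g ^ (k + 2)) p := by
    rintro _ ⟨_, hx, rfl⟩
    obtain ⟨i, hi, s, hs, rfl⟩ := Set.mem_iUnion₂.1 hx
    constructor
    · rw [le_iff_of_mem hr hg]
      refine le_trans ?_ ((le_iff_of_mem hr (G₂.pow_mem hg i)).2 (hS s hs).1)
      have := hmono.monotone (show (0 : ℤ) ≤ i by omega)
      simpa using this
    · have h1 : g ((g ^ i) s) < (g ^ (i + 2)) p := by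
        rw [← Equiv.Perm.mul_apply, ← pow_succ', pow_succ _ (i + 1), Equiv.Perm.mul_apply]
        exact (lt_iff_of_mem hr (G₂.pow_mem hg (i + 1))).2 (hS s hs).2
      have h2 := hmono.monotone (show ((i + 2 : ℕ) : ℤ) ≤ ((k + 2 : ℕ) : ℤ) by
        have : i ≤ k := hi
        omega)
      simp only [zpow_natCast] at h2
      exact h1.trans_le h2
  -- The points `(g ^ j) p` with `1 ≤ j ≤ k + 1` lie in `g '' X`, and the bounds `y₁`, `y₂` force
  -- `j` into this range.
  obtain ⟨j, hj₁, hj₂⟩ := exists_zpow_le_lt hr hg hu p w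
  have j1 : 1 ≤ j := by
    have h1 : (g ^ (1 : ℤ)) p < (g ^ (j + 1)) p := by
      simpa using ((hel y₁ h₁).1.trans hw₁).trans_lt hj₂
    have := hmono.lt_iff_lt.1 h1
    omega
  have j2 : j < k + 2 := by
    have h1 : (g ^ j) p < (g ^ ((k + 2 : ℕ) : ℤ)) p := by
      rw [zpow_natCast]
      exact (hj₁.trans hw₂).trans_lt (hel y₂ h₂).2
    have := hmono.lt_iff_lt.1 h1
    omega
  obtain ⟨i, rfl⟩ : ∃ i : ℕ, j = i + 1 := ⟨(j - 1).toNat, by omega⟩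
  have e : ∀ i : ℕ, (g ^ ((i : ℤ) + 1)) p = g ((g ^ i) p) := fun i => by
    rw [add_comm, zpow_add, zpow_one, zpow_natCast, Equiv.Perm.mul_apply]
  refine ⟨g ((g ^ i) p), ⟨_, Set.mem_biUnion (show i ∈ Set.Iic k from ?_) ⟨p, hp, rfl⟩, rfl⟩, ?_, ?_⟩
  · change i ≤ k
    omega
  · rw [← e]; exact hj₁
  · rw [add_comm _ (1 : ℤ), zpow_add, zpow_one, Equiv.Perm.mul_apply, e] at hj₂
    exact hj₂

end Order

/-! ### Fullness in order expansions -/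

section OrderFull

variable {M : Type w} [LinearOrder M]
variable {G₁ G₂ : Subgroup (Equiv.Perm M)} {I : Set M → Set M → Set M → Prop}
variable {g f : Equiv.Perm M} {X : Set M}

/-- A finite set of points can be separated by finitely many other points. -/
theorem exists_separating [DenselyOrdered M] {P : Set M} (hP : P.Finite) :
    ∃ F : Set M, F.Finite ∧ (∀ e ∈ F, e ∉ P) ∧
      ∀ p ∈ P, ∀ p' ∈ P, p < p' → ∃ e ∈ F, p < e ∧ e < p' := by
  have hex : ∀ p p' : M, ∃ e, p < p' → e ∉ P ∧ p < e ∧ e < p' := fun p p' => by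
    by_cases h : p < p'
    · obtain ⟨e, he, heP⟩ := (Set.Ioo_infinite h).exists_notMem_finite hP
      exact ⟨e, fun _ => ⟨heP, he.1, he.2⟩⟩
    · exact ⟨p, fun h' => (h h').elim⟩
  choose E hE using hex
  refine ⟨⋃ p ∈ P, ⋃ p' ∈ P, {e | e = E p p' ∧ p < p'}, hP.biUnion fun p _ => hP.biUnion fun p' _ =>
    (Set.finite_singleton (E p p')).subset fun e he => he.1, ?_, ?_⟩
  · intro e he
    simp only [Set.mem_iUnion] at he
    obtain ⟨p, hp, p', hp', rfl, hlt⟩ := he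
    exact (hE p p' hlt).1
  · intro p hp p' hp' hlt
    exact ⟨E p p', Set.mem_biUnion hp (Set.mem_biUnion hp' ⟨rfl, hlt⟩), (hE p p' hlt).2⟩

/-- The elements `x` and `y` realize the same cut over `F`. -/
def SameCut (F : Set M) (x y : M) : Prop := ∀ e ∈ F, (e < x ↔ e < y) ∧ (x < e ↔ y < e)

theorem SameCut.refl (F : Set M) (x : M) : SameCut F x x := fun _ _ => ⟨Iff.rfl, Iff.rfl⟩

theorem SameCut.lt {F : Set M} {P : Set M}
    (hsep : ∀ p ∈ P, ∀ p' ∈ P, p < p' → ∃ e ∈ F, p < e ∧ e < p') {x x' p p' : M} (hp : p ∈ P)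
    (hp' : p' ∈ P) (h : SameCut F x p) (h' : SameCut F x' p') (hlt : p < p') : x < x' := by
  obtain ⟨e, he, h1, h2⟩ := hsep p hp p' hp' hlt
  exact ((h e he).2.2 h1).trans ((h' e he).1.2 h2)

theorem SameCut.of_typeEq (hr : IsHomogeneousTournament G₂ (fun x y : M => x < y)) {F : Set M}
    {x y : M} (h : TypeEq G₂ F x y) : SameCut F x y := fun _ he =>
  ⟨hr.iff_of_typeEq' h he, hr.iff_of_typeEq h he⟩

theorem SameCut.trans {F : Set M} {x y z : M} (h : SameCut F x y) (h' : SameCut F y z) :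
    SameCut F x z := fun e he =>
  ⟨(h e he).1.trans (h' e he).1, (h e he).2.trans (h' e he).2⟩

theorem SameCut.symm {F : Set M} {x y : M} (h : SameCut F x y) : SameCut F y x := fun e he =>
  ⟨(h e he).1.symm, (h e he).2.symm⟩

theorem exists_shift (θ : M ≃o ℚ) (hr : IsHomogeneousTournament G₂ (fun x y : M => x < y))
    (δ : ℚ) : ∃ σ ∈ G₂, ∀ x, θ (σ x) = θ x + δ := by
  refine ⟨(θ.toEquiv.trans (Equiv.addRight δ)).trans θ.toEquiv.symm, hr.mem_iff.2 fun x y => ?_,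
    fun x => ?_⟩
  · change θ.symm (θ x + δ) < θ.symm (θ y + δ) ↔ x < y
    simp
  · change θ (θ.symm (θ x + δ)) = θ x + δ
    simp

/-- A finite increasing map can be extended to an unboundedly increasing automorphism. -/
theorem exists_unbounded_eqOn (θ : M ≃o ℚ)
    (hr : IsHomogeneousTournament G₂ (fun x y : M => x < y)) {η : Equiv.Perm M} (hη : η ∈ G₂)
    {T : Set M} (hT : T.Finite) (hinc : ∀ t ∈ T, t < η t) :
    ∃ f ∈ G₂, IsUnboundedlyIncreasing (fun x y : M => x < y) f ∧ Set.EqOn f η T := by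
  -- The maximum of `η` and the translation by `δ` moves every point by at least `δ`, and equals `η`
  -- on `T` as `δ` does not exceed the displacements there.
  obtain ⟨δ, hδ, hδT⟩ : ∃ δ : ℚ, 0 < δ ∧ ∀ t ∈ T, θ t + δ ≤ θ (η t) := by
    rcases T.eq_empty_or_nonempty with rfl | hne
    · exact ⟨1, one_pos, by simp⟩
    · obtain ⟨t₀, ht₀, hmin⟩ := Set.exists_min_image T (fun t => θ (η t) - θ t) hT hne
      refine ⟨θ (η t₀) - θ t₀, sub_pos.2 (θ.lt_iff_lt.2 (hinc t₀ ht₀)), fun t ht => ?_⟩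
      have := hmin t ht
      linarith
  obtain ⟨σ, hσ, hσθ⟩ := exists_shift θ hr δ
  obtain ⟨f, hf, hfmax⟩ := exists_sup hr hη hσ
  have hfδ : ∀ x, θ x + δ ≤ θ (f x) := fun x => by
    rw [← hσθ, θ.le_iff_le, hfmax]
    exact le_max_right _ _
  refine ⟨f, hf, ⟨fun x => ?_, fun a b _ => ?_⟩, fun t ht => ?_⟩
  · have := hfδ x
    exact θ.lt_iff_lt.1 (by linarith)
  · have hpow : ∀ m : ℕ, θ a + m * δ ≤ θ ((f ^ m) a) := fun m => by
      induction m with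
      | zero => simp
      | succ m ih =>
        rw [pow_succ', Equiv.Perm.mul_apply]
        have := hfδ ((f ^ m) a)
        rw [Nat.cast_succ]
        linarith
    obtain ⟨m, hm⟩ := exists_nat_gt ((θ b - θ a) / δ)
    refine ⟨m, θ.lt_iff_lt.1 ?_⟩
    rw [div_lt_iff₀ hδ] at hm
    have := hpow m
    linarith
  · rw [hfmax, max_eq_left]
    rw [← θ.le_iff_le, hσθ]
    exact hδT t ht

/-- In the order alone, an unboundedly increasing `f` that equals `η` on `S ∪ X` is conjugate to `g`
by some `β`, and `β '' S` is a copy as desired. But `β` need not preserve the first structure. The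
copy in the fusion therefore stays in the cuts of the points `β s` over a finite set fine enough to
decide all comparisons. -/
theorem fullFor_order [Countable M] (θ : M ≃o ℚ) (hF : IsFusionPair G₁ G₂)
    (hI : IsIndependence G₁ I) (hr : IsHomogeneousTournament G₂ (fun x y : M => x < y))
    (hg : g ∈ G₁ ⊓ G₂) (hm : Moves (G₁ ⊓ G₂) (fun W x y => I {x} W {y}) g)
    (hu : IsUnboundedlyIncreasing (fun x y : M => x < y) g) (hblock : IsOrbitBlock g X) :
    FullFor (G₁ ⊓ G₂) I (fun x y : M => x < y) g X := by
  have : DenselyOrdered M := ⟨fun a b h => by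
    obtain ⟨c, hac, hcb⟩ := exists_between (θ.lt_iff_lt.2 h)
    exact ⟨θ.symm c, (OrderIso.lt_symm_apply θ).2 hac, (OrderIso.symm_apply_lt θ).2 hcb⟩⟩
  refine FullFor.of_disjoint hI fun S τ hS hSX hτ hτf hrS hp => ?_
  have hX : X.Finite := hblock.finite
  set Y : Set M := g '' X with hYdef
  have hY : Y.Finite := hX.image _
  set η : Equiv.Perm M := τ * g with hη
  have hηG : η ∈ G₁ ⊓ G₂ := mul_mem hτ hg
  have hηX : ∀ x ∈ X, η x = g x := fun x hx => hτf _ ⟨x, hx, rfl⟩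
  obtain ⟨f, hf, hfu, hfη⟩ := exists_unbounded_eqOn θ hr hηG.2 (hS.union hX) (by
    rintro t (ht | ht)
    · exact hrS t ht
    · rw [hηX t ht]; exact hu.1 t)
  obtain ⟨p, S₀, k, hS₀, hpS₀, hSp, hXeq⟩ := hblock
  have hS₀X : ∀ i ≤ k, ∀ s ∈ S₀, (g ^ i) s ∈ X := fun i hi s hs => by
    rw [hXeq]
    exact Set.mem_biUnion (show i ∈ Set.Iic k from hi) ⟨s, hs, rfl⟩
  have hpX : p ∈ X := hS₀X 0 (Nat.zero_le _) p hpS₀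
  have hfX : ∀ x ∈ X, f x = g x := fun x hx => (hfη (Or.inr hx)).trans (hηX x hx)
  obtain ⟨β, hβ, hβp, hβf⟩ := exists_conjugating hr hg.2 hf hu hfu (hfX p hpX)
  -- Initially `β` is the identity on the fundamental domain only. As `f` equals `g` on `X`, the
  -- relation `β f = g β` carries this along the orbit segments, one step beyond `X`.
  have hβpow : ∀ i ≤ k + 1, ∀ s ∈ S₀, β ((g ^ i) s) = (g ^ i) s := by
    intro i
    induction i with
    | zero =>
      intro _ s hs
      exact hβp s (hSp s hs).1 (hSp s hs).2
    | succ i ih =>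
      intro hi s hs
      rw [pow_succ', Equiv.Perm.mul_apply, ← hfX _ (hS₀X i (by omega) s hs), hβf,
        ih (by omega) s hs, hfX _ (hS₀X i (by omega) s hs)]
  have hβXY : ∀ z ∈ X ∪ Y, β z = z := by
    have hXrep : ∀ x ∈ X, ∃ i ≤ k, ∃ s ∈ S₀, (g ^ i) s = x := fun x hx => by
      rw [hXeq] at hx
      obtain ⟨i, hi, s, hs, e⟩ := Set.mem_iUnion₂.1 hx
      exact ⟨i, hi, s, hs, e⟩
    rintro z (hz | ⟨x, hx, rfl⟩)
    · obtain ⟨i, hi, s, hs, rfl⟩ := hXrep z hz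
      exact hβpow i (by omega) s hs
    · obtain ⟨i, hi, s, hs, rfl⟩ := hXrep x hx
      rw [← Equiv.Perm.mul_apply g, ← pow_succ']
      exact hβpow (i + 1) (by omega) s hs
  have hβη : ∀ s ∈ S, β (η s) = g (β s) := fun s hs => by
    rw [← hfη (Or.inl hs), hβf]
  have hSXY : ∀ s ∈ S, s ∉ X ∪ Y := fun s hs h => by
    have hsX : s ∉ X := fun h' => by
      have : s ∈ S ∩ X := ⟨hs, h'⟩
      rw [hSX] at this
      exact this
    exact h.elim hsX fun h => hsX (hI.disj hp.2 hs (Or.inr h))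
  set P : Set M := X ∪ Y ∪ β '' S ∪ β '' (η '' S) with hPdef
  have hPf : P.Finite := ((hX.union hY).union (hS.image _)).union ((hS.image _).image _)
  have hPXY : ∀ z ∈ X ∪ Y, z ∈ P := fun z hz => Or.inl (Or.inl hz)
  have hPβ : ∀ s ∈ S, β s ∈ P := fun s hs => Or.inl (Or.inr ⟨s, hs, rfl⟩)
  have hPη : ∀ s ∈ S, β (η s) ∈ P := fun s hs => Or.inr ⟨η s, ⟨s, hs, rfl⟩, rfl⟩
  obtain ⟨F₀, hF₀, hF₀P, hsep⟩ := exists_separating hPf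
  -- The cut of `g (a s)` over `F₀` is determined by that of `a s` over `g⁻¹(F₀)`.
  set F' : Set M := F₀ ∪ (g⁻¹ : Equiv.Perm M) '' F₀ with hF'def
  have hF' : F'.Finite := hF₀.union (hF₀.image _)
  have hβF' : ∀ s ∈ S, β s ∉ F' := by
    rintro s hs (h | ⟨e, he, h⟩)
    · exact hF₀P _ h (hPβ s hs)
    · rw [Equiv.Perm.inv_eq_iff_eq, ← hβη s hs] at h
      exact hF₀P e he (h ▸ hPη s hs)
  have cut₀ : ∀ {x y : M}, SameCut F' x y → SameCut F₀ x y := fun h e he => h e (Or.inl he)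
  obtain ⟨a, ha, haf, -, h₂, hQa⟩ := exists_indepPair_image hF hI hg hm hX hS
    (hI.mono_right hp.2 Set.subset_union_right)
    (fun S' a => ∀ s ∈ S', SameCut F' (a s) (β s))
    (by simp)
    (fun S' a s _ hs hsX _ _ _ => (hSXY s hs (Or.inl hsX)).elim)
    (by
      intro S' a s F hS'S hs hsS' hsXY ha haf hQa hFf _
      have hS' : S'.Finite := hS.subset hS'S
      have hPf' : (X ∪ Y ∪ a '' S').Finite := (hX.union hY).union (hS'.image _)
      obtain ⟨q, hq, hqE⟩ := hF.exists_fresh hI hF' (hFf.union hPf') (hβF' s hs)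
      have hqcut : SameCut F' q (β s) := (SameCut.of_typeEq hr hq).symm
      refine ⟨F ∪ F', q, hFf.union hF', Set.subset_union_left, ?_, ?_, ?_⟩
      · rintro (h | h)
        exacts [hqE (Or.inl h), hq.notMem (hβF' s hs) h]
      · refine hr.typeEq hPf' ?_ (fun h => hqE (Or.inr h)) ?_
        · rintro (h | ⟨c, hc, e⟩)
          · exact hsXY (a.injective (haf _ h) ▸ h)
          · exact hsS' (a.injective e ▸ hc)
        · -- the cut of `q` is that of `β s`
          have main : ∀ c ∈ X ∪ Y ∪ S', c ≠ s → (a s < a c ↔ q < a c) := by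
            intro c hc hcs
            have hcP : β c ∈ P := hc.elim (fun h => by rw [hβXY c h]; exact hPXY c h)
              fun h => hPβ c (hS'S h)
            have hcut : SameCut F' (a c) (β c) := by
              rcases hc with hc | hc
              · rw [haf c hc, hβXY c hc]; exact SameCut.refl _ _
              · exact hQa c hc
            rw [lt_iff_of_mem hr ha.2]
            constructor
            · intro h
              exact SameCut.lt hsep (hPβ s hs) hcP (cut₀ hqcut) (cut₀ hcut)
                ((lt_iff_of_mem hr hβ).2 h)
            · intro h
              by_contra hn
              have hlt : c < s := lt_of_le_of_ne (not_lt.1 hn) hcs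
              exact lt_asymm h (SameCut.lt hsep hcP (hPβ s hs) (cut₀ hcut) (cut₀ hqcut)
                ((lt_iff_of_mem hr hβ).2 hlt))
          rintro b (hb | ⟨c, hc, rfl⟩)
          · have := main b (Or.inl hb) (fun e => hsXY (e ▸ hb))
            rwa [haf b hb] at this
          · exact main c (Or.inr hc) (fun e => hsS' (e ▸ hc))
      · intro a' ha' haf' hEq htq
        rintro s₁ (rfl | hs₁)
        · exact (SameCut.of_typeEq hr (htq.mono Set.subset_union_right)).symm.trans hqcut
        · rw [hEq hs₁]; exact hQa s₁ hs₁)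
  have hcutη : ∀ s ∈ S, SameCut F₀ (g (a s)) (β (η s)) := by
    intro s hs e he
    have := hQa s hs _ (Or.inr ⟨e, he, rfl⟩)
    rw [hβη s hs, inv_lt_iff_of_mem hr hg.2, lt_inv_iff_of_mem hr hg.2,
      inv_lt_iff_of_mem hr hg.2, lt_inv_iff_of_mem hr hg.2]
    exact this
  have hcutc : ∀ c ∈ X ∪ S, SameCut F₀ (a c) (β c) ∧ β c ∈ P := by
    rintro c (hc | hc)
    · rw [haf c (Or.inl hc), hβXY c (Or.inl hc)]
      exact ⟨SameCut.refl _ _, hPXY c (Or.inl hc)⟩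
    · exact ⟨cut₀ (hQa c hc), hPβ c hc⟩
  refine exists_conj_eq hF hI hr hg hX hS hτ hτf hp ha haf h₂ ?_ ?_
  · intro s hs c hc hlt
    exact SameCut.lt hsep (hPη s hs) (hcutc c hc).2 (hcutη s hs) (hcutc c hc).1
      ((lt_iff_of_mem hr hβ).2 hlt)
  · intro s hs c hc hlt
    exact SameCut.lt hsep (hcutc c hc).2 (hPη s hs) (hcutc c hc).1 (hcutη s hs)
      ((lt_iff_of_mem hr hβ).2 hlt)

end OrderFull

/-! ### The transfer condition, and its proof for tournaments -/

section Transfer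

variable {M : Type w}
variable {G₁ G₂ : Subgroup (Equiv.Perm M)} {I : Set M → Set M → Set M → Prop}
variable {r : M → M → Prop} {g f : Equiv.Perm M} {X Z Z' : Set M}

/-- The conclusion of the transfer condition for `f`, formulated with permutations. -/
def TransferConclusion (G₁ G₂ : Subgroup (Equiv.Perm M)) (I : Set M → Set M → Set M → Prop)
    (r : M → M → Prop) (f : Equiv.Perm M) (Y Z Z' : Set M) {ι : Type*} (x z : ι → M) : Prop :=
  ∃ b' ∈ G₁ ⊓ G₂, (∀ y ∈ Y ∪ Z, b' y = y) ∧
    I (Set.range fun i => b'⁻¹ (f (b' (z i)))) Y ((b'⁻¹ : Equiv.Perm M) '' (f '' Z')) ∧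
    I (Set.range fun i => b' (z i)) Z' (f '' Z') ∧
    ∃ ρ ∈ G₂, (∀ y ∈ (b'⁻¹ : Equiv.Perm M) '' (f '' Z'), ρ y = y) ∧
      ∀ i, r (x i) (ρ (b'⁻¹ (f (b' (z i))))) ∧ r (z i) (ρ (b'⁻¹ (f (b' (z i)))))

/-- The independence required follows from placing `b' x` and `b' z` independently from `Z' ∪ f(Z')`
over `g(X) ∪ Z`. After conjugation by `b'`, the common realization amounts to a `ρ` fixing `f(Z')`
such that `b' x` and `b' z` are related to `ρ (f (b' z))`. Indices with `z i ∈ Z` need no care, as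
there `f (z i) = g (x i)`. -/
theorem transferConclusion_of_exists [Countable M] (hF : IsFusionPair G₁ G₂)
    (hI : IsIndependence G₁ I) (hr : IsHomogeneousTournament G₂ r) (hf : f ∈ G₁ ⊓ G₂)
    (hgr : ∀ x, r x (g x)) (hfr : ∀ x, r x (f x)) (hX : X.Finite) (hZ : Z.Finite)
    (hZ' : Z'.Finite) (hZZ' : Z ⊆ Z') (hY : f '' Z = g '' X) {ι : Type*} [Finite ι] {x z : ι → M}
    {σ : Equiv.Perm M} (hσY : ∀ y ∈ g '' X, σ y = y) (hσz : ∀ i, σ (f (z i)) = g (x i))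
    (hz : I (Set.range z) Z (g '' X ∪ X)) (hx : I (Set.range x) X (g '' X ∪ Z))
    {β : Equiv.Perm M} (hβ : β ∈ G₂) (hβB : ∀ y ∈ g '' X ∪ Z, β y = y)
    (hβT : ∀ t ∈ Set.range x ∪ Set.range z, β t ∈ Z' ∪ f '' Z' → t ∈ g '' X ∪ Z)
    (hρ : ∀ b' ∈ G₁ ⊓ G₂, (∀ y ∈ g '' X ∪ Z, b' y = y) → ∀ κ ∈ G₂,
      (∀ y ∈ Z' ∪ f '' Z', κ y = y) →
      (∀ i, κ (β (x i)) = b' (x i)) → (∀ i, κ (β (z i)) = b' (z i)) →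
      (∀ i, z i ∉ Z → b' (z i) ∉ f '' Z' ∧ b' (x i) ∉ f '' Z' ∧ f (b' (z i)) ∉ f '' Z') →
      ∃ ρ ∈ G₂, (∀ y ∈ f '' Z', ρ y = y) ∧ ∀ i, z i ∉ Z →
        r (b' (x i)) (ρ (f (b' (z i)))) ∧ r (b' (z i)) (ρ (f (b' (z i))))) :
    TransferConclusion G₁ G₂ I r f (g '' X) Z Z' x z := by
  have hB : (g '' X ∪ Z).Finite := (hX.image _).union hZ
  have hC : (Z' ∪ f '' Z').Finite := hZ'.union (hZ'.image _)
  obtain ⟨b', hb', hb'B, hind, κ, hκ, hκf, hκT⟩ := exists_indep_set hF hI hB hC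
    ((Set.finite_range x).union (Set.finite_range z)) hβ hβB hβT
  have hb'Z : b' '' Z = Z := image_eq_of_fix fun a ha => hb'B a (Or.inr ha)
  have hrz : b' '' Set.range z = Set.range fun i => b' (z i) := (Set.range_comp _ _).symm
  have hz₁ : I (Set.range fun i => b' (z i)) Z (g '' X) := by
    have := hI.map hb'.1 (hI.mono_right hz Set.subset_union_left)
    rwa [hb'Z, hrz, image_eq_of_fix fun a ha => hb'B a (Or.inl ha)] at this
  have hz₂ : I (Set.range fun i => b' (z i)) (g '' X ∪ Z) (Z' ∪ f '' Z') :=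
    hI.mono_left hind (by rw [← hrz]; exact Set.image_mono Set.subset_union_right)
  -- The base loses `g '' X` because the tuple is independent from it over `Z`.
  have hz₃ : I (Set.range fun i => b' (z i)) Z (Z' ∪ f '' Z') :=
    hI.trans hz₁ hz₂ Set.subset_union_right (by rw [Set.union_comm]) Set.subset_union_right
  have hZmem : ∀ i, b' (z i) ∈ Z' ∪ f '' Z' → z i ∈ Z := fun i h => by
    have h1 := hI.disj hz₃ (Set.mem_range_self i) h
    have h2 := hb'B _ (Or.inr h1)
    rwa [b'.injective h2] at h1
  have hXZ : ∀ i, x i ∈ X ↔ z i ∈ Z := fun i => by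
    constructor
    · intro h
      have h1 : g (x i) ∈ g '' X := ⟨_, h, rfl⟩
      have h2 : f (z i) = g (x i) := σ.injective (by rw [hσz, hσY _ h1])
      rw [← h2, ← hY] at h1
      exact (f.injective.mem_set_image).1 h1
    · intro h
      have h1 : f (z i) ∈ g '' X := by rw [← hY]; exact ⟨_, h, rfl⟩
      have h2 : f (z i) = g (x i) := by rw [← hσz, hσY _ h1]
      rw [h2] at h1
      exact (g.injective.mem_set_image).1 h1
  obtain ⟨ρ, hρ, hρY, hρi⟩ := hρ b' hb' hb'B κ hκ (fun y hy => hκf y (Or.inr hy))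
    (fun i => hκT _ (Or.inl ⟨i, rfl⟩)) (fun i => hκT _ (Or.inr ⟨i, rfl⟩)) (fun i hi => by
      refine ⟨fun h => hi (hZmem i (Or.inr h)), fun h => ?_, fun h =>
        hi (hZmem i (Or.inl ((f.injective.mem_set_image).1 h)))⟩
      have h1 : β (x i) = b' (x i) := κ.injective (by
        rw [hκT _ (Or.inl ⟨i, rfl⟩), hκf _ (Or.inr (Or.inr h))])
      have h2 := hβT (x i) (Or.inl ⟨i, rfl⟩) (by rw [h1]; exact Or.inr h)
      exact hi ((hXZ i).1 (hI.disj hx ⟨i, rfl⟩ h2)))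
  refine ⟨b', hb', hb'B, ?_,
    hI.mono_right (hI.base hz₃ hZZ' fun y hy => Or.inr (Or.inl hy)) Set.subset_union_right,
    b'⁻¹ * ρ * b', mul_mem (mul_mem (inv_mem hb'.2) hρ) hb'.2, ?_, fun i => ?_⟩
  · have h1 := hI.map (inv_mem hb').1 (hI.map hf.1 (hI.mono_right hz₃ Set.subset_union_left))
    rw [hY, image_eq_of_fix (σ := b'⁻¹) (A := g '' X) fun a ha => by
      rw [Equiv.Perm.inv_eq_iff_eq]; exact (hb'B a (Or.inl ha)).symm, ← Set.range_comp, ← Set.range_comp] at h1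
    exact h1
  · rintro _ ⟨y, hy, rfl⟩
    rw [Equiv.Perm.mul_apply, Equiv.Perm.mul_apply, perm_apply_inv, hρY y hy]
  · have hinv : ∀ t w, r t (b'⁻¹ w) ↔ r (b' t) w := fun t w => by
      rw [← hr.mem_iff.1 hb'.2 t, perm_apply_inv]
    rw [Equiv.Perm.mul_apply, Equiv.Perm.mul_apply, perm_apply_inv, hinv, hinv]
    by_cases hi : z i ∈ Z
    · have h1 : f (z i) ∈ g '' X := by rw [← hY]; exact ⟨_, hi, rfl⟩
      have h2 : f (z i) = g (x i) := by rw [← hσz, hσY _ h1]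
      rw [hb'B _ (Or.inr hi), hρY _ ⟨_, hZZ' hi, rfl⟩]
      refine ⟨?_, hfr _⟩
      rw [← hb'B _ (Or.inl h1), h2, hr.mem_iff.1 hb'.2]
      exact hgr _
    · exact hρi i hi

/-- There is no obstruction in a random tournament: neither `b' x`, `b' z` nor `f (b' z)` lies in
`f(Z')`, so the last can be moved over `f(Z')` to be dominated by the first two. -/
theorem transferConclusion_tournament [Countable M] (hF : IsFusionPair G₁ G₂)
    (hI : IsIndependence G₁ I) (hr : IsHomogeneousTournament G₂ r)
    (hext : HasTournamentExtension r) (hf : f ∈ G₁ ⊓ G₂)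
    (hgr : ∀ x, r x (g x)) (hfr : ∀ x, r x (f x)) (hX : X.Finite) (hZ : Z.Finite)
    (hZ' : Z'.Finite) (hZZ' : Z ⊆ Z') (hY : f '' Z = g '' X) {ι : Type*} [Finite ι] {x z : ι → M}
    {σ : Equiv.Perm M} (hσY : ∀ y ∈ g '' X, σ y = y) (hσz : ∀ i, σ (f (z i)) = g (x i))
    (hz : I (Set.range z) Z (g '' X ∪ X)) (hx : I (Set.range x) X (g '' X ∪ Z)) :
    TransferConclusion G₁ G₂ I r f (g '' X) Z Z' x z := by
  obtain ⟨β, hβ, hβB, hβT⟩ := exists_avoiding hF hI ((hX.image g).union hZ)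
    (hZ'.union (hZ'.image f)) ((Set.finite_range x).union (Set.finite_range z))
  refine transferConclusion_of_exists hF hI hr hf hgr hfr hX hZ hZ' hZZ' hY hσY hσz hz hx hβ hβB
    hβT fun b' _ _ κ _ _ _ _ hn => ?_
  have hfin : {i : ι | z i ∉ Z}.Finite := Set.toFinite _
  obtain ⟨ρ, hρ, hρY, hρV⟩ := exists_dominated hr hext (hZ'.image f)
    (hfin.image fun i => f (b' (z i)))
    ((hfin.image fun i => b' (x i)).union (hfin.image fun i => b' (z i))) (by
      rintro p (⟨i, hi, rfl⟩ | ⟨i, hi, rfl⟩)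
      exacts [(hn i hi).2.1, (hn i hi).1])
  exact ⟨ρ, hρ, hρY, fun i hi => ⟨hρV _ ⟨i, hi, rfl⟩ (hn i hi).2.2 _ (Or.inl ⟨i, hi, rfl⟩),
    hρV _ ⟨i, hi, rfl⟩ (hn i hi).2.2 _ (Or.inr ⟨i, hi, rfl⟩)⟩⟩

end Transfer

/-! ### The transfer condition for orders -/

section OrderTransfer

variable {M : Type w} [LinearOrder M]
variable {G₁ G₂ : Subgroup (Equiv.Perm M)} {I : Set M → Set M → Set M → Prop}
variable {g f : Equiv.Perm M} {X Z Z' : Set M}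

/-- A finite set can be moved over `B` below a point above `B`, arbitrarily close to `B`. -/
theorem exists_move_below [DenselyOrdered M] [NoMinOrder M] [NoMaxOrder M] [Nonempty M]
    (hr : IsHomogeneousTournament G₂ (fun x y : M => x < y)) {B C T : Set M} (hB : B.Finite)
    (hC : C.Finite) (hT : T.Finite) :
    ∃ u, (∀ b ∈ B, b < u) ∧ (∀ c ∈ C, (∀ b ∈ B, b < c) → u < c) ∧
      ∃ σ ∈ G₂, (∀ b ∈ B, σ b = b) ∧ ∀ t ∈ T, σ t < u := by
  have between : ∀ B C : Set M, B.Finite → C.Finite → (∀ b ∈ B, ∀ c ∈ C, b < c) →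
      ∃ u, (∀ b ∈ B, b < u) ∧ ∀ c ∈ C, u < c := fun B C hB hC h => by
    obtain ⟨u, h1, h2⟩ := Order.exists_between_finsets hB.toFinset hC.toFinset
      (by simpa using h)
    exact ⟨u, by simpa using h1, by simpa using h2⟩
  have hC' : {c ∈ C | ∀ b ∈ B, b < c}.Finite := hC.subset (Set.sep_subset _ _)
  -- Two points are chosen in the gap above `B`: `u₀` is where the largest element of `T` goes if it
  -- lies above `B`, and `u` is a bound strictly above it.
  obtain ⟨u₀, hu₀, hu₀'⟩ := between B {c ∈ C | ∀ b ∈ B, b < c} hB hC' fun b hb c hc => hc.2 b hb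
  obtain ⟨u, hu, hu'⟩ := between (insert u₀ B) {c ∈ C | ∀ b ∈ B, b < c} (hB.insert _) hC' (by
    rintro b (rfl | hb) c hc
    exacts [hu₀' c hc, hc.2 b hb])
  refine ⟨u, fun b hb => hu b (Or.inr hb), fun c hc h => hu' c ⟨hc, h⟩, ?_⟩
  rcases T.eq_empty_or_nonempty with rfl | hne
  · exact ⟨1, one_mem _, fun _ _ => rfl, by simp⟩
  obtain ⟨t₀, ht₀, hmax⟩ := Set.exists_max_image T id hT hne
  by_cases h : ∀ b ∈ B, b < t₀
  · obtain ⟨σ, hσ, hσB, hσt⟩ := hr.typeEq hB (fun h' => lt_irrefl _ (h _ h'))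
      (fun h' => lt_irrefl _ (hu₀ _ h')) (x := t₀) (y := u₀)
      fun b hb => ⟨fun h' => (lt_asymm h' (h b hb)).elim, fun h' => (lt_asymm h' (hu₀ b hb)).elim⟩
    refine ⟨σ, hσ, hσB, fun t ht => ?_⟩
    refine lt_of_le_of_lt ((le_iff_of_mem hr hσ).2 (hmax t ht)) ?_
    rw [id, hσt]
    exact hu u₀ (Or.inl rfl)
  · push Not at h
    obtain ⟨b, hb, hle⟩ := h
    exact ⟨1, one_mem _, fun _ _ => rfl, fun t ht =>
      ((hmax t ht).trans hle).trans_lt (hu b (Or.inr hb))⟩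

theorem exists_move_above [DenselyOrdered M] [NoMinOrder M] [NoMaxOrder M] [Nonempty M]
    (hr : IsHomogeneousTournament G₂ (fun x y : M => x < y)) {B C T : Set M} (hB : B.Finite)
    (hC : C.Finite) (hT : T.Finite) :
    ∃ l, (∀ b ∈ B, l < b) ∧ (∀ c ∈ C, (∀ b ∈ B, c < b) → c < l) ∧
      ∃ σ ∈ G₂, (∀ b ∈ B, σ b = b) ∧ ∀ t ∈ T, l < σ t :=
  exists_move_below (M := Mᵒᵈ) (G₂ := G₂) hr.flip hB hC hT

/-- A finite set can be moved over `B` such that it avoids `C` outside of `B`, and such that no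
element of `C` beyond `B` lies between it and `B`. -/
theorem exists_move_inside [DenselyOrdered M] [NoMinOrder M] [NoMaxOrder M] [Nonempty M]
    (hF : IsFusionPair G₁ G₂) (hI : IsIndependence G₁ I)
    (hr : IsHomogeneousTournament G₂ (fun x y : M => x < y)) {B C T : Set M} (hB : B.Finite)
    (hBne : B.Nonempty) (hC : C.Finite) (hT : T.Finite) :
    ∃ β ∈ G₂, (∀ b ∈ B, β b = b) ∧ (∀ t ∈ T, β t ∈ C → t ∈ B) ∧
      (∀ t ∈ T, ∀ c ∈ C, (∀ b ∈ B, b < c) → β t < c) ∧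
      ∀ t ∈ T, ∀ c ∈ C, (∀ b ∈ B, c < b) → c < β t := by
  classical
  obtain ⟨u, huB, huC, σ, hσ, hσB, hσT⟩ := exists_move_below hr hB hC hT
  obtain ⟨l, hlB, hlC, τ, hτ, hτB, hτT⟩ := exists_move_above hr hB hC hT
  -- The two maps can be glued, since both fix `B` pointwise and so preserve the set of points above
  -- `B`.
  let φ : M → M := fun x => if ∀ b ∈ B, b < x then σ x else τ x
  have hφ₁ : ∀ x, (∀ b ∈ B, b < x) → φ x = σ x := fun x h => if_pos h
  have hφ₂ : ∀ x, (∃ b ∈ B, x ≤ b) → φ x = τ x := fun x h => if_neg fun h' => by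
    obtain ⟨b, hb, hle⟩ := h
    exact not_lt.2 hle (h' b hb)
  have hcases : ∀ x, (∀ b ∈ B, b < x) ∨ ∃ b ∈ B, x ≤ b := fun x => by
    by_cases h : ∀ b ∈ B, b < x
    · exact Or.inl h
    · push Not at h; exact Or.inr h
  have hup : ∀ x, (∀ b ∈ B, b < x) → ∀ b ∈ B, b < φ x := fun x h b hb => by
    rw [hφ₁ x h, ← hσB b hb, lt_iff_of_mem hr hσ]; exact h b hb
  have hlow : ∀ x, ∀ b ∈ B, x ≤ b → φ x ≤ b := fun x b hb h => by
    rw [hφ₂ x ⟨b, hb, h⟩, ← hτB b hb, le_iff_of_mem hr hτ]; exact h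
  have hmono : StrictMono φ := fun x y hxy => by
    rcases hcases x with hx | ⟨b, hb, hx⟩
    · have hy : ∀ b ∈ B, b < y := fun b hb => (hx b hb).trans hxy
      rw [hφ₁ x hx, hφ₁ y hy, lt_iff_of_mem hr hσ]; exact hxy
    · rcases hcases y with hy | hy
      · exact (hlow x b hb hx).trans_lt (hup y hy b hb)
      · rw [hφ₂ x ⟨b, hb, hx⟩, hφ₂ y hy, lt_iff_of_mem hr hτ]; exact hxy
  obtain ⟨β, hβ, hβφ⟩ := hr.extend (hB.union hT) φ hmono.injective.injOn
    fun x _ y _ h => hmono h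
  have hβB : ∀ b ∈ B, β b = b := fun b hb => by
    rw [hβφ (Or.inl hb), hφ₂ b ⟨b, hb, le_rfl⟩, hτB b hb]
  have hβu : ∀ t ∈ T, β t < u := fun t ht => by
    rw [hβφ (Or.inr ht)]
    rcases hcases t with h | ⟨b, hb, h⟩
    · rw [hφ₁ t h]; exact hσT t ht
    · exact (hlow t b hb h).trans_lt (huB b hb)
  have hβl : ∀ t ∈ T, l < β t := fun t ht => by
    rw [hβφ (Or.inr ht)]
    rcases hcases t with h | h
    · obtain ⟨b, hb⟩ := hBne
      exact (hlB b hb).trans (hup t h b hb)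
    · rw [hφ₂ t h]; exact hτT t ht
  -- Coincidences with `C` are removed last. As `α` fixes `u` and `l`, the images stay between them.
  obtain ⟨α, hα, hαB, hαT⟩ := exists_avoiding hF hI (hB.union (Set.toFinite {u, l})) hC
    (hT.image β)
  have hαu : α u = u := hαB u (Or.inr (Or.inl rfl))
  have hαl : α l = l := hαB l (Or.inr (Or.inr rfl))
  refine ⟨α * β, mul_mem hα hβ, fun b hb => ?_, fun t ht h => ?_, fun t ht c hc h => ?_,
    fun t ht c hc h => ?_⟩
  · rw [Equiv.Perm.mul_apply, hβB b hb, hαB b (Or.inl hb)]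
  · rcases hαT (β t) ⟨t, ht, rfl⟩ h with h | h | h
    · rwa [β.injective (hβB _ h)] at h
    · exact ((hβu t ht).ne h).elim
    · exact ((hβl t ht).ne' h).elim
  · refine lt_trans ?_ (huC c hc h)
    rw [Equiv.Perm.mul_apply, ← hαu, lt_iff_of_mem hr hα]
    exact hβu t ht
  · refine (hlC c hc h).trans ?_
    rw [Equiv.Perm.mul_apply, ← hαl, lt_iff_of_mem hr hα]
    exact hβl t ht

/-- Finitely many points can be moved up over `Y` simultaneously. -/
theorem exists_raising [DenselyOrdered M] [NoMinOrder M] [NoMaxOrder M] [Nonempty M]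
    (hr : IsHomogeneousTournament G₂ (fun x y : M => x < y)) {Y : Set M} (hY : Y.Finite)
    {ι : Type*} [Finite ι] (s : Set ι) {p w : ι → M} (hw : ∀ i ∈ s, w i ∉ Y)
    (h : ∀ i ∈ s, ∀ y ∈ Y, w i < y → p i < y) :
    ∃ ρ ∈ G₂, (∀ y ∈ Y, ρ y = y) ∧ (∀ x, x ≤ ρ x) ∧ ∀ i ∈ s, p i < ρ (w i) := by
  have hs : s.Finite := Set.toFinite s
  induction s, hs using Set.Finite.induction_on with
  | empty => exact ⟨1, one_mem _, fun _ _ => rfl, fun _ => le_rfl, by simp⟩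
  | @insert i s his hs ih =>
    obtain ⟨ρ, hρ, hρY, hρx, hρs⟩ := ih (fun i hi => hw i (Or.inr hi))
      fun i hi => h i (Or.inr hi)
    have hi := h i (Or.inl rfl)
    have hwi := hw i (Or.inl rfl)
    -- By `h` the cut of `w i` over `Y` contains a point `q` above `p i`. A map over `Y` taking `w
    -- i` there is combined with the previous one by a maximum, which keeps what was raised before.
    obtain ⟨q, hq₁, hq₂⟩ := Order.exists_between_finsets
      (insert (p i) (insert (w i) (hY.subset (Set.sep_subset Y fun y => y < w i)).toFinset))
      (hY.subset (Set.sep_subset Y fun y => w i < y)).toFinset (by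
        intro x hx y hy
        simp only [Finset.mem_insert, Set.Finite.mem_toFinset, Set.mem_sep_iff] at hx hy
        rcases hx with rfl | rfl | hx
        exacts [hi y hy.1 hy.2, hy.2, hx.2.trans hy.2])
    simp only [Finset.mem_insert, Set.Finite.mem_toFinset, Set.mem_sep_iff, forall_eq_or_imp]
      at hq₁ hq₂
    have hcut : ∀ y ∈ Y, w i < y ∨ y < w i := fun y hy => by
      rcases lt_trichotomy (w i) y with h | h | h
      exacts [Or.inl h, (hwi (h ▸ hy)).elim, Or.inr h]
    obtain ⟨σ, hσ, hσY, hσw⟩ := hr.typeEq hY hwi (y := q) (fun hqY =>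
        (hcut q hqY).elim (fun h' => lt_irrefl _ (hq₂ q ⟨hqY, h'⟩))
          fun h' => lt_irrefl _ (hq₁.2.2 q ⟨hqY, h'⟩)) fun y hy =>
      ⟨fun h' => hq₂ y ⟨hy, h'⟩, fun h' => (hcut y hy).resolve_right fun h'' =>
        lt_asymm h' (hq₁.2.2 y ⟨hy, h''⟩)⟩
    obtain ⟨ν, hν, hνmax⟩ := exists_sup hr hρ hσ
    refine ⟨ν, hν, fun y hy => by rw [hνmax, hρY y hy, hσY y hy, max_self], fun x => by
      rw [hνmax]; exact (hρx x).trans (le_max_left _ _), ?_⟩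
    rintro j (rfl | hj)
    · rw [hνmax, hσw]; exact hq₁.1.trans_le (le_max_right _ _)
    · rw [hνmax]; exact (hρs j hj).trans_le (le_max_left _ _)

/-- The points `f (b' z)` have to be raised above `b' x` without crossing `f(Z')`, so each `y'` in
`f(Z')` above `f (b' z)` must be above `b' x`. Over `Y = g(X)`, the cut of `f (b' z)` is that of `g
x`. If this lies between points of `Y`, the orbit block has a `y` in `Y` with `y ≤ g x < g y`, so
`b' x < y ≤ f (b' z)`. Below and above `Y` the argument uses that no points of `Z' ∪ f(Z')` beyond
`Y ∪ Z` separate `b' x` or `b' z` from it. -/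
theorem transferConclusion_order [Countable M] [DenselyOrdered M] [NoMinOrder M] [NoMaxOrder M]
    (hF : IsFusionPair G₁ G₂) (hI : IsIndependence G₁ I)
    (hr : IsHomogeneousTournament G₂ (fun x y : M => x < y)) (hg : g ∈ G₁ ⊓ G₂)
    (hf : f ∈ G₁ ⊓ G₂) (hgu : IsUnboundedlyIncreasing (fun x y : M => x < y) g)
    (hfr : ∀ x, x < f x) (hX : IsOrbitBlock g X) (hZ : Z.Finite)
    (hZ' : Z'.Finite) (hZZ' : Z ⊆ Z') (hY : f '' Z = g '' X) {ι : Type*} [Finite ι] {x z : ι → M}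
    {σ : Equiv.Perm M} (hσ : σ ∈ G₁ ⊓ G₂) (hσY : ∀ y ∈ g '' X, σ y = y)
    (hσz : ∀ i, σ (f (z i)) = g (x i))
    (hz : I (Set.range z) Z (g '' X ∪ X)) (hx : I (Set.range x) X (g '' X ∪ Z)) :
    TransferConclusion G₁ G₂ I (fun x y : M => x < y) f (g '' X) Z Z' x z := by
  have hXne : X.Nonempty := by
    obtain ⟨p, S₀, k, -, hp, -, rfl⟩ := hX
    exact ⟨p, Set.mem_biUnion (show 0 ∈ Set.Iic k from Nat.zero_le _) ⟨p, hp, rfl⟩⟩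
  have : Nonempty M := hXne.to_subtype.map Subtype.val
  have hYne : (g '' X).Nonempty := hXne.image g
  obtain ⟨β, hβ, hβB, hβT, hβup, hβlow⟩ := exists_move_inside hF hI hr
    ((hX.finite.image g).union hZ) (hYne.mono Set.subset_union_left)
    (hZ'.union (hZ'.image f)) ((Set.finite_range x).union (Set.finite_range z))
  refine transferConclusion_of_exists hF hI hr hf hgu.1 hfr hX.finite hZ hZ' hZZ' hY hσY hσz hz hx
    hβ hβB hβT fun b' hb' hb'B κ hκ hκf hκx hκz hn => ?_
  have hκlt : ∀ t, ∀ c ∈ Z' ∪ f '' Z', (κ t < c ↔ t < c) ∧ (c < κ t ↔ c < t) := fun t c hc => by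
    constructor <;> conv_lhs => rw [← hκf c hc, lt_iff_of_mem hr hκ]
  -- `f b' z` has the same cut over `Y` as `g x`
  have hcutz : ∀ i, ∀ y ∈ g '' X, (f (b' (z i)) < y ↔ g (x i) < y) := fun i y hy => by
    obtain ⟨ζ, hζ, rfl⟩ : ∃ ζ ∈ Z, f ζ = y := by rw [← hY] at hy; exact hy
    rw [← hσz]
    conv_rhs => rw [← hσY _ hy, lt_iff_of_mem hr hσ.2, lt_iff_of_mem hr hf.2]
    rw [lt_iff_of_mem hr hf.2]
    conv_lhs => rw [← hb'B ζ (Or.inr hζ), lt_iff_of_mem hr hb'.2]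
  have hcutx : ∀ i, ∀ y ∈ g '' X, (b' (x i) < y ↔ x i < y) := fun i y hy => by
    conv_lhs => rw [← hb'B y (Or.inl hy), lt_iff_of_mem hr hb'.2]
  have hkey : ∀ i, z i ∉ Z → ∀ y ∈ f '' Z', f (b' (z i)) < y → b' (x i) < y := by
    intro i hi y' hy' hlt
    by_cases hlow : ∀ y ∈ g '' X, f (b' (z i)) < y
    · -- below all of `Y`
      have hxlow : ∀ y ∈ g '' X, b' (x i) < y := fun y hy =>
        (hcutx i y hy).2 ((hgu.1 _).trans ((hcutz i y hy).1 (hlow y hy)))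
      by_cases hy'low : ∀ y ∈ g '' X, y' < y
      · exfalso
        obtain ⟨ζ', hζ', rfl⟩ := hy'
        have hζ : ∀ ζ ∈ Z, ζ' < ζ := fun ζ hζ => by
          rw [← lt_iff_of_mem hr hf.2]
          exact hy'low _ (by rw [← hY]; exact ⟨ζ, hζ, rfl⟩)
        have hcl : ∀ b ∈ g '' X ∪ Z, ζ' < b := by
          rintro b (hb | hb)
          · rw [← hY] at hb
            obtain ⟨ζ, hζZ, rfl⟩ := hb
            exact (hζ ζ hζZ).trans (hfr ζ)
          · exact hζ b hb
        have := hβlow (z i) (Or.inr ⟨i, rfl⟩) ζ' (Or.inl hζ') hcl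
        rw [← (hκlt _ ζ' (Or.inl hζ')).2, hκz i, ← lt_iff_of_mem hr hf.2] at this
        exact lt_asymm this hlt
      · push Not at hy'low
        obtain ⟨y, hy, hle⟩ := hy'low
        exact (hxlow y hy).trans_le hle
    · push Not at hlow
      obtain ⟨y₁, hy₁, hle₁⟩ := hlow
      by_cases hup : ∀ y ∈ g '' X, y ≤ f (b' (z i))
      · -- above all of `Y`
        by_cases hxup : ∀ b ∈ g '' X, b < x i
        · have h1 : ∀ b ∈ g '' X ∪ Z, b < y' := by
            have h2 : ∀ b ∈ g '' X, b < y' := fun b hb => (hup b hb).trans_lt hlt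
            rintro b (hb | hb)
            · exact h2 b hb
            · exact (hfr b).trans (h2 _ (by rw [← hY]; exact ⟨b, hb, rfl⟩))
          have := hβup (x i) (Or.inl ⟨i, rfl⟩) y' (Or.inr hy') h1
          rwa [← (hκlt _ y' (Or.inr hy')).1, hκx i] at this
        · push Not at hxup
          obtain ⟨y, hy, hle⟩ := hxup
          have h1 : b' (x i) ≤ y := by
            rw [← hb'B y (Or.inl hy), le_iff_of_mem hr hb'.2]; exact hle
          exact h1.trans_lt ((hup y hy).trans_lt hlt)
      · push Not at hup
        obtain ⟨y₂, hy₂, hlt₂⟩ := hup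
        have h1 : y₁ ≤ g (x i) := not_lt.1 fun h => not_lt.2 hle₁ ((hcutz i y₁ hy₁).2 h)
        obtain ⟨y, hy, hle, hlt'⟩ := hX.exists_le_lt hr hg.2 hgu hy₁ hy₂ h1
          ((hcutz i y₂ hy₂).1 hlt₂).le
        have h2 : b' (x i) < y := (hcutx i y hy).2 ((lt_iff_of_mem hr hg.2).1 hlt')
        have h3 : y ≤ f (b' (z i)) := not_lt.1 fun h => not_lt.2 hle ((hcutz i y hy).1 h)
        exact h2.trans (h3.trans_lt hlt)
  obtain ⟨ρ, hρ, hρY, hρx, hρi⟩ := exists_raising hr (hZ'.image f) {i : ι | z i ∉ Z}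
    (fun i hi => (hn i hi).2.2) hkey
  exact ⟨ρ, hρ, hρY, fun i hi => ⟨hρi i hi, (hfr _).trans_le (hρx _)⟩⟩

end OrderTransfer

/-! ### From a nontrivial automorphism to an unboundedly increasing one -/

section Unbounded

variable {M : Type w} [LinearOrder M]
variable {G₁ G₂ : Subgroup (Equiv.Perm M)} {I : Set M → Set M → Set M → Prop}
variable {h f : Equiv.Perm M}

/-- The point `x` lies above all of `K` if `s` holds, and below all of `K` otherwise. -/
def Beyond (s : Prop) (K : Set M) (x : M) : Prop := ∀ k ∈ K, (s ∧ k < x) ∨ (¬ s ∧ x < k)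

namespace Beyond

variable {s : Prop} {K K' : Set M} {x y z : M}

theorem mono (h : Beyond s K x) (hK : K' ⊆ K) : Beyond s K' x := fun k hk => h k (hK hk)

theorem notMem (h : Beyond s K x) : x ∉ K := fun hx =>
  (h x hx).elim (fun h => lt_irrefl _ h.2) fun h => lt_irrefl _ h.2

theorem of_between (hx : Beyond s K x) (hy : Beyond s K y) (hxz : x < z) (hzy : z < y) :
    Beyond s K z := fun k hk => (hx k hk).elim (fun h => Or.inl ⟨h.1, h.2.trans hxz⟩)
  fun h => Or.inr ⟨h.1, hzy.trans (((hy k hk).resolve_left fun h' => h.1 h'.1).2)⟩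

theorem lt_iff (hx : Beyond s K x) (hy : Beyond s K y) : ∀ k ∈ K, x < k ↔ y < k := fun k hk => by
  rcases hx k hk with h | h <;> rcases hy k hk with h' | h'
  · exact ⟨fun h'' => (lt_asymm h'' h.2).elim, fun h'' => (lt_asymm h'' h'.2).elim⟩
  · exact (h'.1 h.1).elim
  · exact (h.1 h'.1).elim
  · exact ⟨fun _ => h'.2, fun _ => h.2⟩

theorem exists_gt [DenselyOrdered M] [NoMaxOrder M] [NoMinOrder M] (hK : K.Finite)
    (hx : Beyond s K x) (hy : Beyond s K y) :
    ∃ z, Beyond s K z ∧ x < z ∧ y < z := by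
  by_cases hs : s
  · obtain ⟨z, hz⟩ := NoMaxOrder.exists_gt (max x y)
    have hxz := (le_max_left x y).trans_lt hz
    exact ⟨z, fun k hk => (hx k hk).elim (fun h => Or.inl ⟨hs, h.2.trans hxz⟩)
      fun h => (h.1 hs).elim, hxz, (le_max_right x y).trans_lt hz⟩
  · have : Nonempty M := ⟨x⟩
    obtain ⟨z, hz₁, hz₂⟩ := Order.exists_between_finsets {x, y} hK.toFinset (by
      intro a ha b hb
      simp only [Finset.mem_insert, Finset.mem_singleton] at ha
      rw [Set.Finite.mem_toFinset] at hb
      rcases ha with rfl | rfl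
      exacts [((hx b hb).resolve_left fun h => hs h.1).2,
        ((hy b hb).resolve_left fun h => hs h.1).2])
    exact ⟨z, fun k hk => Or.inr ⟨hs, hz₂ k (by simpa using hk)⟩, hz₁ x (by simp),
      hz₁ y (by simp)⟩

theorem map (hr : IsHomogeneousTournament G₂ (fun x y : M => x < y)) {σ : Equiv.Perm M}
    (hσ : σ ∈ G₂) (h : Beyond s K x) : Beyond s (σ '' K) (σ x) := by
  rintro _ ⟨k, hk, rfl⟩
  rw [lt_iff_of_mem hr hσ, lt_iff_of_mem hr hσ]
  exact h k hk

theorem typeEq (hr : IsHomogeneousTournament G₂ (fun x y : M => x < y)) (hK : K.Finite)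
    (hx : Beyond s K x) (hy : Beyond s K y) : TypeEq G₂ K x y :=
  hr.typeEq hK hx.notMem hy.notMem (hx.lt_iff hy)

theorem of_typeEq (hr : IsHomogeneousTournament G₂ (fun x y : M => x < y))
    (hx : Beyond s K x) (h : TypeEq G₂ K x y) : Beyond s K y := fun k hk => by
  have h1 := hr.iff_of_typeEq h hk
  have h2 := hr.iff_of_typeEq' h hk
  rw [← h1, ← h2]
  exact hx k hk

theorem exists_beyond [NoMaxOrder M] [NoMinOrder M] [Nonempty M] (s : Prop)
    (hK : K.Finite) : ∃ x, Beyond s K x := by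
  by_cases hs : s
  · obtain ⟨b, hb⟩ := hK.bddAbove
    obtain ⟨x, hx⟩ := NoMaxOrder.exists_gt b
    exact ⟨x, fun k hk => Or.inl ⟨hs, (hb hk).trans_lt hx⟩⟩
  · obtain ⟨b, hb⟩ := hK.bddBelow
    obtain ⟨x, hx⟩ := NoMinOrder.exists_lt b
    exact ⟨x, fun k hk => Or.inr ⟨hs, hx.trans_le (hb hk)⟩⟩

end Beyond

/-- A nontrivial element has a commutator that moves points up, beyond any given point. -/
theorem exists_commutator_increasing [Countable M] [DenselyOrdered M] [NoMaxOrder M]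
    [NoMinOrder M] [Nonempty M] (hF : IsFusionPair G₁ G₂)
    (hr : IsHomogeneousTournament G₂ (fun x y : M => x < y)) (hh : h ∈ G₁ ⊓ G₂) {E : Set M}
    (hE : E.Finite) {p : M} (hp : p ∉ E) (hmove : ∀ x, TypeEq G₁ E p x → h x ≠ x) :
    ∃ a ∈ G₁ ⊓ G₂, ∀ (s : Prop) (q : M), ∃ t, Beyond s {q} t ∧ t < (h⁻¹ * (a⁻¹ * h * a)) t := by
  let Good : Set M → Equiv.Perm M → Prop := fun _ a => ∀ e ∈ E, a e = e
  -- With `w = a⁻¹ (h (a t))`, the commutator moves `t` up exactly if `h t < w`.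
  let T : Prop × M → Approximation (G₁ ⊓ G₂) Good → Prop := fun i c =>
    ∃ t ∈ c.dom, ∃ w ∈ c.dom, Beyond i.1 {i.2} t ∧ c.val w = h (c.val t) ∧ h t < w
  obtain ⟨a, ha, -, haT⟩ := exists_of_approximations hF (Good := Good)
    (fun c x => ⟨⟨insert x c.dom, c.val, c.finite.insert x, c.mem, c.good⟩,
      ⟨Set.subset_insert _ _, fun _ _ => rfl⟩, Set.mem_insert _ _⟩)
    (fun c y => ⟨⟨insert (c.val⁻¹ y) c.dom, c.val, c.finite.insert _, c.mem, c.good⟩,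
      ⟨Set.subset_insert _ _, fun _ _ => rfl⟩, ⟨_, Set.mem_insert _ _, perm_apply_inv _ _⟩⟩)
    T (by
      rintro ⟨s, q⟩ c
      set a := c.val with hadef
      have ha : a ∈ G₁ ⊓ G₂ := c.mem
      have haE : ∀ e ∈ E, a e = e := c.good
      set A : Set M := c.dom ∪ E with hAdef
      have hA : A.Finite := c.finite.union hE
      have hEA : E ⊆ a '' A := fun e he => ⟨e, Or.inr he, haE e he⟩
      set K : Set M := a '' A ∪ (h⁻¹ : Equiv.Perm M) '' (a '' A) with hKdef
      have hK : K.Finite := (hA.image _).union ((hA.image _).image _)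
      set K' : Set M := A ∪ (h⁻¹ : Equiv.Perm M) '' A ∪ {q} with hK'def
      have hK' : K'.Finite := (hA.union (hA.image _)).union (Set.finite_singleton q)
      -- The point `s'` will be the image of `t`. If some remote realization of the type of `p` is
      -- moved up, it serves as `s'`; then `w` is above `t` and can also be put above `h t`.
      -- Otherwise all remote realizations are moved down, and `t`, `s'` are both taken among them;
      -- then `w` is below `t` and can be put between `h t` and `t`. Since `a` fixes `E`, it
      -- preserves the type of `p` over `E`.
      obtain ⟨t, s', ht, hs', hts', hcase⟩ : ∃ t s', Beyond s K' t ∧ Beyond s K s' ∧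
          TypeEq G₁ (a '' A) (a t) s' ∧ (s' < h s' ∨ (h s' < s' ∧ h t < t)) := by
        by_cases hex : ∃ s', TypeEq G₁ E p s' ∧ Beyond s K s' ∧ s' < h s'
        · obtain ⟨s', -, hs', hup⟩ := hex
          obtain ⟨t₀, ht₀⟩ := Beyond.exists_beyond s hK'
          have hn : a⁻¹ s' ∉ A := fun h' =>
            hs'.notMem (Or.inl ⟨_, h', perm_apply_inv a s'⟩)
          obtain ⟨t, ht₁, ht₂⟩ := hF.realize hA hK' hn ht₀.notMem
          refine ⟨t, s', ht₀.of_typeEq hr ht₂, hs', ?_, Or.inl hup⟩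
          have := ht₁.symm.map ha.1
          rwa [perm_apply_inv] at this
        · push Not at hex
          obtain ⟨t₀, ht₀⟩ := Beyond.exists_beyond s (hK.union hK')
          obtain ⟨t, ht₁, ht₂⟩ := hF.realize hE (hK.union hK') hp ht₀.notMem
          have ht := ht₀.of_typeEq hr ht₂
          have htA : a t ∉ a '' A := fun h' => ht.notMem
            (Or.inr (Or.inl (Or.inl ((a.injective.mem_set_image).1 h'))))
          obtain ⟨s₀, hs₀⟩ := Beyond.exists_beyond s hK
          obtain ⟨s', hs₁, hs₂⟩ := hF.realize (hA.image a) hK htA hs₀.notMem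
          have hs' := hs₀.of_typeEq hr hs₂
          have hta : TypeEq G₁ E t (a t) := ⟨a, ha.1, haE, rfl⟩
          have hps' : TypeEq G₁ E p s' := (ht₁.trans hta).trans (hs₁.mono hEA)
          exact ⟨t, s', ht.mono Set.subset_union_right, hs', hs₁,
            Or.inr ⟨lt_of_le_of_ne (hex s' hps' hs') (hmove _ hps'),
              lt_of_le_of_ne (hex t ht₁ (ht.mono Set.subset_union_left)) (hmove _ ht₁)⟩⟩
      have htA : Beyond s A t := ht.mono fun z hz => Or.inl (Or.inl hz)
      have himg : ∀ B : Set M, h '' ((h⁻¹ : Equiv.Perm M) '' B) = B := fun B => by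
        rw [Set.image_image]; simp
      have hhtA : Beyond s A (h t) := by
        have := (ht.mono (K' := (h⁻¹ : Equiv.Perm M) '' A) fun z hz => Or.inl (Or.inr hz)).map hr
          hh.2
        rwa [himg] at this
      have hhsA : Beyond s (a '' A) (h s') := by
        have := (hs'.mono (K' := (h⁻¹ : Equiv.Perm M) '' (a '' A)) fun z hz => Or.inr hz).map hr
          hh.2
        rwa [himg] at this
      obtain ⟨σ, hσ, hσA, hσt⟩ := hF.typeEq_inf (hA.image a) hts'
        ((htA.map hr ha.2).typeEq hr (hA.image a) (hs'.mono Set.subset_union_left))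
      set a₁ := σ * a with ha₁def
      have ha₁ : a₁ ∈ G₁ ⊓ G₂ := mul_mem hσ ha
      have ha₁A : Set.EqOn a₁ a A := fun z hz => hσA _ ⟨z, hz, rfl⟩
      have ha₁t : a₁ t = s' := hσt
      set u := a₁⁻¹ (h s') with hudef
      have huA : Beyond s A u := by
        have := hhsA.map hr (inv_mem ha₁).2
        rwa [← ha₁A.image_eq, Set.image_image, Set.image_congr (g := id) (fun z _ => by simp),
          Set.image_id] at this
      have hut : (u < t ↔ h s' < s') ∧ (t < u ↔ s' < h s') := by
        rw [← lt_iff_of_mem hr ha₁.2, ← lt_iff_of_mem hr ha₁.2 (x := t), ha₁t, hudef,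
          perm_apply_inv]
        exact ⟨Iff.rfl, Iff.rfl⟩
      obtain ⟨w₀, hw₀A, hw₀t, hw₀u, htu, hw₀t'⟩ : ∃ w₀, Beyond s A w₀ ∧ h t < w₀ ∧
          (u < t ↔ w₀ < t) ∧ t ≠ u ∧ w₀ ≠ t := by
        rcases hcase with hup | ⟨hdown, htd⟩
        · obtain ⟨w₀, hw, hw₁, hw₂⟩ := htA.exists_gt hA hhtA
          exact ⟨w₀, hw, hw₂, ⟨fun h' => (lt_asymm h' (hut.2.2 hup)).elim,
            fun h' => (lt_asymm h' hw₁).elim⟩, (hut.2.2 hup).ne, hw₁.ne'⟩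
        · obtain ⟨w₀, hw₁, hw₂⟩ := exists_between htd
          exact ⟨w₀, hhtA.of_between htA hw₁ hw₂, hw₁, ⟨fun _ => hw₂, fun _ => hut.1.2 hdown⟩,
            (hut.1.2 hdown).ne', hw₂.ne⟩
      have hu₀ : TypeEq G₂ (insert t A) u w₀ := by
        refine hr.typeEq (hA.insert t) ?_ ?_ ?_
        · rintro (h' | h')
          exacts [htu h'.symm, huA.notMem h']
        · rintro (h' | h')
          exacts [hw₀t' h', hw₀A.notMem h']
        · rintro k (rfl | hk)
          exacts [hw₀u, huA.lt_iff hw₀A k hk]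
      obtain ⟨w, hw₁, hw₂⟩ := hF.realize (hA.insert t) ((hA.insert t).insert (h t)) (p₁ := u)
        (p₂ := w₀) (by
          rintro (h' | h')
          exacts [htu h'.symm, huA.notMem h']) (by
          rintro (h' | h' | h')
          exacts [hw₀t.ne' h', hw₀t' h', hw₀A.notMem h'])
      obtain ⟨ν, hν, hνA, hνu⟩ := hF.typeEq_inf (hA.insert t) hw₁
        (hu₀.trans (hw₂.mono (Set.subset_insert _ _)))
      have hν' : ∀ z ∈ insert t A, ν⁻¹ z = z := fun z hz => by
        rw [Equiv.Perm.inv_eq_iff_eq, hνA z hz]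
      have hEq : Set.EqOn (a₁ * ν⁻¹ : Equiv.Perm M) a A := fun z hz => by
        rw [Equiv.Perm.mul_apply, hν' z (Or.inr hz), ha₁A hz]
      refine ⟨⟨insert w (insert t A), a₁ * ν⁻¹, (hA.insert t).insert w, mul_mem ha₁ (inv_mem hν),
        fun e he => by rw [hEq (Or.inr he), haE e he]⟩, ⟨fun z hz => Or.inr (Or.inr (Or.inl hz)),
        hEq.mono Set.subset_union_left⟩, t, Or.inr (Or.inl rfl), w, Or.inl rfl,
        ht.mono Set.subset_union_right, ?_, ?_⟩
      · change (a₁ * ν⁻¹) w = h ((a₁ * ν⁻¹) t)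
        rw [Equiv.Perm.mul_apply a₁, Equiv.Perm.mul_apply a₁, hν' t (Or.inl rfl), ← hνu,
          perm_inv_apply, ha₁t, hudef, perm_apply_inv]
      · exact (hr.iff_of_typeEq' hw₂ (Or.inl rfl)).1 hw₀t)
    (fun _ _ => rfl)
  refine ⟨a, ha, fun s q => ?_⟩
  obtain ⟨c, ⟨t, ht, w, hw, hq, hwt, hlt⟩, hEq⟩ := haT (s, q)
  refine ⟨t, hq, ?_⟩
  have e : (h⁻¹ * (a⁻¹ * h * a)) t = h⁻¹ w := by
    simp only [Equiv.Perm.mul_apply]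
    rw [hEq ht, ← hwt, ← hEq hw, perm_inv_apply]
  rw [e]
  exact (lt_inv_iff_of_mem hr hh.2).1 hlt

/-- The permutation `b` shifts the cuts `γ` by `d`, as far as the elements of `A` are
concerned. -/
def ShiftsCuts (θ : M ≃o ℚ) (γ : ℤ → ℝ) (d : ℤ) (A : Set M) (b : Equiv.Perm M) : Prop :=
  ∀ x ∈ A, ∀ m, γ m < θ (b x) ↔ γ (m + d) < θ x

theorem ShiftsCuts.inv {θ : M ≃o ℚ} {γ : ℤ → ℝ} {d : ℤ} {A : Set M} {b : Equiv.Perm M}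
    (h : ShiftsCuts θ γ d A b) : ShiftsCuts θ γ (-d) (b '' A) b⁻¹ := by
  rintro _ ⟨x, hx, rfl⟩ m
  rw [perm_inv_apply, h x hx, neg_add_cancel_right]

/-- A point between the cuts `γ k` and `γ (k + 1)` has to go between `γ (k - d)` and `γ (k + 1 - d)`
and into the right place among the images of `A`. These conditions are compatible as `b` already
shifts the cuts on `A`. Irrationality keeps points off the cuts. -/
theorem ShiftsCuts.exists_extension [Countable M] (θ : M ≃o ℚ) (hF : IsFusionPair G₁ G₂)
    (hr : IsHomogeneousTournament G₂ (fun x y : M => x < y)) {γ : ℤ → ℝ} (hγ : StrictMono γ)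
    (hlow : ∀ x : ℝ, ∃ m, γ m < x) (hup : ∀ x : ℝ, ∃ m, x < γ m) {d : ℤ}
    {A : Set M} (hA : A.Finite) {b : Equiv.Perm M} (hb : b ∈ G₁ ⊓ G₂)
    (hirr : ∀ m, Irrational (γ m)) (h : ShiftsCuts θ γ d A b) (x : M) :
    ∃ b' ∈ G₁ ⊓ G₂, Set.EqOn b' b A ∧ ShiftsCuts θ γ d (insert x A) b' := by
  by_cases hx : x ∈ A
  · exact ⟨b, hb, fun _ _ => rfl, by rwa [Set.insert_eq_of_mem hx]⟩
  obtain ⟨k, hk, hmax⟩ := Int.exists_greatest_of_bdd (P := fun m : ℤ => γ m < θ x)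
    (by
      obtain ⟨m, hm⟩ := hup (θ x)
      exact ⟨m, fun z hz => (hγ.lt_iff_lt.1 (hz.trans hm)).le⟩) (hlow _)
  have hk' : (θ x : ℝ) < γ (k + 1) := by
    refine lt_of_le_of_ne (not_lt.1 fun h' => ?_) ((hirr _).ne_rat _).symm
    have := hmax _ h'
    omega
  set Lo : Set ℝ := insert (γ (k - d)) ((fun y => (θ (b y) : ℝ)) '' {y ∈ A | y < x}) with hLo
  set Hi : Set ℝ := insert (γ (k + 1 - d)) ((fun y => (θ (b y) : ℝ)) '' {y ∈ A | x < y}) with hHi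
  have hLof : Lo.Finite := ((hA.subset (Set.sep_subset _ _)).image _).insert _
  have hHif : Hi.Finite := ((hA.subset (Set.sep_subset _ _)).image _).insert _
  have hcast : ∀ {y z : M}, (θ y : ℝ) < θ z ↔ y < z := fun {y z} => by
    rw [Rat.cast_lt, θ.lt_iff_lt]
  have hLH : ∀ l ∈ Lo, ∀ u ∈ Hi, l < u := by
    rintro _ (rfl | ⟨y, hy, rfl⟩) _ (rfl | ⟨z, hz, rfl⟩)
    · exact hγ (by omega)
    · refine (h z hz.1 _).2 ?_
      rw [sub_add_cancel]
      exact hk.trans (hcast.2 hz.2)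
    · refine lt_of_le_of_ne (not_lt.1 fun h' => ?_) ((hirr _).ne_rat _).symm
      have := (h y hy.1 _).1 h'
      rw [sub_add_cancel] at this
      exact lt_asymm (this.trans (hcast.2 hy.2)) hk'
    · exact hcast.2 ((lt_iff_of_mem hr hb.2).2 (hy.2.trans hz.2))
  obtain ⟨r₁, hr₁, hr₁'⟩ := Order.exists_between_finsets hLof.toFinset hHif.toFinset
    (fun l hl u hu => hLH l (hLof.mem_toFinset.1 hl) u (hHif.mem_toFinset.1 hu))
  simp only [Set.Finite.mem_toFinset] at hr₁ hr₁'
  obtain ⟨r₂, hr₂, hr₂'⟩ := Order.exists_between_finsets {r₁} hHif.toFinset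
    (fun l hl u hu => by rw [Finset.mem_singleton.1 hl]; exact hr₁' u (hHif.mem_toFinset.1 hu))
  simp only [Set.Finite.mem_toFinset, Finset.mem_singleton, forall_eq] at hr₂ hr₂'
  -- Joint realization needs finitely many points of `M` as parameters. Hence the real bounds are
  -- replaced by rational ones, `q₀` and `q₂`, and the type is that of `q₁` between them.
  obtain ⟨q₀, hq₀, hq₀'⟩ := exists_rat_btwn hr₂
  obtain ⟨q₁, hq₁, hq₁'⟩ := exists_rat_btwn hq₀'
  obtain ⟨q₂, hq₂, hq₂'⟩ := exists_rat_btwn hq₁'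
  have h01 : θ.symm q₀ < θ.symm q₁ := θ.symm.lt_iff_lt.2 (by exact_mod_cast hq₁)
  have h12 : θ.symm q₁ < θ.symm q₂ := θ.symm.lt_iff_lt.2 (by exact_mod_cast hq₂)
  have hq₂u : ∀ u ∈ Hi, (q₂ : ℝ) < u := fun u hu => hq₂'.trans (hr₂' u hu)
  have hq₀l : ∀ l ∈ Lo, l < (q₀ : ℝ) := fun l hl => (hr₁ l hl).trans hq₀
  have hθ : ∀ q : ℚ, (θ (θ.symm q) : ℝ) = q := fun q => by rw [θ.apply_symm_apply]
  have hnotA : ∀ q : ℚ, (∀ u ∈ Hi, (q : ℝ) < u) → (∀ l ∈ Lo, l < (q : ℝ)) →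
      θ.symm q ∉ b '' A ∧ ∀ y ∈ A, (x < y ↔ θ.symm q < b y) := fun q hu hl => by
    have h1 : ∀ y ∈ A, x < y → θ.symm q < b y := fun y hy hlt => by
      rw [← hcast, hθ]; exact hu _ (Or.inr ⟨y, ⟨hy, hlt⟩, rfl⟩)
    have h2 : ∀ y ∈ A, y < x → b y < θ.symm q := fun y hy hlt => by
      rw [← hcast, hθ]; exact hl _ (Or.inr ⟨y, ⟨hy, hlt⟩, rfl⟩)
    have h3 : ∀ y ∈ A, x < y ∨ y < x := fun y hy =>
      (lt_or_gt_of_ne (fun e : x = y => hx (e ▸ hy)))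
    refine ⟨?_, fun y hy => ⟨h1 y hy, fun h' => (h3 y hy).resolve_right fun h'' =>
      lt_asymm h' (h2 y hy h'')⟩⟩
    rintro ⟨y, hy, e⟩
    exact (h3 y hy).elim (fun h' => (h1 y hy h').ne e.symm) fun h' => (h2 y hy h').ne e
  have hq₁A := hnotA q₁ (fun u hu => hq₂.trans (hq₂u u hu)) fun l hl => (hq₀l l hl).trans hq₁
  have hbx : b x ∉ b '' A := by simpa using hx
  obtain ⟨c, hc₁, hc₂⟩ := hF.realize (hA.image b) ((hA.image b).union
    (Set.toFinite {θ.symm q₀, θ.symm q₂})) hbx (p₂ := θ.symm q₁) (by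
      rintro (h' | h' | h')
      exacts [hq₁A.1 h', h01.ne' h', h12.ne h'])
  have hbq : TypeEq G₂ (b '' A) (b x) (θ.symm q₁) := by
    refine hr.typeEq (hA.image b) hbx hq₁A.1 ?_
    rintro _ ⟨y, hy, rfl⟩
    rw [lt_iff_of_mem hr hb.2]
    exact hq₁A.2 y hy
  obtain ⟨σ, hσ, hσA, hσx⟩ := hF.typeEq_inf (hA.image b) hc₁
    (hbq.trans (hc₂.mono Set.subset_union_left))
  refine ⟨σ * b, mul_mem hσ hb, fun y hy => hσA _ ⟨y, hy, rfl⟩, ?_⟩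
  rintro y (rfl | hy) m
  · rw [Equiv.Perm.mul_apply, hσx]
    have hc0 : (q₀ : ℝ) < θ c := by
      rw [← hθ, hcast]
      exact (hr.iff_of_typeEq' hc₂ (Or.inr (Or.inl rfl))).1 h01
    have hc2 : (θ c : ℝ) < q₂ := by
      rw [← hθ q₂, hcast]
      exact (hr.iff_of_typeEq hc₂ (Or.inr (Or.inr rfl))).1 h12
    have hlo : γ (k - d) < θ c := (hq₀l _ (Or.inl rfl)).trans hc0
    have hhi : (θ c : ℝ) < γ (k + 1 - d) := hc2.trans (hq₂u _ (Or.inl rfl))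
    constructor
    · intro h'
      have := hγ.lt_iff_lt.1 (h'.trans hhi)
      exact (hγ.monotone (by omega)).trans_lt hk
    · intro h'
      have := hγ.lt_iff_lt.1 (h'.trans hk')
      exact (hγ.monotone (by omega)).trans_lt hlo
  · rw [Equiv.Perm.mul_apply, hσA _ ⟨y, hy, rfl⟩]
    exact h y hy m

/-- There is an automorphism of the fusion that shifts a sequence of irrational cuts. -/
theorem exists_shiftsCuts [Countable M] (θ : M ≃o ℚ) (hF : IsFusionPair G₁ G₂)
    (hr : IsHomogeneousTournament G₂ (fun x y : M => x < y)) {γ : ℤ → ℝ} (hγ : StrictMono γ)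
    (hlow : ∀ x : ℝ, ∃ m, γ m < x) (hup : ∀ x : ℝ, ∃ m, x < γ m)
    (hirr : ∀ m, Irrational (γ m)) (d : ℤ) :
    ∃ b ∈ G₁ ⊓ G₂, ∀ x m, γ m < θ (b x) ↔ γ (m + d) < θ x := by
  obtain ⟨b, hb, hb', -⟩ := exists_of_approximations hF (Good := ShiftsCuts θ γ d)
    (fun c x => by
      obtain ⟨b', hb', hEq, hs⟩ := ShiftsCuts.exists_extension θ hF hr hγ hlow hup c.finite c.mem
        hirr c.good x
      exact ⟨⟨_, b', c.finite.insert x, hb', hs⟩, ⟨Set.subset_insert _ _, hEq⟩,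
        Set.mem_insert _ _⟩)
    (fun c y => by
      obtain ⟨b', hb', hEq, hs⟩ := ShiftsCuts.exists_extension θ hF hr hγ hlow hup
        (c.finite.image _) (inv_mem c.mem) hirr c.good.inv y
      have hEq' : Set.EqOn (b'⁻¹ : Equiv.Perm M) c.val c.dom := fun z hz => by
        rw [Equiv.Perm.inv_eq_iff_eq, hEq ⟨z, hz, rfl⟩, perm_inv_apply]
      have hs' := hs.inv
      rw [neg_neg, Set.image_insert_eq, hEq.image_eq, Set.image_image,
        Set.image_congr (g := id) (fun z _ => perm_inv_apply c.val z), Set.image_id] at hs'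
      exact ⟨⟨insert (b' y) c.dom, b'⁻¹, c.finite.insert _, inv_mem hb', hs'⟩,
        ⟨Set.subset_insert _ _, hEq'⟩, ⟨_, Set.mem_insert _ _, perm_inv_apply _ _⟩⟩)
    (ι := Empty) (fun _ _ => True) (fun i => i.elim) (fun _ h => h.elim)
  refine ⟨b, hb, fun x m => ?_⟩
  obtain ⟨c, hc, hEq⟩ := hb' {x} (Set.finite_singleton x)
  have hx : x ∈ c.dom := hc rfl
  rw [hEq hx]
  exact c.good x hx m

/-- The points that are moved up by `f`. -/
structure RaisedPoint (f : Equiv.Perm M) (θ : M ≃o ℚ) where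
  val : M
  lt : val < f val

/-- Raised points are ordered such that `t` precedes `t'` if `f t` lies below `t'`, and the distance
of `t` and `t'` is at least one. -/
instance (f : Equiv.Perm M) (θ : M ≃o ℚ) : Preorder (RaisedPoint f θ) where
  le t t' := t = t' ∨ (f t.1 < t'.1 ∧ θ t.1 + 1 ≤ θ t'.1)
  le_refl t := Or.inl rfl
  le_trans := by
    rintro t t' t'' (rfl | h) (rfl | h')
    · exact Or.inl rfl
    · exact Or.inr h'
    · exact Or.inr h
    · exact Or.inr ⟨h.1.trans (t'.2.trans h'.1), by linarith [h.2, h'.2]⟩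

/-- An increasing sequence of points that are moved up, each to a point below the next one. -/
theorem exists_seq_increasing (θ : M ≃o ℚ)
    (hr : IsHomogeneousTournament G₂ (fun x y : M => x < y)) (hf : f ∈ G₂)
    (hup : ∀ (s : Prop) (q : M), ∃ t, Beyond s {q} t ∧ t < f t) :
    ∃ t : ℤ → M, ∀ n, t n < f (t n) ∧ f (t n) < t (n + 1) ∧ θ (t n) + 1 ≤ θ (t (n + 1)) := by
  have hnext : ∀ u : M, ∃ t, u < t ∧ t < f t := fun u => by
    obtain ⟨t, ht, ht'⟩ := hup True u
    exact ⟨t, ((ht u rfl).resolve_right fun h => h.1 trivial).2, ht'⟩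
  have hprev : ∀ u : M, ∃ t, t < u ∧ t < f t := fun u => by
    obtain ⟨t, ht, ht'⟩ := hup False u
    exact ⟨t, ((ht u rfl).resolve_left fun h => h.1).2, ht'⟩
  let P := RaisedPoint f θ
  have hlt : ∀ t t' : P, f t.1 < t'.1 → θ t.1 + 1 ≤ θ t'.1 → t < t' := fun t t' h h' => by
    refine lt_iff_le_not_ge.2 ⟨Or.inr ⟨h, h'⟩, ?_⟩
    rintro (rfl | h'')
    · exact lt_asymm h t'.2
    · linarith [h''.2]
  have : Nonempty P := by
    obtain ⟨t, -, ht⟩ := hnext (θ.symm 0)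
    exact ⟨⟨t, ht⟩⟩
  have : NoMaxOrder P := ⟨fun t => by
    obtain ⟨t', h, h'⟩ := hnext (max (f t.1) (θ.symm (θ t.1 + 1)))
    refine ⟨⟨t', h'⟩, hlt _ _ ((le_max_left _ _).trans_lt h) ?_⟩
    have := θ.lt_iff_lt.2 ((le_max_right _ _).trans_lt h)
    rw [θ.apply_symm_apply] at this
    exact this.le⟩
  have : NoMinOrder P := ⟨fun t => by
    obtain ⟨t', h, h'⟩ := hprev (min (f⁻¹ t.1) (θ.symm (θ t.1 - 1)))
    refine ⟨⟨t', h'⟩, hlt _ _ ((lt_inv_iff_of_mem hr hf).2 (h.trans_le (min_le_left _ _))) ?_⟩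
    have := θ.lt_iff_lt.2 (h.trans_le (min_le_right _ _))
    rw [θ.apply_symm_apply] at this
    change θ t' + 1 ≤ θ t.1
    linarith⟩
  -- Without maximal or minimal elements the preorder admits a strictly increasing sequence indexed
  -- by `ℤ`. The distance condition makes it unbounded in both directions.
  obtain ⟨t, ht⟩ := Int.exists_strictMono P
  refine ⟨fun n => (t n).1, fun n => ⟨(t n).2, ?_⟩⟩
  have h : t n < t (n + 1) := ht (by omega)
  exact h.le.resolve_left h.ne

/-- Irrational cuts, two between each point of the sequence and its image. -/
theorem exists_cuts {t t' : ℤ → ℝ} (h : ∀ n, t n < t' n) (h' : ∀ n, t' n < t (n + 1)) :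
    ∃ γ : ℤ → ℝ, StrictMono γ ∧ (∀ m, Irrational (γ m)) ∧
      ∀ n, t n < γ (2 * n) ∧ γ (2 * n + 1) < t' n := by
  choose α hα h₁ h₂ using fun n => exists_irrational_btwn (h n)
  choose α' hα' h₁' h₂' using fun n => exists_irrational_btwn (h₂ n)
  let γ : ℤ → ℝ := fun m => if m % 2 = 0 then α (m / 2) else α' (m / 2)
  have hγ₀ : ∀ n, γ (2 * n) = α n := fun n => by
    have e : 2 * n / 2 = n := by omega
    change (if 2 * n % 2 = 0 then _ else _) = _
    rw [if_pos (by omega), e]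
  have hγ₁ : ∀ n, γ (2 * n + 1) = α' n := fun n => by
    have e : (2 * n + 1) / 2 = n := by omega
    change (if (2 * n + 1) % 2 = 0 then _ else _) = _
    rw [if_neg (by omega), e]
  have hcases : ∀ m : ℤ, ∃ n, m = 2 * n ∨ m = 2 * n + 1 := fun m => ⟨m / 2, by omega⟩
  refine ⟨γ, strictMono_int_of_lt_succ fun m => ?_, fun m => ?_, fun n => ?_⟩
  · obtain ⟨n, rfl | rfl⟩ := hcases m
    · rw [hγ₀, hγ₁]; exact h₁' n
    · rw [hγ₁, show 2 * n + 1 + 1 = 2 * (n + 1) by omega, hγ₀]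
      exact (h₂' n).trans ((h' n).trans (h₁ _))
  · obtain ⟨n, rfl | rfl⟩ := hcases m
    · rw [hγ₀]; exact hα n
    · rw [hγ₁]; exact hα' n
  · rw [hγ₀, hγ₁]; exact ⟨h₁ n, h₂' n⟩

/-- If `f` moves points up beyond any given point, then the product of `f` and a conjugate of `f`
is unboundedly increasing. -/
theorem exists_conj_unboundedlyIncreasing [Countable M] (θ : M ≃o ℚ) (hF : IsFusionPair G₁ G₂)
    (hr : IsHomogeneousTournament G₂ (fun x y : M => x < y)) (hf : f ∈ G₁ ⊓ G₂)
    (hup : ∀ (s : Prop) (q : M), ∃ t, Beyond s {q} t ∧ t < f t) :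
    ∃ b ∈ G₁ ⊓ G₂, IsUnboundedlyIncreasing (fun x y : M => x < y) (b⁻¹ * f * b * f) := by
  obtain ⟨t, ht⟩ := exists_seq_increasing θ hr hf.2 hup
  have hcast : ∀ {y z : M}, (θ y : ℝ) < θ z ↔ y < z := fun {y z} => by
    rw [Rat.cast_lt, θ.lt_iff_lt]
  obtain ⟨γ, hγ, hirr, hγt⟩ := exists_cuts (t := fun n => (θ (t n) : ℝ))
    (t' := fun n => (θ (f (t n)) : ℝ)) (fun n => hcast.2 (ht n).1) fun n => hcast.2 (ht n).2.1
  have hgrow : ∀ (n : ℤ) (k : ℕ), θ (t n) + k ≤ θ (t (n + k)) := fun n k => by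
    induction k with
    | zero => simp
    | succ k ih =>
      have := (ht (n + k)).2.2
      rw [Nat.cast_succ, Nat.cast_succ, ← add_assoc, ← add_assoc]
      linarith
  have hbelow : ∀ x : ℚ, ∃ n, θ (t n) < x := fun x => by
    obtain ⟨k, hk⟩ := exists_nat_gt (θ (t 0) - x)
    have := hgrow (-k) k
    rw [neg_add_cancel] at this
    exact ⟨-k, by linarith⟩
  have habove : ∀ x : ℚ, ∃ n, x < θ (t n) := fun x => by
    obtain ⟨k, hk⟩ := exists_nat_gt (x - θ (t 0))
    have := hgrow 0 k
    exact ⟨0 + k, by linarith⟩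
  obtain ⟨b, hb, hbγ⟩ := exists_shiftsCuts θ hF hr hγ
    (fun x => by
      obtain ⟨q, hq⟩ := exists_rat_lt x
      obtain ⟨n, hn⟩ := hbelow q
      refine ⟨2 * (n - 1) + 1, ((hγt (n - 1)).2.trans ?_).trans hq⟩
      have := (ht (n - 1)).2.1
      rw [sub_add_cancel] at this
      exact (hcast.2 this).trans (by exact_mod_cast hn))
    (fun x => by
      obtain ⟨q, hq⟩ := exists_rat_gt x
      obtain ⟨n, hn⟩ := habove q
      exact ⟨2 * n, (hq.trans (by exact_mod_cast hn)).trans (hγt n).1⟩)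
    hirr 1
  have hFG : b⁻¹ * f * b * f ∈ G₂ := (mul_mem (mul_mem (mul_mem (inv_mem hb) hf) hb) hf).2
  -- Here `b` lowers the index of a cut by one. So `f (t n)`, above `γ (2 * n + 1)`, goes above `γ
  -- (2 * n)` and hence above `t n`; the second `f` leads above `γ (2 * n + 1)` again, and `b⁻¹`
  -- above `γ (2 * n + 2)`, which exceeds `t (n + 1)`.
  have hstep : ∀ n, t (n + 1) < (b⁻¹ * f * b * f) (t n) := fun n => by
    have h1 : t n < b (f (t n)) := by
      rw [← hcast]
      exact (hγt n).1.trans ((hbγ _ _).2 (hγt n).2)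
    have h2 : γ (2 * n + 1) < θ (f (b (f (t n)))) :=
      (hγt n).2.trans (hcast.2 ((lt_iff_of_mem hr hf.2).2 h1))
    have h3 := (hbγ (b⁻¹ (f (b (f (t n))))) (2 * n + 1)).1 (by rwa [perm_apply_inv])
    rw [← hcast]
    simp only [Equiv.Perm.mul_apply]
    refine lt_trans ?_ h3
    rw [show 2 * n + 1 + 1 = 2 * (n + 1) by omega]
    exact (hγt (n + 1)).1
  have hmono : StrictMono fun n => θ (t n) := strictMono_int_of_lt_succ fun n => by
    linarith [(ht n).2.2]
  refine ⟨b, hb, fun x => ?_, fun x y _ => ?_⟩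
  · obtain ⟨n, hn, hmax⟩ := Int.exists_greatest_of_bdd (P := fun n : ℤ => t n ≤ x)
      (by
        obtain ⟨m, hm⟩ := habove (θ x)
        exact ⟨m, fun z hz => (hmono.lt_iff_lt.1 ((θ.monotone hz).trans_lt hm)).le⟩)
      (by
        obtain ⟨m, hm⟩ := hbelow (θ x)
        exact ⟨m, (θ.lt_iff_lt.1 hm).le⟩)
    have hlt : x < t (n + 1) := not_le.1 fun h => by
      have := hmax _ h
      omega
    exact hlt.trans ((hstep n).trans_le ((le_iff_of_mem hr hFG).2 hn))
  · obtain ⟨n, hn⟩ := hbelow (θ x)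
    have hpow : ∀ m : ℕ, t (n + m) < ((b⁻¹ * f * b * f) ^ m) x := fun m => by
      induction m with
      | zero => simpa using θ.lt_iff_lt.1 hn
      | succ m ih =>
        rw [pow_succ', Equiv.Perm.mul_apply, Nat.cast_succ, ← add_assoc]
        exact (hstep _).trans ((lt_iff_of_mem hr hFG).2 ih)
    obtain ⟨k, hk⟩ := exists_nat_gt (θ y - θ (t n))
    refine ⟨k, lt_trans (θ.lt_iff_lt.1 ?_) (hpow k)⟩
    linarith [hgrow n k]

/-- The product of two unboundedly increasing automorphisms is unboundedly increasing. -/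
theorem IsUnboundedlyIncreasing.mul {g : Equiv.Perm M}
    (hr : IsHomogeneousTournament G₂ (fun x y : M => x < y)) (hg : g ∈ G₂)
    (h : IsUnboundedlyIncreasing (fun x y : M => x < y) g)
    (hf : IsUnboundedlyIncreasing (fun x y : M => x < y) f) :
    IsUnboundedlyIncreasing (fun x y : M => x < y) (g * f) := by
  refine ⟨fun x => (hf.1 x).trans (h.1 _), fun a b hab => ?_⟩
  obtain ⟨m, hm⟩ := h.2 a b hab
  refine ⟨m, lt_of_lt_of_le hm ?_⟩
  clear hm
  induction m with
  | zero => simp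
  | succ m ih =>
    rw [pow_succ', pow_succ', Equiv.Perm.mul_apply, Equiv.Perm.mul_apply, Equiv.Perm.mul_apply,
      le_iff_of_mem hr hg]
    exact ih.trans (hf.1 _).le

theorem IsUnboundedlyIncreasing.conj {a : Equiv.Perm M}
    (hr : IsHomogeneousTournament G₂ (fun x y : M => x < y)) (ha : a ∈ G₂)
    (h : IsUnboundedlyIncreasing (fun x y : M => x < y) f) :
    IsUnboundedlyIncreasing (fun x y : M => x < y) (a⁻¹ * f * a) := by
  refine ⟨fun x => ?_, fun x y hxy => ?_⟩
  · rw [Equiv.Perm.mul_apply, Equiv.Perm.mul_apply]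
    exact (lt_inv_iff_of_mem hr ha).1 (h.1 _)
  · obtain ⟨m, hm⟩ := h.2 _ _ ((lt_iff_of_mem hr ha).2 hxy)
    refine ⟨m, ?_⟩
    have e : (a⁻¹ * f * a) ^ m = a⁻¹ * f ^ m * a := by
      have := conj_pow (a := a⁻¹) (b := f) (i := m)
      rwa [inv_inv] at this
    rw [e, Equiv.Perm.mul_apply, Equiv.Perm.mul_apply]
    exact (lt_inv_iff_of_mem hr ha).1 hm

end Unbounded

/-! ### Relational structures as permutation groups -/

section Automorphisms

variable {L : FirstOrder.Language.{u, v}} [L.IsRelational] {M : Type w} [L.Structure M]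

theorem mem_autGroup_iff {σ : Equiv.Perm M} : σ ∈ autGroup L M ↔
    ∀ (n : ℕ) (R : L.Relations n) (x : Fin n → M),
      Language.Structure.RelMap R (fun i => σ (x i)) ↔ Language.Structure.RelMap R x := by
  constructor
  · rintro ⟨φ, rfl⟩ n R x
    exact φ.map_rel' R x
  · intro h
    exact ⟨⟨σ, fun f => isEmptyElim f, fun R x => h _ R x⟩, rfl⟩

/-- In a homogeneous relational structure, isomorphisms between finite substructures extend to
automorphisms. -/
theorem exists_autGroup_eqOn (hM : L.IsUltrahomogeneous M) {A : Set M} (hA : A.Finite) (φ : M → M)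
    (hinj : Set.InjOn φ A)
    (hrel : ∀ (n : ℕ) (R : L.Relations n) (x : Fin n → M), (∀ i, x i ∈ A) →
      (Language.Structure.RelMap R (fun i => φ (x i)) ↔ Language.Structure.RelMap R x)) :
    ∃ σ ∈ autGroup L M, Set.EqOn σ φ A := by
  let S : L.Substructure M := ⟨A, fun f => isEmptyElim f⟩
  have hS : S.FG := Language.Substructure.fg_iff_finite.2 hA
  let f : S ↪[L] M :=
    { toFun := fun s => φ s.1
      inj' := fun s t h => Subtype.ext (hinj s.2 t.2 h)
      map_fun' := fun f => isEmptyElim f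
      map_rel' := fun R x => hrel _ R (fun i => (x i).1) fun i => (x i).2 }
  obtain ⟨e, he⟩ := hM S hS f
  refine ⟨e.toEquiv, ⟨e, rfl⟩, fun a ha => ?_⟩
  exact (DFunLike.congr_fun he (⟨a, ha⟩ : S)).symm

theorem autGroup_closed (π : Equiv.Perm M)
    (h : ∀ A : Set M, A.Finite → ∃ σ ∈ autGroup L M, Set.EqOn π σ A) : π ∈ autGroup L M := by
  refine mem_autGroup_iff.2 fun n R x => ?_
  obtain ⟨σ, hσ, hEq⟩ := h (Set.range x) (Set.finite_range x)
  rw [← mem_autGroup_iff.1 hσ n R x]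
  have : (fun i => π (x i)) = fun i => σ (x i) := funext fun i => hEq ⟨i, rfl⟩
  rw [this]

end Automorphisms

section Types

variable {L : FirstOrder.Language.{u, v}} {M : Type w} [L.Structure M]

theorem sameType_singleton_iff {A : Set M} {x y : M} :
    SameType L A ![x] ![y] ↔ TypeEq (autGroup L M) A x y := by
  unfold SameType TypeEq
  simp only [Fin.forall_fin_one, Matrix.cons_val_zero]

theorem nonAlgebraic_of_exists {A : Set M} {p : M}
    (h : ∀ E : Set M, E.Finite → ∃ q, TypeEq (autGroup L M) A p q ∧ q ∉ E) :
    NonAlgebraic L A ![p] := by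
  have hinf : {q | TypeEq (autGroup L M) A p q}.Infinite := fun hfin => by
    obtain ⟨q, hq, hn⟩ := h _ hfin
    exact hn hq
  refine (hinf.image (f := fun q => ![q]) fun a _ b _ e => by simpa using congrFun e 0).mono ?_
  rintro _ ⟨q, hq, rfl⟩
  exact sameType_singleton_iff.2 hq

end Types

instance : distLang.IsRelational := fun _ => inferInstanceAs (IsEmpty Empty)

instance : binLang.IsRelational := fun _ => inferInstanceAs (IsEmpty Empty)

section Sum

variable {L₁ : FirstOrder.Language.{u, v}} {L₂ : FirstOrder.Language.{u', v'}}
variable {M : Type w} [L₁.Structure M] [L₂.Structure M]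

theorem mem_autGroup_sum_iff [L₁.IsRelational] [L₂.IsRelational] {σ : Equiv.Perm M} :
    σ ∈ autGroup (L₁.sum L₂) M ↔ σ ∈ autGroup L₁ M ⊓ autGroup L₂ M := by
  rw [Subgroup.mem_inf, mem_autGroup_iff, mem_autGroup_iff, mem_autGroup_iff]
  constructor
  · exact fun h => ⟨fun n R x => h n (Sum.inl R) x, fun n R x => h n (Sum.inr R) x⟩
  · rintro ⟨h₁, h₂⟩ n (R | R) x
    exacts [h₁ n R x, h₂ n R x]

end Sum

section Binary

variable {M : Type w} [binLang.Structure M]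

theorem relMap_rel_iff (x : Fin 2 → M) :
    Language.Structure.RelMap (L := binLang) BinRel.rel x ↔ binRel M (x 0) (x 1) := by
  unfold binRel
  rw [← List.ofFn_inj.1 (show List.ofFn x = List.ofFn ![x 0, x 1] by simp [List.ofFn_succ])]

theorem mem_autGroup_binLang_iff {σ : Equiv.Perm M} :
    σ ∈ autGroup binLang M ↔ ∀ x y, binRel M (σ x) (σ y) ↔ binRel M x y := by
  rw [mem_autGroup_iff]
  constructor
  · intro h x y
    have := h 2 BinRel.rel ![x, y]
    rwa [relMap_rel_iff, relMap_rel_iff] at this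
  · intro h n R x
    cases R
    exact (relMap_rel_iff _).trans ((h _ _).trans (relMap_rel_iff _).symm)

theorem isHomogeneousTournament_binLang (hM : binLang.IsUltrahomogeneous M)
    (irrefl : ∀ x, ¬ binRel M x x) (asymm : ∀ x y, binRel M x y → ¬ binRel M y x)
    (total : ∀ x y, x ≠ y → binRel M x y ∨ binRel M y x) :
    IsHomogeneousTournament (autGroup binLang M) (binRel M) where
  irrefl := irrefl
  asymm := asymm _ _
  total := total _ _
  mem_iff := mem_autGroup_binLang_iff
  extend := by
    intro A hA φ hinj hφ
    refine exists_autGroup_eqOn hM hA φ hinj fun n R x hx => ?_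
    cases R
    refine (relMap_rel_iff _).trans (Iff.trans ⟨fun h => ?_, hφ _ (hx 0) _ (hx 1)⟩
      (relMap_rel_iff _).symm)
    by_contra hn
    by_cases e : x 0 = x 1
    · change binRel M (φ (x 0)) (φ (x 1)) at h
      rw [e] at h
      exact irrefl _ h
    · exact asymm _ _ h (hφ _ (hx 1) _ (hx 0) ((total _ _ e).resolve_left hn))

end Binary

section FusionPair

variable {L : FirstOrder.Language.{u, v}} [L.IsRelational]
variable {M : Type w} [L.Structure M] [binLang.Structure M]
variable {I : Set M → Set M → Set M → Prop}

/-- A type not realized in its base is non-algebraic: in the first structure it has realizations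
independent from any finite set, in the second one `hfresh` provides them. -/
theorem isFusionPair_of_isFreeFusion (hf : IsFreeFusion L binLang M)
    (hI : IsIndependence (autGroup L M) I)
    (hfresh : ∀ (A E : Set M), A.Finite → E.Finite → ∀ p ∉ A,
      ∃ q, TypeEq (autGroup binLang M) A p q ∧ q ∉ E) :
    IsFusionPair (autGroup L M) (autGroup binLang M) where
  closed₁ := autGroup_closed
  closed₂ := autGroup_closed
  realize := by
    intro A₁ A₂ h₁ h₂ p₁ p₂ hp₁ hp₂
    obtain ⟨c, hc₁, hc₂⟩ := hf.realize A₁ A₂ h₁ h₂ p₁ p₂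
      (nonAlgebraic_of_exists fun E hE => by
        obtain ⟨q, hq, hqE⟩ := hI.exist h₁ hE p₁
        exact ⟨q, hq, fun h => hq.notMem hp₁ (hI.disj hqE rfl h)⟩)
      (nonAlgebraic_of_exists fun E hE => hfresh A₂ E h₂ hE p₂ hp₂)
    exact ⟨c, sameType_singleton_iff.1 hc₁, sameType_singleton_iff.1 hc₂⟩

end FusionPair

/-! ### Compatibility in terms of finite sets and permutations -/

section Compatible

variable {L : FirstOrder.Language.{u, v}} [L.IsRelational]
variable {M : Type w} [L.Structure M] [binLang.Structure M]
variable {I : Set M → Set M → Set M → Prop} {g : autGroup (L.sum binLang) M}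

theorem mem_inf_of_aut (g : autGroup (L.sum binLang) M) :
    g.1 ∈ autGroup L M ⊓ autGroup binLang M := mem_autGroup_sum_iff.1 g.2

theorem movesMaximally_of_moves [Countable M]
    (hF : IsFusionPair (autGroup L M) (autGroup binLang M)) (hI : IsIndependence (autGroup L M) I)
    (hr : IsHomogeneousTournament (autGroup binLang M) (binRel M))
    (hm : Moves (autGroup L M ⊓ autGroup binLang M) (fun W x y => I {x} W {y}) g.1)
    (hgr : ∀ x, binRel M x (g.1 x)) : MovesMaximally L binLang I g := by
  classical
  refine ⟨fun x y => ?_, fun X hX n p _ => ?_⟩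
  · obtain ⟨σ, hσ, hσxy⟩ := hr.extend (A := {x, g.1 x}) (Set.toFinite _)
      (fun z => if z = x then y else g.1 y) (by
        rintro z (rfl | rfl) z' (rfl | rfl) e
        · rfl
        · simp only [if_true, if_neg (hr.ne (hgr z)).symm] at e
          exact (hr.ne (hgr y) e).elim
        · simp only [if_true, if_neg (hr.ne (hgr z')).symm] at e
          exact (hr.ne (hgr y) e.symm).elim
        · rfl) (by
        rintro z (rfl | rfl) z' (rfl | rfl) e
        · exact (hr.irrefl _ e).elim
        · simp only [if_true, if_neg (hr.ne (hgr z)).symm]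
          exact hgr y
        · exact (hr.asymm e (hgr _)).elim
        · exact (hr.irrefl _ e).elim)
    refine ⟨σ, hσ, by simp, fun i => ?_⟩
    fin_cases i
    · exact (hσxy (Or.inl rfl)).trans (if_pos rfl)
    · exact (hσxy (Or.inr rfl)).trans (if_neg (hr.ne (hgr x)).symm)
  · obtain ⟨a, ha, haX, hp⟩ := hm.exists_indepPair hF hI (mem_inf_of_aut g) hX
      (Set.finite_range p)
    refine ⟨fun i => a (p i), ⟨a, mem_autGroup_sum_iff.2 ha, haX, fun _ => rfl⟩, ?_⟩
    have e : a '' Set.range p = Set.range fun i => a (p i) := (Set.range_comp _ _).symm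
    rw [e, ← Set.range_comp] at hp
    exact hp

theorem isFull_of_fullFor (hr : IsHomogeneousTournament (autGroup binLang M) (binRel M))
    {X : Set M} (hgr : ∀ x, binRel M x (g.1 x))
    (h : FullFor (autGroup L M ⊓ autGroup binLang M) I (binRel M) g.1 X) :
    IsFull L binLang I g X := by
  rintro n x y ⟨τ, hτ, hτX, hτx⟩ hxy hp
  rw [mem_autGroup_sum_iff] at hτ
  obtain ⟨b, hb, hbX, hbx⟩ := h (Set.range x) τ (Set.finite_range x) hτ hτX (by
    rintro _ ⟨i, rfl⟩
    rw [Equiv.Perm.mul_apply]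
    have h1 := hr.iff_of_typeEq' (sameType_singleton_iff.1 (hxy i)) rfl
    exact (hτx i : τ (g.1 (x i)) = y i) ▸ h1.1 (hgr _)) (by
    have e : (τ * g.1 : Equiv.Perm M) '' Set.range x = Set.range y := by
      rw [← Set.range_comp]
      exact congrArg Set.range (funext hτx)
    rwa [e])
  refine ⟨⟨b, mem_autGroup_sum_iff.2 hb⟩, hbX, fun i => ?_⟩
  change b⁻¹ (g.1 (b (x i))) = y i
  rw [hbx _ ⟨i, rfl⟩, perm_inv_apply]
  exact hτx i

theorem isCompatible_of_transferConclusion [Countable M]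
    (hF : IsFusionPair (autGroup L M) (autGroup binLang M)) (hI : IsIndependence (autGroup L M) I)
    (hr : IsHomogeneousTournament (autGroup binLang M) (binRel M))
    (hm : Moves (autGroup L M ⊓ autGroup binLang M) (fun W x y => I {x} W {y}) g.1)
    (hgr : ∀ x, binRel M x (g.1 x))
    (hX : ∀ X₀ : Set M, X₀.Finite → ∃ X : Set M, X.Finite ∧ X₀ ⊆ X ∧
      FullFor (autGroup L M ⊓ autGroup binLang M) I (binRel M) g.1 X ∧
      ∀ b ∈ autGroup L M ⊓ autGroup binLang M, ∀ Z : Set M, Z.Finite →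
        (b⁻¹ * g.1 * b : Equiv.Perm M) '' Z = g.1 '' X → ∃ Z' : Set M, Z'.Finite ∧ Z ⊆ Z' ∧
        FullFor (autGroup L M ⊓ autGroup binLang M) I (binRel M) (b⁻¹ * g.1 * b) Z' ∧
        ∀ (n : ℕ) (x z : Fin n → M), ∀ σ ∈ autGroup L M ⊓ autGroup binLang M,
          (∀ y ∈ g.1 '' X, σ y = y) → (∀ i, σ ((b⁻¹ * g.1 * b) (z i)) = g.1 (x i)) →
          I (Set.range z) Z (g.1 '' X ∪ X) → I (Set.range x) X (g.1 '' X ∪ Z) →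
          TransferConclusion (autGroup L M) (autGroup binLang M) I (binRel M) (b⁻¹ * g.1 * b)
            (g.1 '' X) Z Z' x z) :
    IsCompatible L binLang I g := by
  refine ⟨movesMaximally_of_moves hF hI hr hm hgr, fun X₀ hX₀ => ?_⟩
  obtain ⟨X, hXf, hX₀X, hfull, htr⟩ := hX X₀ hX₀
  refine ⟨X, hXf, hX₀X, isFull_of_fullFor hr hgr hfull, ?_⟩
  intro b Z hZ hZY n x z hσ hz hx
  obtain ⟨σ, hσ, hσY, hσz⟩ := hσ
  rw [mem_autGroup_sum_iff] at hσ
  have hb := mem_inf_of_aut b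
  obtain ⟨Z', hZ', hZZ', hfull', hconc⟩ := htr b.1 hb Z hZ hZY
  obtain ⟨b', hb', hb'f, h₁, h₂, ρ, hρ, hρf, hρr⟩ := hconc n x z σ hσ hσY hσz hz hx
  set f : Equiv.Perm M := b.1⁻¹ * g.1 * b.1 with hfdef
  have hfconj : (conj g b).1 = f := rfl
  have hfG : f ∈ autGroup L M ⊓ autGroup binLang M :=
    mul_mem (mul_mem (inv_mem hb) (mem_inf_of_aut g)) hb
  have hfr : ∀ t, binRel M t (f t) := fun t => by
    have := (hr.mem_iff.1 hb.2 t (f t)).1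
    refine this ?_
    have e : b.1 (f t) = g.1 (b.1 t) := perm_apply_inv b.1 _
    rw [e]
    exact hgr _
  have hb's : b' ∈ autGroup (L.sum binLang) M := mem_autGroup_sum_iff.2 hb'
  have hconj : ∀ t, (conj g (b * ⟨b', hb's⟩)).1 t = b'⁻¹ (f (b' t)) := fun t => rfl
  have hF' : ∀ t, binRel M t (b'⁻¹ (f (b' t))) := fun t => by
    rw [← hr.mem_iff.1 hb'.2, perm_apply_inv]
    exact hfr _
  have htype : ∀ {t v v' : M}, binRel M t v → binRel M t v' → SameType binLang {t} ![v] ![v'] :=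
    fun {t v v'} h h' => sameType_singleton_iff.2 (hr.typeEq (Set.finite_singleton t)
      (fun e => hr.ne h (Set.mem_singleton_iff.1 e).symm)
      (fun e => hr.ne h' (Set.mem_singleton_iff.1 e).symm) (by
        rintro _ rfl
        exact ⟨fun e => (hr.asymm h e).elim, fun e => (hr.asymm h' e).elim⟩))
  refine ⟨⟨b', hb's⟩, Z', hb'f, hZ', hZZ', isFull_of_fullFor hr hfr hfull', ?_, h₁, h₂,
    fun i => ρ (b'⁻¹ (f (b' (z i)))), ⟨ρ, hρ, hρf, fun i => rfl⟩, fun i => ?_, fun i => ?_⟩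
  -- This commutator takes `b'⁻¹ (f (b' z))` to `f z`. It fixes `Y` because `f⁻¹` maps `Y` onto `Z`
  -- and `b'` fixes both sets.
  · refine ⟨f * b'⁻¹ * f⁻¹ * b', mem_autGroup_sum_iff.2
      (mul_mem (mul_mem (mul_mem hfG (inv_mem hb')) (inv_mem hfG)) hb'), fun y hy => ?_, fun i => ?_⟩
    · have h3 : f⁻¹ y ∈ Z := by
        rw [← hZY] at hy
        obtain ⟨ζ, hζ, rfl⟩ := hy
        rw [hfconj, perm_inv_apply]
        exact hζ
      have h4 : b'⁻¹ (f⁻¹ y) = f⁻¹ y := by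
        rw [Equiv.Perm.inv_eq_iff_eq, hb'f _ (Or.inr h3)]
      simp only [Equiv.Perm.mul_apply]
      rw [hb'f y (Or.inl hy), h4, perm_apply_inv]
    · simp only [Equiv.Perm.mul_apply, Function.comp_apply]
      rw [hconj, perm_apply_inv, perm_inv_apply, perm_inv_apply]
      rfl
  · exact htype (hgr _) (hρr i).1
  · exact htype (hF' _) (hρr i).2

end Compatible

/-! ### Chains of movement relations -/

section Chain

variable {M : Type w} {G₁ G₂ : Subgroup (Equiv.Perm M)} {I : Set M → Set M → Set M → Prop}
variable {R : Set M → M → M → Prop} {g h : Equiv.Perm M}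

theorem Moves.conj (hR : IsMoveRel (G₁ ⊓ G₂) I R) (hm : Moves (G₁ ⊓ G₂) R g) {b : Equiv.Perm M}
    (hb : b ∈ G₁ ⊓ G₂) : Moves (G₁ ⊓ G₂) R (b⁻¹ * g * b) := by
  intro W hW x hx
  obtain ⟨y, hy, hyR⟩ := hm (b '' W) (hW.image b) (b x) (by simpa using hx)
  have e : (b⁻¹ : Equiv.Perm M) '' (b '' W) = W := by rw [Set.image_image]; simp
  refine ⟨b⁻¹ y, ?_, ?_⟩
  · have := hy.map (inv_mem hb)
    rwa [e, perm_inv_apply] at this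
  · have := hR.map (inv_mem hb) hyR
    rw [e] at this
    simpa only [Equiv.Perm.mul_apply, perm_apply_inv] using this

/-- Finitely many steps lead from the relation in which `h` moves elements to independence. -/
def MoveChain (G : Subgroup (Equiv.Perm M)) (I : Set M → Set M → Set M → Prop)
    (h : Equiv.Perm M) : Prop :=
  ∃ (R : ℕ → Set M → M → M → Prop) (N : ℕ), (∀ n, IsMoveRel G I (R n)) ∧
    (∀ n {A : Set M} {x y z : M}, R n A x y → R n A x z → I {z} (insert x A) {y} →
      R (n + 1) A z y) ∧
    (∀ {A : Set M} {x y : M}, R N A x y → I {x} A {y}) ∧ Moves G (R 0) h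

/-- Independence reproduces itself by transitivity through `x`, so further commutators can add
properties without losing it. -/
theorem IsIndependence.comp (hI : IsIndependence G₁ I) {A : Set M} {x y z : M} (_ : I {x} A {y})
    (h : I {x} A {z}) (h' : I {z} (insert x A) {y}) : I {z} A {y} :=
  hI.trans (hI.symm h) h' (Set.subset_insert _ _) (by rw [Set.union_comm]; exact subset_rfl)
    Set.subset_union_right

end Chain

/-! ### Assembly of the tournament and the order case -/

section Cases

variable {L : FirstOrder.Language.{u, v}} [L.IsRelational]
variable {M : Type w} [L.Structure M] [binLang.Structure M] [Countable M]
variable {I : Set M → Set M → Set M → Prop}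

omit [Countable M] in
theorem exists_mem_conj {N : Subgroup (autGroup (L.sum binLang) M)} (hN : N.Normal)
    {g : autGroup (L.sum binLang) M} (hg : g ∈ N) {a : Equiv.Perm M}
    (ha : a ∈ autGroup L M ⊓ autGroup binLang M) : ∃ k ∈ N, k.1 = a⁻¹ * g.1 * a := by
  obtain ⟨a', rfl⟩ : ∃ a' : autGroup (L.sum binLang) M, a'.1 = a :=
    ⟨⟨a, mem_autGroup_sum_iff.2 ha⟩, rfl⟩
  refine ⟨a'⁻¹ * g * a', ?_, rfl⟩
  simpa using hN.conj_mem g hg a'⁻¹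

omit [Countable M] in
theorem exists_mem_commutator {N : Subgroup (autGroup (L.sum binLang) M)} (hN : N.Normal)
    {g : autGroup (L.sum binLang) M} (hg : g ∈ N) {a : Equiv.Perm M}
    (ha : a ∈ autGroup L M ⊓ autGroup binLang M) :
    ∃ k ∈ N, k.1 = g.1⁻¹ * (a⁻¹ * g.1 * a) := by
  obtain ⟨k, hk, e⟩ := exists_mem_conj hN hg ha
  exact ⟨g⁻¹ * k, mul_mem (inv_mem hg) hk, by rw [← e]; rfl⟩

/-- The chain is climbed by commutators until single points are moved independently. Two more
commutators, which preserve independence, remove fixed points and then make every point dominate its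
image. -/
theorem exists_compatible_tournament
    (hF : IsFusionPair (autGroup L M) (autGroup binLang M)) (hI : IsIndependence (autGroup L M) I)
    (hr : IsHomogeneousTournament (autGroup binLang M) (binRel M))
    (hext : HasTournamentExtension (binRel M)) {h : autGroup (L.sum binLang) M}
    (hch : MoveChain (autGroup L M ⊓ autGroup binLang M) I h.1) :
    ∃ g ∈ Subgroup.normalClosure {h}, MovesMaximally L binLang I g ∧
      IsCompatible L binLang I g := by
  obtain ⟨R, N, hR, hcomp, hRN, hm⟩ := hch
  have hIR := hI.isMoveRel (G₂ := autGroup binLang M)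
  have hstep : ∀ n, ∃ g ∈ Subgroup.normalClosure {h},
      Moves (autGroup L M ⊓ autGroup binLang M) (R n) g.1 := fun n => by
    induction n with
    | zero => exact ⟨h, Subgroup.subset_normalClosure rfl, hm⟩
    | succ n ih =>
      obtain ⟨g, hg, hgm⟩ := ih
      obtain ⟨a, ha, ham, -⟩ := exists_commutator_fixedPointFree hF hI (hR n) (hR (n + 1))
        (hcomp n) (mem_inf_of_aut g) hgm
      obtain ⟨k, hk, e⟩ := exists_mem_commutator Subgroup.normalClosure_normal hg ha
      exact ⟨k, hk, e ▸ ham⟩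
  obtain ⟨g₀, hg₀, hg₀m⟩ := hstep N
  have hg₀I : Moves (autGroup L M ⊓ autGroup binLang M) (fun W x y => I {x} W {y}) g₀.1 :=
    fun W hW x hx => (hg₀m W hW x hx).imp fun y hy => ⟨hy.1, hRN hy.2⟩
  obtain ⟨a, ha, hg₁m, hfree⟩ := exists_commutator_fixedPointFree hF hI hIR hIR hI.comp
    (mem_inf_of_aut g₀) hg₀I
  obtain ⟨g₁, hg₁, e₁⟩ := exists_mem_commutator Subgroup.normalClosure_normal hg₀ ha
  rw [← e₁] at hg₁m hfree
  obtain ⟨a', ha', hgm, hgr⟩ := exists_commutator_dominated hF hI hr hext hIR hIR hI.comp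
    (mem_inf_of_aut g₁) hfree hg₁m
  obtain ⟨g, hgN, e⟩ := exists_mem_commutator Subgroup.normalClosure_normal hg₁ ha'
  rw [← e] at hgm hgr
  refine ⟨g, hgN, movesMaximally_of_moves hF hI hr hgm hgr,
    isCompatible_of_transferConclusion hF hI hr hgm hgr fun X₀ hX₀ => ?_⟩
  obtain ⟨X, hX, hX₀X, hnice⟩ := exists_orbit_convex g.1 hX₀
  have hg := mem_inf_of_aut g
  refine ⟨X, hX, hX₀X, fullFor_tournament hF hI hr hext hg hgm hgr hX hnice,
    fun b hb Z hZ hZY => ?_⟩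
  obtain ⟨Z', hZ', hZZ', hnice'⟩ := exists_orbit_convex (b⁻¹ * g.1 * b) hZ
  have hfr : ∀ x, binRel M x ((b⁻¹ * g.1 * b) x) := fun x => by
    rw [← hr.mem_iff.1 hb.2, Equiv.Perm.mul_apply, Equiv.Perm.mul_apply, perm_apply_inv]
    exact hgr _
  have hf : b⁻¹ * g.1 * b ∈ autGroup L M ⊓ autGroup binLang M :=
    mul_mem (mul_mem (inv_mem hb) hg) hb
  exact ⟨Z', hZ', hZZ', fullFor_tournament hF hI hr hext hf (hgm.conj hIR hb) hfr hZ' hnice',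
    fun n x z σ _ hσY hσz hz hx => transferConclusion_tournament hF hI hr hext hf hgr hfr hX hZ
      hZ' hZZ' hZY hσY hσz hz hx⟩

/-- A commutator of an increasing element need not be increasing. Therefore an unboundedly
increasing element is produced first, and the chain is climbed by products of it with its
conjugates. -/
theorem exists_compatible_order [LinearOrder M] (θ : M ≃o ℚ)
    (hlt : binRel M = fun x y => x < y)
    (hF : IsFusionPair (autGroup L M) (autGroup binLang M)) (hI : IsIndependence (autGroup L M) I)
    (hr : IsHomogeneousTournament (autGroup binLang M) (binRel M))
    {h : autGroup (L.sum binLang) M} {E : Set M} (hE : E.Finite) {p : M} (hp : p ∉ E)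
    (hmove : ∀ x, TypeEq (autGroup L M) E p x → h.1 x ≠ x)
    (hch : ∀ f ∈ autGroup L M ⊓ autGroup binLang M, (∀ x, f x ≠ x) →
      MoveChain (autGroup L M ⊓ autGroup binLang M) I f) :
    ∃ g ∈ Subgroup.normalClosure {h}, MovesMaximally L binLang I g ∧
      IsCompatible L binLang I g ∧ IsUnboundedlyIncreasing (binRel M) g.1 := by
  have : DenselyOrdered M := ⟨fun a b h => by
    obtain ⟨c, hac, hcb⟩ := exists_between (θ.lt_iff_lt.2 h)
    exact ⟨θ.symm c, (OrderIso.lt_symm_apply θ).2 hac, (OrderIso.symm_apply_lt θ).2 hcb⟩⟩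
  have : NoMaxOrder M := ⟨fun a => by
    obtain ⟨c, hc⟩ := NoMaxOrder.exists_gt (θ a)
    exact ⟨θ.symm c, (OrderIso.lt_symm_apply θ).2 hc⟩⟩
  have : NoMinOrder M := ⟨fun a => by
    obtain ⟨c, hc⟩ := NoMinOrder.exists_lt (θ a)
    exact ⟨θ.symm c, (OrderIso.symm_apply_lt θ).2 hc⟩⟩
  have : Nonempty M := ⟨p⟩
  have hr' := hr
  rw [hlt] at hr'
  have hIR := hI.isMoveRel (G₂ := autGroup binLang M)
  obtain ⟨a, ha, haup⟩ := exists_commutator_increasing hF hr' (mem_inf_of_aut h) hE hp hmove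
  obtain ⟨f, hfN, e⟩ := exists_mem_commutator Subgroup.normalClosure_normal
    (Subgroup.subset_normalClosure (Set.mem_singleton h)) ha
  rw [← e] at haup
  obtain ⟨b, hb, hbu⟩ := exists_conj_unboundedlyIncreasing θ hF hr' (mem_inf_of_aut f) haup
  obtain ⟨f', hf'N, e'⟩ := exists_mem_conj Subgroup.normalClosure_normal hfN hb
  have hFu : IsUnboundedlyIncreasing (fun x y : M => x < y) (f' * f).1 := by
    rw [← e'] at hbu
    exact hbu
  obtain ⟨R, N, hR, hcomp, hRN, hm⟩ := hch (f' * f).1 (mem_inf_of_aut _) fun x => (hFu.1 x).ne'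
  have hstep : ∀ n, ∃ g ∈ Subgroup.normalClosure {h},
      Moves (autGroup L M ⊓ autGroup binLang M) (R n) g.1 ∧
      IsUnboundedlyIncreasing (fun x y : M => x < y) g.1 := fun n => by
    induction n with
    | zero => exact ⟨f' * f, mul_mem hf'N hfN, hm, hFu⟩
    | succ n ih =>
      obtain ⟨g, hg, hgm, hgu⟩ := ih
      have hgG := mem_inf_of_aut g
      obtain ⟨a, ha, ham, -⟩ := exists_moves_mul_conj hF hI (hR n) (hR (n + 1)) (hcomp n) hgG hgm
        (Moves.inv hF hI (hR n) hgG hgm) (Good := fun _ _ => True) (fun _ _ _ _ h => h) trivial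
        (by
          intro A a x F hA ha _ hx hFf
          obtain ⟨q, hq, hqF⟩ := hF.exists_fresh hI (hA.image a) hFf
            (show a x ∉ a '' A by simpa using hx)
          exact ⟨F, q, hFf, subset_rfl, hqF, hq, fun _ _ _ _ _ => trivial⟩)
        (by
          intro A a y F hA ha _ hy hFf
          obtain ⟨q, hq, hqF⟩ := hF.exists_fresh hI hA hFf
            (show a⁻¹ y ∉ A from fun h => hy ⟨_, h, perm_apply_inv a y⟩)
          exact ⟨F, q, hFf, subset_rfl, hqF, hq, fun _ _ _ _ _ => trivial⟩)
      obtain ⟨k, hk, ek⟩ := exists_mem_conj Subgroup.normalClosure_normal hg ha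
      rw [← ek] at ham
      exact ⟨g * k, mul_mem hg hk, ham, hgu.mul hr' hgG.2 (ek ▸ hgu.conj hr' ha.2)⟩
  obtain ⟨g, hgN, hgRm, hgu⟩ := hstep N
  have hg := mem_inf_of_aut g
  have hgm : Moves (autGroup L M ⊓ autGroup binLang M) (fun W x y => I {x} W {y}) g.1 :=
    fun W hW x hx => (hgRm W hW x hx).imp fun y hy => ⟨hy.1, hRN hy.2⟩
  have hgr : ∀ x, binRel M x (g.1 x) := by rw [hlt]; exact hgu.1
  refine ⟨g, hgN, movesMaximally_of_moves hF hI hr hgm hgr,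
    isCompatible_of_transferConclusion hF hI hr hgm hgr fun X₀ hX₀ => ?_, by rw [hlt]; exact hgu⟩
  obtain ⟨X, hX, hX₀X⟩ := exists_orbitBlock hr' hg.2 hgu hX₀
  rw [hlt]
  refine ⟨X, hX.finite, hX₀X, fullFor_order θ hF hI hr' hg hgm hgu hX, fun b hb Z hZ hZY => ?_⟩
  have hf : b⁻¹ * g.1 * b ∈ autGroup L M ⊓ autGroup binLang M :=
    mul_mem (mul_mem (inv_mem hb) hg) hb
  have hfu := hgu.conj hr' hb.2
  obtain ⟨Z', hZ', hZZ'⟩ := exists_orbitBlock hr' hf.2 hfu hZ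
  exact ⟨Z', hZ'.finite, hZZ', fullFor_order θ hF hI hr' hf (hgm.conj hIR hb) hfu hZ',
    fun n x z σ hσ hσY hσz hz hx => transferConclusion_order hF hI hr' hg hf hgu hfu.1 hX hZ
      hZ'.finite hZZ' hZY hσ hσY hσz hz hx⟩

end Cases

/-! ### Realizations of types outside a finite set -/

section Fresh

variable {M : Type w} {G₂ : Subgroup (Equiv.Perm M)}

theorem exists_fresh_tournament {r : M → M → Prop} (hr : IsHomogeneousTournament G₂ r)
    (hext : HasTournamentExtension r) (A E : Set M) (hA : A.Finite) (hE : E.Finite) (p : M)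
    (hp : p ∉ A) : ∃ q, TypeEq G₂ A p q ∧ q ∉ E := by
  obtain ⟨q, hq, hqD⟩ := hext.exists_point (hA.union hE) fun b => r p b
  refine ⟨q, hr.typeEq hA hp (fun h => hq (Or.inl h)) fun b hb =>
    ⟨(hqD b (Or.inl hb)).1, fun h => ?_⟩, fun h => hq (Or.inr h)⟩
  by_contra hn
  exact hr.asymm h ((hqD b (Or.inl hb)).2 hn)

theorem exists_fresh_order [LinearOrder M] [DenselyOrdered M] [NoMaxOrder M] [NoMinOrder M]
    (hr : IsHomogeneousTournament G₂ fun x y : M => x < y) (A E : Set M) (hA : A.Finite)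
    (hE : E.Finite) (p : M) (hp : p ∉ A) : ∃ q, TypeEq G₂ A p q ∧ q ∉ E := by
  have : Nonempty M := ⟨p⟩
  have hAE := hA.union hE
  obtain ⟨q, hq₁, hq₂⟩ := Order.exists_between_finsets
    (insert p (hAE.subset (Set.sep_subset (A ∪ E) fun y => y ≤ p)).toFinset)
    (hAE.subset (Set.sep_subset (A ∪ E) fun y => p < y)).toFinset (by
      intro x hx y hy
      simp only [Finset.mem_insert, Set.Finite.mem_toFinset, Set.mem_sep_iff] at hx hy
      rcases hx with rfl | hx
      exacts [hy.2, hx.2.trans_lt hy.2])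
  simp only [Finset.mem_insert, Set.Finite.mem_toFinset, Set.mem_sep_iff, forall_eq_or_imp]
    at hq₁ hq₂
  have hq : q ∉ A ∪ E := fun h => (le_or_gt q p).elim (fun h' => lt_irrefl _ (hq₁.2 q ⟨h, h'⟩))
    fun h' => lt_irrefl _ (hq₂ q ⟨h, h'⟩)
  refine ⟨q, hr.typeEq hA hp (fun h => hq (Or.inl h)) fun b hb =>
    ⟨fun h => hq₂ b ⟨Or.inl hb, h⟩, fun h => hq₁.1.trans h⟩, fun h => hq (Or.inr h)⟩

end Fresh

/-! ### Limits of free amalgamation classes -/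

section Free

variable {L : FirstOrder.Language.{u, v}} {M : Type w} [L.Structure M]

theorem FreeIndep.symm {A B C : Set M} (h : FreeIndep L A B C) : FreeIndep L C B A := by
  refine ⟨fun x hx => h.1 ⟨hx.2, hx.1⟩, fun n R d hd h₁ h₂ => h.2 n R d (fun k => ?_) h₂ h₁⟩
  rcases hd k with (h' | h') | h'
  exacts [Or.inr h', Or.inl (Or.inr h'), Or.inl (Or.inl h')]

theorem FreeIndep.mono_right {A B C C' : Set M} (h : FreeIndep L A B C) (hC : C' ⊆ C) :
    FreeIndep L A B C' :=
  ⟨fun _ hx => h.1 ⟨hx.1, hC hx.2⟩, fun n R d hd h₁ h₂ =>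
    h.2 n R d (fun k => Set.union_subset_union_right _ hC (hd k)) h₁
      (h₂.imp fun _ hk => ⟨hC hk.1, hk.2⟩)⟩

theorem FreeIndep.trans_right {A B C D : Set M} (h : FreeIndep L A B D)
    (h' : FreeIndep L A (B ∪ D) C) : FreeIndep L A B (D ∪ C) := by
  have hAD : ∀ x ∈ A, x ∈ B ∪ D → x ∈ B := fun x hx hx' => hx'.elim id fun hD => h.1 ⟨hx, hD⟩
  refine ⟨fun x hx => hAD x hx.1 (hx.2.elim Or.inr fun hC => h'.1 ⟨hx.1, hC⟩),
    fun n R d hd h₁ h₂ => ?_⟩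
  obtain ⟨i, hi, hiB⟩ := h₁
  by_cases hex : ∃ k, d k ∈ C \ (B ∪ D)
  · refine h'.2 n R d (fun k => ?_) ⟨i, hi, fun hn => hiB (hAD _ hi hn)⟩ hex
    rcases hd k with (h'' | h'') | h'' | h''
    exacts [Or.inl (Or.inl h''), Or.inl (Or.inr (Or.inl h'')), Or.inl (Or.inr (Or.inr h'')),
      Or.inr h'']
  · have hC : ∀ k, d k ∈ C → d k ∈ B ∪ D := fun k hk => by
      by_contra hn
      exact hex ⟨k, hk, hn⟩
    refine h.2 n R d (fun k => ?_) ⟨i, hi, hiB⟩ ?_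
    · rcases hd k with (h'' | h'') | h'' | h''
      · exact Or.inl (Or.inl h'')
      · exact Or.inl (Or.inr h'')
      · exact Or.inr h''
      · exact (hC k h'').elim (fun h => Or.inl (Or.inr h)) Or.inr
    · obtain ⟨j, hj, hjB⟩ := h₂
      exact ⟨j, hj.elim id fun hj => (hC j hj).resolve_left hjB, hjB⟩

theorem FreeIndep.base_right {A B C D : Set M} (h : FreeIndep L A B (D ∪ C)) :
    FreeIndep L A (B ∪ D) C := by
  refine ⟨fun x hx => Or.inl (h.1 ⟨hx.1, Or.inr hx.2⟩), fun n R d hd h₁ h₂ =>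
    h.2 n R d (fun k => ?_) (h₁.imp fun k hk => ⟨hk.1, fun hB => hk.2 (Or.inl hB)⟩)
      (h₂.imp fun k hk => ⟨Or.inr hk.1, fun hB => hk.2 (Or.inl hB)⟩)⟩
  rcases hd k with (h'' | h'' | h'') | h''
  exacts [Or.inl (Or.inl h''), Or.inl (Or.inr h''), Or.inr (Or.inl h''), Or.inr (Or.inr h'')]

/-- One step suffices. The middle point `x` equals neither `y` nor `z` unless they lie in `A`.
Adding it to the base therefore does not absorb an entry `y` or `z` outside `A`, and independence
over `insert x A` forbids the same relations as independence over `A`. -/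
theorem freeIndep_moveChain {G₂ : Subgroup (Equiv.Perm M)}
    (hI : IsIndependence (autGroup L M) (FreeIndep L (M := M))) {h : Equiv.Perm M}
    (hm : Moves (autGroup L M ⊓ G₂) (fun W x y => x = y → x ∈ W) h) :
    MoveChain (autGroup L M ⊓ G₂) (FreeIndep L) h := by
  let R : ℕ → Set M → M → M → Prop := fun n => match n with
    | 0 => fun W x y => x = y → x ∈ W
    | _ + 1 => fun W x y => FreeIndep L {x} W {y}
  refine ⟨R, 1, fun n => ?_, fun n => ?_, fun h => h, hm⟩
  · cases n with
    | zero =>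
      exact
      { map := fun {σ} _ {W x y} h e => ⟨x, h (σ.injective e), rfl⟩
        symm := fun {W x y} h e => e ▸ h e.symm
        reduce := fun {W D x y} h h' _ e => hI.disj h' rfl (h e)
        ne := fun {W x y} h hx e => hx (h e) }
    | succ n => exact hI.isMoveRel
  · cases n with
    | zero =>
      intro A x y z h₁ h₂ h₃
      refine ⟨?_, fun n R d hd hz hy => h₃.2 n R d (fun k => ?_) ?_ ?_⟩
      · rintro t ⟨rfl, ht⟩
        exact (h₃.1 ⟨rfl, ht⟩).elim (fun e => e ▸ h₂ e.symm) id
      · rcases hd k with (h' | h') | h'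
        exacts [Or.inl (Or.inl h'), Or.inl (Or.inr (Or.inr h')), Or.inr h']
      · obtain ⟨k, hk, hkA⟩ := hz
        refine ⟨k, hk, fun hn => hkA (hn.resolve_left fun e => ?_)⟩
        have e' : x = z := e.symm.trans hk
        exact hkA (e ▸ h₂ e')
      · obtain ⟨k, hk, hkA⟩ := hy
        refine ⟨k, hk, fun hn => hkA (hn.resolve_left fun e => ?_)⟩
        have e' : x = y := e.symm.trans hk
        exact hkA (e ▸ h₁ e')
    | succ n =>
      intro A x y z h₁ h₂ h₃
      exact hI.comp h₁ h₂ h₃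

variable [L.IsRelational]

theorem FreeIndep.map {σ : Equiv.Perm M} (hσ : σ ∈ autGroup L M) {A B C : Set M}
    (h : FreeIndep L A B C) : FreeIndep L (σ '' A) (σ '' B) (σ '' C) := by
  have hmem : ∀ {x : M} {S : Set M}, x ∈ σ '' S ↔ σ⁻¹ x ∈ S := fun {x S} => by
    rw [← σ.injective.mem_set_image (a := σ⁻¹ x), perm_apply_inv]
  refine ⟨fun x hx => hmem.2 (h.1 ⟨hmem.1 hx.1, hmem.1 hx.2⟩), fun n R d hd h₁ h₂ hR => ?_⟩
  refine h.2 n R (fun k => σ⁻¹ (d k)) (fun k => ?_) ?_ ?_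
    ((mem_autGroup_iff.1 (inv_mem hσ) n R d).2 hR)
  · rw [← Set.image_union, ← Set.image_union] at hd
    exact hmem.1 (hd k)
  · exact h₁.imp fun k hk => ⟨hmem.1 hk.1, fun h => hk.2 (hmem.2 h)⟩
  · exact h₂.imp fun k hk => ⟨hmem.1 hk.1, fun h => hk.2 (hmem.2 h)⟩

/-- Relations between the point and `C \ B` fail for both `p` and `q`. Relations involving the point
and otherwise only `B` are decided by the type over `B`. -/
theorem FreeIndep.stat (hM : L.IsUltrahomogeneous M) {B C : Set M} (hB : B.Finite) (hC : C.Finite)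
    {p q : M} (h : TypeEq (autGroup L M) B p q) (hp : FreeIndep L {p} B C)
    (hq : FreeIndep L {q} B C) : TypeEq (autGroup L M) (B ∪ C) p q := by
  classical
  by_cases hpB : p ∈ B
  · rw [h.eq_of_mem hpB]
    exact TypeEq.refl _ _ _
  have hqB : q ∉ B := h.notMem hpB
  have hpBC : ∀ z ∈ B ∪ C, z ≠ p := by
    rintro z hz rfl
    exact hz.elim hpB fun hz => hpB (hp.1 ⟨rfl, hz⟩)
  have hqBC : ∀ z ∈ B ∪ C, z ≠ q := by
    rintro z hz rfl
    exact hz.elim hqB fun hz => hqB (hq.1 ⟨rfl, hz⟩)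
  obtain ⟨σ, hσ, hσB, hσp⟩ := h
  obtain ⟨φ, hφp, hφ⟩ : ∃ φ : M → M, φ p = q ∧ ∀ a ∈ B ∪ C, φ a = a :=
    ⟨fun z => if z = p then q else z, if_pos rfl, fun a ha => if_neg (hpBC a ha)⟩
  obtain ⟨τ, hτ, hτφ⟩ := exists_autGroup_eqOn hM ((hB.union hC).insert p) φ (by
    rintro z (rfl | hz) z' (rfl | hz') e
    · rfl
    · rw [hφp, hφ _ hz'] at e
      exact (hqBC _ hz' e.symm).elim
    · rw [hφp, hφ _ hz] at e
      exact (hqBC _ hz e).elim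
    · rwa [hφ _ hz, hφ _ hz'] at e) (by
    intro n R x hx
    by_cases hex : ∃ i, x i = p
    · obtain ⟨i, hi⟩ := hex
      by_cases hexC : ∃ j, x j ∈ C \ B
      · obtain ⟨j, hj⟩ := hexC
        refine iff_of_false (hq.2 n R _ (fun k => ?_) ⟨i, ?_, ?_⟩ ⟨j, ?_⟩)
          (hp.2 n R x (fun k => ?_) ⟨i, hi, hi ▸ hpB⟩ ⟨j, hj⟩)
        · rcases hx k with h' | h'
          · exact Or.inl (Or.inl (by rw [h', hφp]; rfl))
          · rw [hφ _ h', Set.union_assoc]; exact Or.inr h'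
        · rw [hi, hφp]; rfl
        · rwa [hi, hφp]
        · rwa [hφ _ (Or.inr hj.1)]
        · rcases hx k with h' | h'
          · exact Or.inl (Or.inl h')
          · rw [Set.union_assoc]; exact Or.inr h'
      · have e : (fun k => φ (x k)) = fun k => σ (x k) := funext fun k => by
          rcases hx k with h' | h'
          · rw [h', hφp, hσp]
          · have : x k ∈ B := by
              by_contra hn
              exact hexC ⟨k, h'.resolve_left hn, hn⟩
            rw [hφ _ h', hσB _ this]
        rw [e]
        exact mem_autGroup_iff.1 hσ n R x
    · have e : (fun k => φ (x k)) = x := funext fun k =>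
        hφ _ ((hx k).resolve_left fun h' => hex ⟨k, h'⟩)
      rw [e])
  exact ⟨τ, hτ, fun b hb => by rw [hτφ (Or.inr hb), hφ b hb], by rw [hτφ (Or.inl rfl), hφp]⟩

/-- The free amalgam of `B ∪ {p}` and `B ∪ C` over `B` belongs to the age of `M`. By homogeneity it
embeds into `M` over `B ∪ C`, and the image of `p` is the point sought. -/
theorem FreeIndep.exist [Countable M] {K : Set (Bundled.{w} L.Structure)}
    (hK : IsFreeAmalgamationClass K) (hM : Language.IsFraisseLimit K M) {B C : Set M}
    (hB : B.Finite) (hC : C.Finite) (p : M) :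
    ∃ q, TypeEq (autGroup L M) B p q ∧ FreeIndep L {q} B C := by
  classical
  by_cases hpB : p ∈ B
  · exact ⟨p, TypeEq.refl _ _ _, fun z hz => by rwa [Set.mem_singleton_iff.1 hz.1], fun n R d _ h₁ => by
      obtain ⟨k, hk, hkB⟩ := h₁
      rw [Set.mem_singleton_iff.1 hk] at hkB
      exact (hkB hpB).elim⟩
  let sub : Set M → L.Substructure M := fun A => ⟨A, fun f => isEmptyElim f⟩
  have hfg : ∀ A : Set M, A.Finite → (sub A).FG := fun A hA =>
    Language.Substructure.fg_iff_finite.2 hA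
  have hmemK : ∀ A : Set M, A.Finite → (Bundled.of (sub A) : Bundled.{w} L.Structure) ∈ K :=
    fun A hA => by
      rw [← hM.age]
      exact Language.age.fg_substructure (hfg A hA)
  let i : sub B ↪[L] sub (insert p B) :=
    Language.Substructure.inclusion (show sub B ≤ sub (insert p B) from Set.subset_insert p B)
  let j : sub B ↪[L] sub (B ∪ C) :=
    Language.Substructure.inclusion (show sub B ≤ sub (B ∪ C) from Set.subset_union_left)
  obtain ⟨D, f, g, hD, hcomm, -, hinter, hrel⟩ := hK.2 (Bundled.of (sub (insert p B)))
    (Bundled.of (sub B)) (Bundled.of (sub (B ∪ C))) i j (hmemK _ (hB.insert p)) (hmemK _ hB)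
    (hmemK _ (hB.union hC))
  rw [← hM.age] at hD
  obtain ⟨-, hDM⟩ := hD
  obtain ⟨f', hf'⟩ := hM.ultrahomogeneous.extend_embedding
    ((Language.Substructure.fg_iff_structure_fg _).1 (hfg _ (hB.union hC)))
    (sub (B ∪ C)).subtype g
  have hg' : ∀ z (hz : z ∈ B ∪ C), f' (g ⟨z, hz⟩) = z := fun z hz =>
    (DFunLike.congr_fun hf' (⟨z, hz⟩ : sub (B ∪ C))).symm
  have hfB : ∀ z (hz : z ∈ B), f ⟨z, Or.inr hz⟩ = g ⟨z, Or.inl hz⟩ := fun z hz =>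
    DFunLike.congr_fun hcomm (⟨z, hz⟩ : sub B)
  let P : sub (insert p B) := ⟨p, Or.inl rfl⟩
  have hPn : f P ∉ Set.range g := fun h => by
    have : f P ∈ Set.range f ∩ Set.range g := ⟨⟨P, rfl⟩, h⟩
    rw [hinter] at this
    obtain ⟨b, hb⟩ := this
    have h1 : i b = P := f.injective hb
    have h2 : (i b : M) = p := congrArg Subtype.val h1
    exact hpB (h2 ▸ b.2)
  have hgB : ∀ z (hz : z ∈ B ∪ C), g ⟨z, hz⟩ ∈ Set.range f → z ∈ B := fun z hz h => by
    have : g ⟨z, hz⟩ ∈ Set.range f ∩ Set.range g := ⟨h, ⟨_, rfl⟩⟩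
    rw [hinter] at this
    obtain ⟨b, hb⟩ := this
    rw [hcomm] at hb
    have h1 : j b = ⟨z, hz⟩ := g.injective hb
    have h2 : (j b : M) = z := congrArg Subtype.val h1
    exact h2 ▸ b.2
  obtain ⟨φ, hφ⟩ : ∃ φ : M → M, ∀ z (hz : z ∈ insert p B), φ z = f' (f ⟨z, hz⟩) :=
    ⟨fun z => if hz : z ∈ insert p B then f' (f ⟨z, hz⟩) else z, fun z hz => dif_pos hz⟩
  obtain ⟨σ, hσ, hσφ⟩ := exists_autGroup_eqOn hM.ultrahomogeneous (hB.insert p) φ (by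
    intro z hz z' hz' e
    rw [hφ z hz, hφ z' hz'] at e
    exact congrArg Subtype.val (f.injective (f'.injective e))) (by
    intro n R x hx
    have e : (fun k => φ (x k)) = f' ∘ f ∘ fun k => (⟨x k, hx k⟩ : sub (insert p B)) :=
      funext fun k => hφ _ (hx k)
    rw [e]
    exact (f'.map_rel R _).trans (f.map_rel R _))
  refine ⟨f' (f P), ⟨σ, hσ, fun b hb => ?_, ?_⟩, ?_, ?_⟩
  · rw [hσφ (Or.inr hb), hφ b (Or.inr hb), hfB b hb]
    exact hg' b (Or.inl hb)
  · rw [hσφ (Or.inl rfl), hφ p (Or.inl rfl)]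
  · rintro z ⟨hz, hzC⟩
    rw [Set.mem_singleton_iff, ← hg' z (Or.inr hzC)] at hz
    exact (hPn ⟨_, f'.injective hz⟩).elim
  · rintro n R d hd ⟨k, hk, -⟩ ⟨l, hlC, hlB⟩ hR
    have hex : ∀ m, ∃ e, f' e = d m := fun m => by
      rcases hd m with (h | h) | h
      exacts [⟨f P, (Set.mem_singleton_iff.1 h).symm⟩, ⟨_, hg' _ (Or.inl h)⟩,
        ⟨_, hg' _ (Or.inr h)⟩]
    choose e he using hex
    have hRe : Language.Structure.RelMap R e := by
      rw [← f'.map_rel R e]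
      have : f' ∘ e = d := funext he
      rwa [this]
    have hek : e k = f P := f'.injective (by rw [he]; exact hk)
    have hel : e l = g ⟨d l, Or.inr hlC⟩ := f'.injective ((he l).trans (hg' (d l) (Or.inr hlC)).symm)
    rcases hrel n R e hRe with h | h
    · exact hlB (hgB (d l) (Or.inr hlC) (hel ▸ h l))
    · exact hPn (hek ▸ h k)

theorem freeIndep_isIndependence [Countable M] {K : Set (Bundled.{w} L.Structure)}
    (hK : IsFreeAmalgamationClass K) (hM : Language.IsFraisseLimit K M) :
    IsIndependence (autGroup L M) (FreeIndep L (M := M)) where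
  map := FreeIndep.map
  symm := FreeIndep.symm
  mono_right := FreeIndep.mono_right
  trans_right := FreeIndep.trans_right
  base_right := FreeIndep.base_right
  self B C := ⟨fun x hx => hx.1, fun n R d _ h₁ => by
    obtain ⟨k, hk, hk'⟩ := h₁
    exact (hk' hk).elim⟩
  disj h hA hC := h.1 ⟨hA, hC⟩
  exist hB hC p := FreeIndep.exist hK hM hB hC p
  stat hB hC _ _ h hp hq := FreeIndep.stat hM.ultrahomogeneous hB hC h hp hq

/-- Some relation holds of a tuple with two distinct entries. -/
theorem exists_relMap_ne (hM : L.IsUltrahomogeneous M) (htr : IsTransitive L M)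
    (hni : ¬ IsIndiscernibleSet L M) : ∃ (n : ℕ) (R : L.Relations n) (d : Fin n → M),
      Language.Structure.RelMap R d ∧ ∃ i j, d i ≠ d j := by
  by_contra hno
  push Not at hno
  refine hni fun m x y hx hy => ?_
  obtain ⟨φ, hφ⟩ : ∃ φ : M → M, ∀ i, φ (x i) = y i :=
    ⟨Function.extend x y id, fun i => hx.extend_apply y id i⟩
  have hinj : Set.InjOn φ (Set.range x) := by
    rintro _ ⟨i, rfl⟩ _ ⟨j, rfl⟩ e
    rw [hφ, hφ] at e
    rw [hy e]
  obtain ⟨σ, hσ, hσφ⟩ := exists_autGroup_eqOn hM (Set.finite_range x) φ hinj (by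
    intro n R d hd
    -- By transitivity a relation holds at all constant tuples or at none; at the other tuples none
    -- holds by assumption. So every injection between finite sets preserves all relations.
    by_cases hconst : ∀ i j, d i = d j
    · cases n with
      | zero => rw [Subsingleton.elim (fun i => φ (d i)) d]
      | succ n =>
        obtain ⟨τ, hτ, hτd⟩ := htr (d 0) (φ (d 0))
        have e : (fun i => φ (d i)) = fun i => τ (d i) := funext fun i => by
          rw [hconst i 0, hτd]
        rw [e]
        exact mem_autGroup_iff.1 hτ _ R d
    · refine iff_of_false (fun h => hconst fun i j => ?_) fun h => hconst (hno n R d h)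
      exact hinj (hd i) (hd j) (hno n R _ h i j))
  exact ⟨σ, hσ, by simp, fun i => (hσφ ⟨i, rfl⟩).trans (hφ i)⟩

/-- A nontrivial automorphism moves all realizations of some type. -/
theorem exists_moved_type_free (hI : IsIndependence (autGroup L M) (FreeIndep L (M := M)))
    (hM : L.IsUltrahomogeneous M) (htr : IsTransitive L M)
    (hni : ¬ IsIndiscernibleSet L M) {h : Equiv.Perm M} (hh : h ∈ autGroup L M) (hne : h ≠ 1) :
    ∃ (E : Set M) (p : M), E.Finite ∧ p ∉ E ∧ ∀ x, TypeEq (autGroup L M) E p x → h x ≠ x := by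
  obtain ⟨c, hc⟩ : ∃ c, h c ≠ c := by
    by_contra! hall
    exact hne (Equiv.ext hall)
  obtain ⟨n, R, d, hR, i, j, hij⟩ := exists_relMap_ne hM htr hni
  obtain ⟨σ, hσ, hσj⟩ := htr (d j) c
  -- The related tuple is moved over `c` so that it avoids `h c`. Equivalently, `h c` is replaced by
  -- a point `q` of the same type over `c` outside the tuple.
  obtain ⟨q, ⟨τ, hτ, hτc, hτq⟩, hq⟩ := hI.exist (B := {c}) (C := σ '' Set.range d)
    (Set.finite_singleton c) ((Set.finite_range d).image σ) (h c)
  have hτc' : τ⁻¹ c = c := by rw [Equiv.Perm.inv_eq_iff_eq, hτc c rfl]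
  set ρ := τ⁻¹ * σ with hρdef
  have hρ : ρ ∈ autGroup L M := mul_mem (inv_mem hτ) hσ
  have hρj : ρ (d j) = c := by rw [hρdef, Equiv.Perm.mul_apply, hσj, hτc']
  have hhc : ∀ k, ρ (d k) ≠ h c := fun k e => by
    have h1 : σ (d k) = q := by
      rw [← hτq, ← e, hρdef, Equiv.Perm.mul_apply, perm_apply_inv]
    have h2 : q ∈ ({c} : Set M) := hI.disj hq rfl ⟨d k, ⟨k, rfl⟩, h1⟩
    rw [← hτq, Set.mem_singleton_iff] at h2
    exact hc (τ.injective (h2.trans (hτc c rfl).symm))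
  set E : Set M := (Set.range fun k => ρ (d k)) \ {ρ (d i)} with hEdef
  have hE : E.Finite := (Set.finite_range _).subset Set.sdiff_subset
  have hcE : c ∈ E := ⟨⟨j, hρj⟩, fun e => hij (ρ.injective ((Set.mem_singleton_iff.1 e).symm.trans
    hρj.symm))⟩
  have hhcE : h c ∉ E := fun ⟨⟨k, hk⟩, _⟩ => hhc k hk
  have hpE : ρ (d i) ∉ E := fun hn => hn.2 rfl
  -- The realizations of this type are related to `E`, but independent from `h '' E` over `E`. If
  -- `h` fixed one, it would map the related tuple to one containing both that point and `h c`,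
  -- contradicting independence, as `h c ∉ E`.
  obtain ⟨p, hp, hpI⟩ := hI.exist hE (hE.image h) (ρ (d i))
  have hpE' : p ∉ E := hp.notMem hpE
  refine ⟨E ∪ h '' E, p, hE.union (hE.image h), fun hn => hpE' (hn.elim id fun hn =>
    hI.disj hpI rfl hn), fun x hx hfix => ?_⟩
  have hxI : FreeIndep L {x} E (h '' E) := by
    obtain ⟨ν, hν, hνf, rfl⟩ := hx
    have := hI.map hν hpI
    rwa [Set.image_singleton, image_eq_of_fix fun b hb => hνf b (Or.inl hb),
      image_eq_of_fix fun b hb => hνf b (Or.inr hb)] at this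
  have hxE : x ∉ E := (hx.mono Set.subset_union_left).notMem hpE'
  obtain ⟨ν, hν, hνE, hνx⟩ := hp.trans (hx.mono Set.subset_union_left)
  have hent : ∀ k, ν (ρ (d k)) ∈ insert x E := fun k => by
    by_cases e : ρ (d k) = ρ (d i)
    · rw [e, hνx]; exact Or.inl rfl
    · have : ρ (d k) ∈ E := ⟨⟨k, rfl⟩, e⟩
      rw [hνE _ this]; exact Or.inr this
  have hRx : Language.Structure.RelMap R fun k => h (ν (ρ (d k))) :=
    (mem_autGroup_iff.1 (mul_mem hh (mul_mem hν hρ)) n R d).2 hR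
  refine hxI.2 n R _ (fun k => ?_) ⟨i, ?_, ?_⟩ ⟨j, ?_, ?_⟩ hRx
  · rcases hent k with e | he
    · rw [e, hfix]; exact Or.inl (Or.inl rfl)
    · exact Or.inr ⟨_, he, rfl⟩
  · change h (ν (ρ (d i))) = x
    rw [hνx, hfix]
  · rw [hνx, hfix]; exact hxE
  · rw [hρj, hνE c hcE]; exact ⟨c, hcE, rfl⟩
  · rw [hρj, hνE c hcE]; exact hhcE

end Free

/-! ### The bounded rational Urysohn space -/

section Metric

variable {M : Type w} [MetricSpace M]

/-- The real number `t` is rational. -/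
def IsRat (t : ℝ) : Prop := ∃ q : ℚ, t = q

theorem IsRat.add {s t : ℝ} (hs : IsRat s) (ht : IsRat t) : IsRat (s + t) := by
  obtain ⟨q, rfl⟩ := hs
  obtain ⟨q', rfl⟩ := ht
  exact ⟨q + q', by push_cast; rfl⟩

theorem IsRat.min {s t : ℝ} (hs : IsRat s) (ht : IsRat t) : IsRat (min s t) := by
  rcases min_choice s t with h | h <;> rw [h] <;> assumption

theorem isRat_one : IsRat 1 := ⟨1, by simp⟩

theorem isRat_half : IsRat (1 / 2) := ⟨1 / 2, by norm_num⟩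

theorem mem_autGroup_distLang_iff (hU : IsBoundedRationalUrysohn M) {σ : Equiv.Perm M} :
    σ ∈ autGroup distLang M ↔ ∀ x y, dist (σ x) (σ y) = dist x y := by
  rw [mem_autGroup_iff]
  constructor
  · intro h x y
    obtain ⟨q, hq⟩ := (hU.rational x y).2
    exact ((h 2 (DistRel.dist q) ![x, y]).2 hq).trans hq.symm
  · intro h n R x
    cases R with
    | dist q =>
      change dist (σ (x 0)) (σ (x 1)) = q ↔ dist (x 0) (x 1) = q
      rw [h]

theorem exists_isometry_eqOn (hU : IsBoundedRationalUrysohn M) {A : Set M} (hA : A.Finite)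
    (φ : M → M) (hφ : ∀ x ∈ A, ∀ y ∈ A, dist (φ x) (φ y) = dist x y) :
    ∃ σ ∈ autGroup distLang M, Set.EqOn σ φ A := by
  obtain ⟨e, he⟩ := hU.homogeneous A hA (fun s => φ s.1)
    (Isometry.of_dist_eq fun x y => hφ x.1 x.2 y.1 y.2)
  exact ⟨e.toEquiv, (mem_autGroup_distLang_iff hU).2 fun x y => e.dist_eq x y,
    fun a ha => he ⟨a, ha⟩⟩

theorem typeEq_of_dist (hU : IsBoundedRationalUrysohn M) {A : Set M} (hA : A.Finite) {p q : M}
    (h : ∀ a ∈ A, dist p a = dist q a) : TypeEq (autGroup distLang M) A p q := by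
  classical
  by_cases hp : p ∈ A
  · have := h p hp
    rw [dist_self] at this
    rw [dist_eq_zero.1 this.symm]
    exact TypeEq.refl _ _ _
  have hne : ∀ a ∈ A, a ≠ p := fun a ha e => hp (e ▸ ha)
  obtain ⟨φ, hφp, hφ⟩ : ∃ φ : M → M, φ p = q ∧ ∀ a ∈ A, φ a = a :=
    ⟨fun z => if z = p then q else z, if_pos rfl, fun a ha => if_neg (hne a ha)⟩
  obtain ⟨σ, hσ, hσφ⟩ := exists_isometry_eqOn hU (hA.insert p) φ (by
    rintro x (rfl | hx) y (rfl | hy)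
    · rw [dist_self, dist_self]
    · rw [hφp, hφ y hy, h y hy]
    · rw [hφp, hφ x hx, dist_comm, ← h x hx, dist_comm]
    · rw [hφ x hx, hφ y hy])
  exact ⟨σ, hσ, fun a ha => by rw [hσφ (Or.inr ha), hφ a ha], by rw [hσφ (Or.inl rfl), hφp]⟩

theorem TypeEq.dist_eq (hU : IsBoundedRationalUrysohn M) {A : Set M} {p q a : M}
    (h : TypeEq (autGroup distLang M) A p q) (ha : a ∈ A) : dist q a = dist p a := by
  obtain ⟨σ, hσ, hσA, rfl⟩ := h
  conv_lhs => rw [← hσA a ha]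
  exact (mem_autGroup_distLang_iff hU).1 hσ p a

/-- The one-point extension of a finite metric space given by a distance function. -/
theorem exists_dist_eq_of_pos (hU : IsBoundedRationalUrysohn M) {A : Set M} (hA : A.Finite)
    {u : M → ℝ} (hrat : ∀ a ∈ A, IsRat (u a)) (hpos : ∀ a ∈ A, 0 < u a) (hle : ∀ a ∈ A, u a ≤ 1)
    (hlip : ∀ a ∈ A, ∀ b ∈ A, u a ≤ u b + dist a b)
    (htri : ∀ a ∈ A, ∀ b ∈ A, dist a b ≤ u a + u b) : ∃ c, ∀ a ∈ A, dist c a = u a := by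
  obtain ⟨n, a, hinj, rfl⟩ := Set.Finite.fin_param hA
  have hm : ∀ i, a i ∈ Set.range a := fun i => ⟨i, rfl⟩
  let D : Option (Fin n) → Option (Fin n) → ℝ := fun x y => match x, y with
    | none, none => 0
    | none, some j => u (a j)
    | some i, none => u (a i)
    | some i, some j => dist (a i) (a j)
  let _ : MetricSpace (Option (Fin n)) :=
    { dist := D
      dist_self := by
        rintro (_ | i)
        exacts [rfl, dist_self (a i)]
      dist_comm := by
        rintro (_ | i) (_ | j)
        exacts [rfl, rfl, rfl, dist_comm (a i) (a j)]
      dist_triangle := by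
        rintro (_ | i) (_ | j) (_ | k)
        · exact (add_zero (0 : ℝ)).ge
        · exact (zero_add (u (a k))).ge
        · exact add_nonneg (hpos _ (hm j)).le (hpos _ (hm j)).le
        · change u (a k) ≤ u (a j) + dist (a j) (a k)
          rw [dist_comm]
          exact hlip _ (hm k) _ (hm j)
        · exact (add_zero (u (a i))).ge
        · exact htri _ (hm i) _ (hm k)
        · change u (a i) ≤ dist (a i) (a j) + u (a j)
          rw [add_comm]
          exact hlip _ (hm i) _ (hm j)
        · exact dist_triangle (a i) (a j) (a k)
      eq_of_dist_eq_zero := by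
        rintro (_ | i) (_ | j) h
        · rfl
        · exact ((hpos _ (hm j)).ne' h).elim
        · exact ((hpos _ (hm i)).ne' h).elim
        · exact congrArg some (hinj (dist_eq_zero.1 h)) }
  obtain ⟨f, hf⟩ := hU.universal (Option (Fin n)) (by
    rintro (_ | i) (_ | j)
    · exact ⟨zero_le_one, 0, by simp⟩
    · exact ⟨hle _ (hm j), hrat _ (hm j)⟩
    · exact ⟨hle _ (hm i), hrat _ (hm i)⟩
    · exact hU.rational (a i) (a j))
  have hfinj : Function.Injective fun i => f (some i) := fun i j e =>
    Option.some_injective _ (hf.injective e)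
  obtain ⟨φ, hφ⟩ : ∃ φ : M → M, ∀ i, φ (f (some i)) = a i :=
    ⟨Function.extend (fun i => f (some i)) a id, fun i => hfinj.extend_apply a id i⟩
  obtain ⟨σ, hσ, hσφ⟩ := exists_isometry_eqOn hU (Set.finite_range fun i => f (some i)) φ (by
    rintro _ ⟨i, rfl⟩ _ ⟨j, rfl⟩
    rw [hφ, hφ, hf.dist_eq]
    rfl)
  refine ⟨σ (f none), ?_⟩
  rintro _ ⟨i, rfl⟩
  rw [← hφ i, ← hσφ ⟨i, rfl⟩, (mem_autGroup_distLang_iff hU).1 hσ, hf.dist_eq, hσφ ⟨i, rfl⟩, hφ]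
  rfl

theorem exists_dist_eq (hU : IsBoundedRationalUrysohn M) {A : Set M} (hA : A.Finite)
    {u : M → ℝ} (hrat : ∀ a ∈ A, IsRat (u a)) (hnonneg : ∀ a ∈ A, 0 ≤ u a)
    (hle : ∀ a ∈ A, u a ≤ 1) (hlip : ∀ a ∈ A, ∀ b ∈ A, u a ≤ u b + dist a b)
    (htri : ∀ a ∈ A, ∀ b ∈ A, dist a b ≤ u a + u b) : ∃ c, ∀ a ∈ A, dist c a = u a := by
  by_cases hzero : ∃ c ∈ A, u c = 0
  · obtain ⟨c, hc, hc0⟩ := hzero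
    refine ⟨c, fun a ha => le_antisymm ?_ ?_⟩
    · have := htri c hc a ha
      rwa [hc0, zero_add] at this
    · have := hlip a ha c hc
      rwa [hc0, zero_add, dist_comm] at this
  · push Not at hzero
    exact exists_dist_eq_of_pos hU hA hrat
      (fun a ha => lt_of_le_of_ne (hnonneg a ha) (hzero a ha).symm) hle hlip htri

theorem exists_capped_min {α : Type*} {B : Set α} (hB : B.Finite) (f : α → ℝ) :
    ∃ m ≤ 1, (∀ b ∈ B, m ≤ f b) ∧ (m = 1 ∨ ∃ b ∈ B, m = f b) := by
  obtain ⟨m, hm, hmin⟩ := Set.exists_min_image (insert 1 (f '' B)) id ((hB.image f).insert 1)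
    ⟨1, Or.inl rfl⟩
  refine ⟨m, hmin 1 (Or.inl rfl), fun b hb => hmin _ (Or.inr ⟨b, hb, rfl⟩), ?_⟩
  rcases hm with rfl | ⟨b, hb, rfl⟩
  exacts [Or.inl rfl, Or.inr ⟨b, hb, rfl⟩]

/-- The one-point extension over `B` given by `f`, with the largest possible distances to the
elements of `C`. -/
theorem exists_dist_eq_indep (hU : IsBoundedRationalUrysohn M) {B C : Set M} (hB : B.Finite)
    (hC : C.Finite) {f : M → ℝ} (hrat : ∀ b ∈ B, IsRat (f b)) (hnonneg : ∀ b ∈ B, 0 ≤ f b)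
    (hle : ∀ b ∈ B, f b ≤ 1) (hlip : ∀ b ∈ B, ∀ b' ∈ B, f b ≤ f b' + dist b b')
    (htri : ∀ b ∈ B, ∀ b' ∈ B, dist b b' ≤ f b + f b') :
    ∃ c, (∀ b ∈ B, dist c b = f b) ∧
      ∀ z ∈ C, dist c z = 1 ∨ ∃ b ∈ B, dist c z = f b + dist b z := by
  -- The largest extension of `f` that the triangle inequality and the bound one permit.
  choose u hu₁ hu₂ hu₃ using fun z : M => exists_capped_min hB fun b => f b + dist b z
  have hub : ∀ b ∈ B, u b = f b := fun b hb => by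
    refine le_antisymm ((hu₂ b b hb).trans (by rw [dist_self, add_zero])) ?_
    rcases hu₃ b with h | ⟨b', hb', h⟩
    · rw [h]; exact hle b hb
    · rw [h, dist_comm]; exact hlip b hb b' hb'
  obtain ⟨c, hc⟩ := exists_dist_eq hU (hB.union hC) (u := u)
    (fun z _ => by
      rcases hu₃ z with h | ⟨b, hb, h⟩ <;> rw [h]
      exacts [isRat_one, (hrat b hb).add (hU.rational b z).2])
    (fun z _ => by
      rcases hu₃ z with h | ⟨b, hb, h⟩ <;> rw [h]
      exacts [zero_le_one, add_nonneg (hnonneg b hb) dist_nonneg])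
    (fun z _ => hu₁ z)
    (fun z _ z' _ => by
      rcases hu₃ z' with h | ⟨b, hb, h⟩ <;> rw [h]
      · exact (hu₁ z).trans (le_add_of_nonneg_right dist_nonneg)
      · have h1 := hu₂ z b hb
        have h2 := dist_triangle b z' z
        rw [dist_comm z' z] at h2
        linarith)
    (fun z _ z' _ => by
      have hpos : ∀ z, 0 ≤ u z := fun z => by
        rcases hu₃ z with h | ⟨b, hb, h⟩ <;> rw [h]
        exacts [zero_le_one, add_nonneg (hnonneg b hb) dist_nonneg]
      have h1 := (hU.rational z z').1
      rcases hu₃ z with h | ⟨b, hb, h⟩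
      · linarith [hpos z']
      · rcases hu₃ z' with h' | ⟨b', hb', h'⟩
        · linarith [hpos z]
        · have h2 := htri b hb b' hb'
          have h3 := dist_triangle4 z b b' z'
          rw [dist_comm z b] at h3
          linarith)
  refine ⟨c, fun b hb => (hc b (Or.inl hb)).trans (hub b hb), fun z hz => ?_⟩
  rw [hc z (Or.inr hz)]
  exact hu₃ z

/-- Independence means that distances take the largest values permitted by the distances to the
base. This gives stationarity; existence is the largest extension, and transitivity is a triangle
inequality. -/
theorem metricIndep_isIndependence (hU : IsBoundedRationalUrysohn M) :
    IsIndependence (autGroup distLang M) (MetricIndep (M := M)) where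
  map := by
    rintro σ hσ A B C h _ ⟨a, ha, rfl⟩ _ ⟨c, hc, rfl⟩
    have hd := (mem_autGroup_distLang_iff hU).1 hσ
    rcases h a ha c hc with h | ⟨b, hb, h⟩
    · exact Or.inl (by rw [hd, h])
    · exact Or.inr ⟨σ b, ⟨b, hb, rfl⟩, by rw [hd, hd, hd, h]⟩
  symm := by
    intro A B C h c hc a ha
    rcases h a ha c hc with h | ⟨b, hb, h⟩
    · exact Or.inl (by rw [dist_comm, h])
    · exact Or.inr ⟨b, hb, by rw [dist_comm, h, add_comm, dist_comm b c, dist_comm a b]⟩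
  mono_right h hC a ha c hc := h a ha c (hC hc)
  trans_right := by
    rintro A B C D h h' a ha c (hc | hc)
    · exact h a ha c hc
    rcases h' a ha c hc with h'' | ⟨b, hb | hb, h''⟩
    · exact Or.inl h''
    · exact Or.inr ⟨b, hb, h''⟩
    · rcases h a ha b hb with e | ⟨b', hb', e⟩
      · refine Or.inl (le_antisymm (hU.rational a c).1 ?_)
        rw [h'', e]
        exact le_add_of_nonneg_right dist_nonneg
      · refine Or.inr ⟨b', hb', le_antisymm (dist_triangle _ _ _) ?_⟩
        rw [h'', e]
        linarith [dist_triangle b' b c]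
  base_right h a ha c hc := (h a ha c (Or.inr hc)).imp id fun ⟨b, hb, e⟩ => ⟨b, Or.inl hb, e⟩
  self B C a ha c _ := Or.inr ⟨a, ha, by rw [dist_self, zero_add]⟩
  disj := by
    intro A B C x h hA hC
    rcases h x hA x hC with e | ⟨b, hb, e⟩
    · rw [dist_self] at e
      exact (zero_ne_one e).elim
    · rw [dist_self, dist_comm b x] at e
      have : dist x b = 0 := by linarith [dist_nonneg (x := x) (y := b)]
      rw [dist_eq_zero.1 this]
      exact hb
  exist := by
    intro B C hB hC p
    obtain ⟨c, hc₁, hc₂⟩ := exists_dist_eq_indep hU hB hC (f := fun b => dist p b)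
      (fun b _ => (hU.rational p b).2) (fun b _ => dist_nonneg) (fun b _ => (hU.rational p b).1)
      (fun b _ b' _ => by
        have := dist_triangle p b' b
        rwa [dist_comm b' b] at this)
      (fun b _ b' _ => by
        have := dist_triangle b p b'
        rwa [dist_comm b p] at this)
    refine ⟨c, typeEq_of_dist hU hB fun b hb => (hc₁ b hb).symm, ?_⟩
    rintro _ rfl z hz
    exact (hc₂ z hz).imp id fun ⟨b, hb, e⟩ => ⟨b, hb, by rw [e, hc₁ b hb]⟩
  stat := by
    intro B C hB hC p q h hp hq
    have key : ∀ {p q : M}, TypeEq (autGroup distLang M) B p q → MetricIndep {p} B C →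
        ∀ c ∈ C, dist q c ≤ dist p c := by
      intro p q h hp c hc
      rcases hp p rfl c hc with e | ⟨b, hb, e⟩
      · rw [e]; exact (hU.rational q c).1
      · rw [e, ← h.dist_eq hU hb]; exact dist_triangle _ _ _
    refine typeEq_of_dist hU (hB.union hC) ?_
    rintro a (ha | ha)
    · exact (h.dist_eq hU ha).symm
    · exact le_antisymm (key h.symm hq a ha) (key h hp a ha)

/-- A nontrivial isometry moves all realizations of some type. -/
theorem exists_moved_type_metric (hU : IsBoundedRationalUrysohn M) {h : Equiv.Perm M}
    (hh : h ∈ autGroup distLang M) (hne : h ≠ 1) : ∃ (E : Set M) (p : M), E.Finite ∧ p ∉ E ∧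
      ∀ x, TypeEq (autGroup distLang M) E p x → h x ≠ x := by
  obtain ⟨c, hc⟩ : ∃ c, h c ≠ c := by
    by_contra! hall
    exact hne (Equiv.ext hall)
  have hD : 0 < dist c (h c) := dist_pos.2 hc.symm
  have hD1 := (hU.rational c (h c)).1
  obtain ⟨q, hq⟩ := (hU.rational c (h c)).2
  -- A fixed point would have equal distances to `c` and `h c`. A quarter of their distance is too
  -- small for that.
  obtain ⟨p, hp, -⟩ := exists_dist_eq_indep hU (B := {c}) (C := ∅) (Set.finite_singleton c)
    Set.finite_empty (f := fun _ => dist c (h c) / 4)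
    (fun _ _ => ⟨q / 4, by rw [hq]; push_cast; rfl⟩) (fun _ _ => by positivity)
    (fun _ _ => by linarith) (fun _ _ _ _ => le_add_of_nonneg_right dist_nonneg) (by
      rintro b rfl b' rfl
      rw [dist_self]
      positivity)
  have hpc := hp c rfl
  have hphc : dist p (h c) ≠ dist p c := by
    have := dist_triangle c p (h c)
    rw [dist_comm c p] at this
    intro e
    linarith
  refine ⟨{c, h c}, p, Set.toFinite _, ?_, fun x hx e => hphc ?_⟩
  · rintro (rfl | e)
    · rw [dist_self] at hpc
      linarith
    · have e' : p = h c := e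
      rw [e', dist_comm] at hpc
      linarith
  · rw [← hx.dist_eq hU (Or.inl rfl), ← hx.dist_eq hU (Or.inr rfl)]
    have := (mem_autGroup_distLang_iff hU).1 hh x c
    rwa [e] at this

/-- The elements `x` and `y` have distance at least `ε`, or at least one, or their distance is
realized by a path through `W`. -/
def FarApart (ε : ℝ) (W : Set M) (x y : M) : Prop :=
  min ε 1 ≤ dist x y ∨ ∃ b ∈ W, dist x y = dist x b + dist b y

theorem farApart_isMoveRel (hU : IsBoundedRationalUrysohn M) (G₂ : Subgroup (Equiv.Perm M))
    {ε : ℝ} (hε : 0 < ε) :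
    IsMoveRel (autGroup distLang M ⊓ G₂) MetricIndep (FarApart (M := M) ε) where
  map := by
    intro σ hσ W x y h
    have hd := (mem_autGroup_distLang_iff hU).1 hσ.1
    rcases h with h | ⟨b, hb, h⟩
    · exact Or.inl (by rwa [hd])
    · exact Or.inr ⟨σ b, ⟨b, hb, rfl⟩, by rw [hd, hd, hd, h]⟩
  symm := by
    intro W x y h
    rcases h with h | ⟨b, hb, h⟩
    · exact Or.inl (by rwa [dist_comm])
    · exact Or.inr ⟨b, hb, by rw [dist_comm, h, add_comm, dist_comm b y, dist_comm x b]⟩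
  reduce := by
    intro W D x y h h' _
    rcases h with h | ⟨b, hb, h⟩
    · exact Or.inl h
    rcases h' x rfl b hb with e | ⟨b', hb', e⟩
    · refine Or.inl ((min_le_right _ _).trans ?_)
      rw [h, e]
      exact le_add_of_nonneg_right dist_nonneg
    · refine Or.inr ⟨b', hb', le_antisymm (dist_triangle _ _ _) ?_⟩
      rw [h, e]
      linarith [dist_triangle b' b y]
  ne := by
    rintro W x y h hx rfl
    rcases h with h | ⟨b, hb, h⟩
    · rw [dist_self] at h
      exact absurd (lt_min hε one_pos) (not_lt.2 h)
    · rw [dist_self, dist_comm b x] at h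
      have : dist x b = 0 := by linarith [dist_nonneg (x := x) (y := b)]
      rw [dist_eq_zero.1 this] at hx
      exact hx hb

/-- If the distance from `z` to `y` is realized through `x`, two distances of at least `ε` add up.
If one of the two is itself realized through `A`, then so is the whole path. -/
theorem FarApart.comp {ε : ℝ} {A : Set M} {x y z : M} (h₁ : FarApart ε A x y)
    (h₂ : FarApart ε A x z) (h₃ : MetricIndep {z} (insert x A) {y}) :
    FarApart (2 * ε) A z y := by
  rcases h₃ z rfl y rfl with e | ⟨b, rfl | hb, e⟩
  · exact Or.inl (e ▸ min_le_right _ _)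
  · rcases h₁ with h₁ | ⟨b', hb', h₁⟩
    · rcases h₂ with h₂ | ⟨b', hb', h₂⟩
      · refine Or.inl ?_
        rw [e, dist_comm z b]
        rcases le_total ε 1 with h | h
        · rw [min_eq_left h] at h₁ h₂
          exact (min_le_left _ _).trans (by linarith)
        · rw [min_eq_right h] at h₁ h₂
          exact (min_le_right _ _).trans (by linarith)
      · refine Or.inr ⟨b', hb', le_antisymm (dist_triangle _ _ _) ?_⟩
        rw [e, dist_comm z b, h₂, dist_comm z b']
        linarith [dist_triangle b' b y, dist_comm b b']
    · refine Or.inr ⟨b', hb', le_antisymm (dist_triangle _ _ _) ?_⟩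
      rw [e, h₁]
      linarith [dist_triangle z b b']
  · exact Or.inr ⟨b, hb, e⟩

/-- Doubling `ε` until it reaches one turns `FarApart` into independence. -/
theorem metricIndep_moveChain (hU : IsBoundedRationalUrysohn M) {G₂ : Subgroup (Equiv.Perm M)}
    {h : Equiv.Perm M} {ε : ℝ} (hε : 0 < ε)
    (hm : Moves (autGroup distLang M ⊓ G₂) (FarApart ε) h) :
    MoveChain (autGroup distLang M ⊓ G₂) MetricIndep h := by
  obtain ⟨N, hN⟩ := pow_unbounded_of_one_lt (1 / ε) (one_lt_two (α := ℝ))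
  have hN' : 1 ≤ 2 ^ N * ε := by
    rw [div_lt_iff₀ hε] at hN
    exact hN.le
  refine ⟨fun n => FarApart (2 ^ n * ε), N, fun n => farApart_isMoveRel hU G₂ (by positivity),
    fun n A x y z h₁ h₂ h₃ => ?_, ?_, by simpa using hm⟩
  · change FarApart (2 ^ (n + 1) * ε) A z y
    rw [pow_succ', mul_assoc]
    exact h₁.comp h₂ h₃
  · rintro A x y h _ rfl _ rfl
    refine h.imp (fun h => le_antisymm (hU.rational _ _).1 ?_) id
    rwa [min_eq_right hN'] at h

/-- A nontrivial isometry moves some points by a fixed amount, far away from any finite set. -/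
theorem exists_displaced_far (hU : IsBoundedRationalUrysohn M) {h : Equiv.Perm M}
    (hh : h ∈ autGroup distLang M) {c : M} {E : Set M} (hE : E.Finite) :
    ∃ c₁, (∀ e ∈ E, 1 / 2 ≤ dist c₁ e ∧ 1 / 2 ≤ dist (h c₁) e) ∧
      min (1 / 2) (dist c (h c)) ≤ dist c₁ (h c₁) := by
  classical
  have hd := (mem_autGroup_distLang_iff hU).1 hh
  set δ := min (1 / 2) (dist c (h c)) with hδ
  have hδ0 : 0 ≤ δ := le_min (by norm_num) dist_nonneg
  have hδ1 : δ ≤ 1 / 2 := min_le_left _ _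
  have hδ2 : δ ≤ dist c (h c) := min_le_right _ _
  by_cases hc : h c = c
  · have hδ3 : δ = 0 := by
      rw [hδ, hc, dist_self]; norm_num
    obtain ⟨c₁, -, hc₁⟩ := exists_dist_eq_indep hU (B := ∅)
      (C := E ∪ (h⁻¹ : Equiv.Perm M) '' E) Set.finite_empty (hE.union (hE.image _))
      (f := fun _ => 0) (by simp) (by simp) (by simp) (by simp) (by simp)
    have h1 : ∀ z ∈ E ∪ (h⁻¹ : Equiv.Perm M) '' E, dist c₁ z = 1 := fun z hz =>
      (hc₁ z hz).resolve_right (by simp)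
    refine ⟨c₁, fun e he => ⟨?_, ?_⟩, by rw [hδ3]; exact dist_nonneg⟩
    · rw [h1 e (Or.inl he)]; norm_num
    · rw [← perm_apply_inv h e, hd, h1 _ (Or.inr ⟨e, he, rfl⟩)]; norm_num
  -- Since `h c₁` has distance `1 / 2` from `h c` and `c₁` has distance `1 / 2 + δ`, the two are at
  -- least `δ` apart. Values of at least one half keep `c₁` away from other sets.
  obtain ⟨f, hfc, hfhc⟩ : ∃ f : M → ℝ, f c = 1 / 2 ∧ f (h c) = 1 / 2 + δ :=
    ⟨fun z => if z = c then 1 / 2 else 1 / 2 + δ, if_pos rfl, if_neg hc⟩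
  have hf : ∀ b ∈ ({c, h c} : Set M), 1 / 2 ≤ f b ∧ f b ≤ 1 ∧ IsRat (f b) := by
    rintro b (rfl | rfl)
    · rw [hfc]; exact ⟨le_rfl, by norm_num, isRat_half⟩
    · rw [hfhc]
      exact ⟨by linarith, by linarith, isRat_half.add (isRat_half.min (hU.rational _ _).2)⟩
  obtain ⟨c₁, hc₁, hc₁'⟩ := exists_dist_eq_indep hU (B := {c, h c})
    (C := E ∪ (h⁻¹ : Equiv.Perm M) '' E) (Set.toFinite _) (hE.union (hE.image _)) (f := f)
    (fun b hb => (hf b hb).2.2) (fun b hb => by linarith [(hf b hb).1])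
    (fun b hb => (hf b hb).2.1) (by
      rintro b (rfl | rfl) b' (rfl | rfl)
      · exact le_add_of_nonneg_right dist_nonneg
      · rw [hfc, hfhc]; linarith [dist_nonneg (x := b) (y := h b)]
      · rw [hfc, hfhc, dist_comm]; linarith
      · exact le_add_of_nonneg_right dist_nonneg)
    (fun b hb b' hb' => by linarith [(hf b hb).1, (hf b' hb').1, (hU.rational b b').1])
  have hfar : ∀ z ∈ E ∪ (h⁻¹ : Equiv.Perm M) '' E, 1 / 2 ≤ dist c₁ z := fun z hz => by
    rcases hc₁' z hz with e | ⟨b, hb, e⟩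
    · rw [e]; norm_num
    · rw [e]; linarith [(hf b hb).1, dist_nonneg (x := b) (y := z)]
  refine ⟨c₁, fun e he => ⟨hfar e (Or.inl he), ?_⟩, ?_⟩
  · rw [← perm_apply_inv h e, hd]
    exact hfar _ (Or.inr ⟨e, he, rfl⟩)
  · have h1 := hc₁ c (Or.inl rfl)
    have h2 := hc₁ (h c) (Or.inr rfl)
    have h3 := dist_triangle c₁ (h c₁) (h c)
    rw [hd, h1, h2, hfc, hfhc] at h3
    linarith

/-- A nontrivial isometry moves some realization of any type with large distances by a fixed
amount. -/
theorem exists_displaced (hU : IsBoundedRationalUrysohn M) {h : Equiv.Perm M}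
    (hh : h ∈ autGroup distLang M) {c : M} (hc : h c ≠ c) {E : Set M} (hE : E.Finite) {e₀ : M}
    (he₀ : ∀ e ∈ E, 1 / 2 ≤ dist e₀ e) :
    ∃ c₀, (∀ e ∈ E, dist c₀ e = dist e₀ e) ∧
      min (1 / 2) (dist c (h c)) ≤ dist c₀ (h c₀) := by
  classical
  have hd := (mem_autGroup_distLang_iff hU).1 hh
  obtain ⟨c₁, hc₁, hδc₁⟩ := exists_displaced_far hU hh (c := c) hE
  set δ := min (1 / 2) (dist c (h c)) with hδ
  have hδ0 : 0 < δ := lt_min (by norm_num) (dist_pos.2 hc.symm)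
  have hδ1 : δ ≤ 1 / 2 := min_le_left _ _
  have hc₁E : c₁ ∉ E := fun he => by
    have := (hc₁ c₁ he).1
    rw [dist_self] at this
    norm_num at this
  have hhc₁E : h c₁ ∉ E := fun he => by
    have := (hc₁ _ he).2
    rw [dist_self] at this
    norm_num at this
  have hne : h c₁ ≠ c₁ := fun e => by
    rw [e, dist_self] at hδc₁
    linarith
  -- The same device, relative to `c₁` and with the distances of `e₀` to `E`. As `c₁` and `h c₁` are
  -- at least one half away from `E` and all values lie in `[1/2, 1]`, these distances are
  -- compatible.
  obtain ⟨f, hf₁, hf₂, hfE⟩ : ∃ f : M → ℝ, f c₁ = 1 / 2 ∧ f (h c₁) = 1 / 2 + δ ∧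
      ∀ e ∈ E, f e = dist e₀ e :=
    ⟨fun z => if z = c₁ then 1 / 2 else if z = h c₁ then 1 / 2 + δ else dist e₀ z, if_pos rfl,
      (if_neg hne).trans (if_pos rfl), fun e he =>
        (if_neg fun e' : e = c₁ => hc₁E (e' ▸ he)).trans
          (if_neg fun e' : e = h c₁ => hhc₁E (e' ▸ he))⟩
  have hf : ∀ b ∈ insert c₁ (insert (h c₁) E), 1 / 2 ≤ f b ∧ f b ≤ 1 ∧ IsRat (f b) := by
    rintro b (rfl | rfl | hb)
    · rw [hf₁]; exact ⟨le_rfl, by norm_num, isRat_half⟩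
    · rw [hf₂]
      exact ⟨by linarith, by linarith, isRat_half.add (isRat_half.min (hU.rational _ _).2)⟩
    · rw [hfE b hb]; exact ⟨he₀ b hb, (hU.rational _ _).1, (hU.rational _ _).2⟩
  obtain ⟨c₀, hc₀⟩ := exists_dist_eq hU ((hE.insert (h c₁)).insert c₁) (u := f)
    (fun b hb => (hf b hb).2.2) (fun b hb => by linarith [(hf b hb).1])
    (fun b hb => (hf b hb).2.1) (by
      have hfar : ∀ b ∈ insert c₁ (insert (h c₁) E), ∀ b' ∈ insert c₁ (insert (h c₁) E),
          1 / 2 ≤ dist b b' → f b ≤ f b' + dist b b' := fun b hb b' hb' hbb' => by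
        linarith [(hf b hb).2.1, (hf b' hb').1]
      intro b hb b' hb'
      rcases hb with rfl | rfl | hbE <;> rcases hb' with rfl | rfl | hbE'
      · exact le_add_of_nonneg_right dist_nonneg
      · rw [hf₁, hf₂]; linarith [dist_nonneg (x := b) (y := h b)]
      · exact hfar _ (Or.inl rfl) _ (Or.inr (Or.inr hbE')) (hc₁ b' hbE').1
      · rw [hf₁, hf₂, dist_comm]; linarith
      · exact le_add_of_nonneg_right dist_nonneg
      · exact hfar _ (Or.inr (Or.inl rfl)) _ (Or.inr (Or.inr hbE')) (hc₁ b' hbE').2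
      · exact hfar _ (Or.inr (Or.inr hbE)) _ (Or.inl rfl) (by
          rw [dist_comm]; exact (hc₁ b hbE).1)
      · exact hfar _ (Or.inr (Or.inr hbE)) _ (Or.inr (Or.inl rfl)) (by
          rw [dist_comm]; exact (hc₁ b hbE).2)
      · rw [hfE b hbE, hfE b' hbE', dist_comm b b']
        exact dist_triangle _ _ _)
    (fun b hb b' hb' => by linarith [(hf b hb).1, (hf b' hb').1, (hU.rational b b').1])
  refine ⟨c₀, fun e he => (hc₀ e (Or.inr (Or.inr he))).trans (hfE e he), ?_⟩
  have h1 := hc₀ c₁ (Or.inl rfl)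
  have h2 := hc₀ (h c₁) (Or.inr (Or.inl rfl))
  have h3 := dist_triangle c₀ (h c₀) (h c₁)
  rw [hd, h1, h2, hf₁, hf₂] at h3
  linarith

/-- A nontrivial automorphism moves some realization of any type by a fixed amount, or as far as
possible. -/
theorem exists_moves_farApart [Countable M] (hU : IsBoundedRationalUrysohn M)
    {G₂ : Subgroup (Equiv.Perm M)} (hF : IsFusionPair (autGroup distLang M) G₂)
    {h : Equiv.Perm M} (hh : h ∈ autGroup distLang M) (hne : h ≠ 1) :
    ∃ ε > 0, Moves (autGroup distLang M ⊓ G₂) (FarApart ε) h := by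
  classical
  obtain ⟨c, hc⟩ : ∃ c, h c ≠ c := by
    by_contra! hall
    exact hne (Equiv.ext hall)
  have hd := (mem_autGroup_distLang_iff hU).1 hh
  set δ := min (1 / 2) (dist c (h c)) with hδ
  have hδ0 : 0 < δ := lt_min (by norm_num) (dist_pos.2 hc.symm)
  have hδ1 : δ ≤ 1 / 2 := min_le_left _ _
  refine ⟨δ, hδ0, fun W hW x hx => ?_⟩
  -- a point `e₀` of distance one half from the realizations
  set f : M → ℝ := fun b => min 1 (1 / 2 + dist x b) with hf
  have hfle : ∀ b, f b ≤ 1 := fun b => min_le_left _ _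
  have hfge : ∀ b, 1 / 2 ≤ f b := fun b => le_min (by norm_num) (by
    linarith [dist_nonneg (x := x) (y := b)])
  obtain ⟨e₀, he₀, he₀'⟩ := exists_dist_eq_indep hU hW (hW.image (h⁻¹ : Equiv.Perm M)) (f := f)
    (fun b _ => isRat_one.min (isRat_half.add (hU.rational x b).2))
    (fun b _ => by linarith [hfge b]) (fun b _ => hfle b)
    (fun b _ b' _ => by
      have h1 := dist_triangle x b' b
      rw [dist_comm b' b] at h1
      rcases min_choice (1 : ℝ) (1 / 2 + dist x b') with e | e
      · have : f b' = 1 := e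
        linarith [hfle b, dist_nonneg (x := b) (y := b')]
      · have e' : f b' = 1 / 2 + dist x b' := e
        have : f b ≤ 1 / 2 + dist x b := min_le_right _ _
        linarith)
    (fun b _ b' _ => by linarith [hfge b, hfge b', (hU.rational b b').1])
  have hE : (W ∪ (h⁻¹ : Equiv.Perm M) '' W).Finite := hW.union (hW.image _)
  have hfar : ∀ e ∈ W ∪ (h⁻¹ : Equiv.Perm M) '' W, 1 / 2 ≤ dist e₀ e := by
    rintro e (he | he)
    · rw [he₀ e he]; exact hfge e
    · rcases he₀' e he with h' | ⟨b, hb, h'⟩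
      · rw [h']; norm_num
      · rw [h']; linarith [hfge b, dist_nonneg (x := b) (y := e)]
  obtain ⟨c₀, hc₀, hδc₀⟩ := exists_displaced hU hh hc hE hfar
  have hc₀W : ∀ b ∈ W, dist c₀ b = f b := fun b hb => (hc₀ b (Or.inl hb)).trans (he₀ b hb)
  have hc₀n : c₀ ∉ W := fun hn => by
    have := hfar c₀ (Or.inl hn)
    rw [← hc₀ c₀ (Or.inl hn), dist_self] at this
    norm_num at this
  have hhc₀ : ∀ b, dist b (h c₀) = dist c₀ (h⁻¹ b) := fun b => by
    rw [← hd c₀, perm_apply_inv, dist_comm]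
  obtain ⟨k, hkc, hkW⟩ : ∃ k : M → ℝ, k c₀ = 1 / 2 ∧ ∀ b ∈ W, k b = dist x b :=
    ⟨fun z => if z = c₀ then 1 / 2 else dist x z, if_pos rfl, fun b hb =>
      if_neg fun e : b = c₀ => hc₀n (e ▸ hb)⟩
  have hcase : ∀ b ∈ W, dist c₀ b ≤ 1 / 2 + dist x b ∧ 1 / 2 ≤ dist c₀ b := fun b hb => by
    rw [hc₀W b hb]
    exact ⟨min_le_right _ _, hfge b⟩
  -- A realization of the metric type of `x` at distance `1 / 2` from `c₀`, and as far as possible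
  -- from `h c₀`. Its counterpart `y` in the fusion then has `h y` at distance `1 / 2` from `h c₀`,
  -- so `y` and `h y` differ by at least the excess of `dist y (h c₀)` over `1 / 2`.
  obtain ⟨y₁, hy₁, hy₁'⟩ := exists_dist_eq_indep hU (hW.insert c₀) (Set.finite_singleton (h c₀))
    (f := k)
    (by
      rintro b (rfl | hb)
      · rw [hkc]; exact isRat_half
      · rw [hkW b hb]; exact (hU.rational x b).2)
    (by
      rintro b (rfl | hb)
      · rw [hkc]; norm_num
      · rw [hkW b hb]; exact dist_nonneg)
    (by
      rintro b (rfl | hb)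
      · rw [hkc]; norm_num
      · rw [hkW b hb]; exact (hU.rational x b).1)
    (by
      rintro b (rfl | hb) b' (rfl | hb')
      · exact le_add_of_nonneg_right dist_nonneg
      · rw [hkc, hkW b' hb']
        linarith [(hcase b' hb').2, dist_nonneg (x := x) (y := b')]
      · rw [hkc, hkW b hb, dist_comm b b']
        linarith [(hcase b hb).2, (hU.rational x b).1]
      · rw [hkW b hb, hkW b' hb', dist_comm b b']
        exact dist_triangle _ _ _)
    (by
      rintro b (rfl | hb) b' (rfl | hb')
      · rw [dist_self, hkc]; norm_num
      · rw [hkc, hkW b' hb']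
        exact (hcase b' hb').1
      · rw [hkc, hkW b hb, dist_comm b b', add_comm]
        exact (hcase b hb).1
      · rw [hkW b hb, hkW b' hb']
        have := dist_triangle b x b'
        rwa [dist_comm b x] at this)
  have hy₁W : ∀ b ∈ W, dist y₁ b = dist x b := fun b hb => (hy₁ b (Or.inr hb)).trans (hkW b hb)
  have hy₁c : dist y₁ c₀ = 1 / 2 := (hy₁ c₀ (Or.inl rfl)).trans hkc
  have hhalf : ∀ b ∈ W, 1 / 2 ≤ dist b (h c₀) := fun b hb => by
    rw [hhc₀, hc₀ _ (Or.inr ⟨b, hb, rfl⟩)]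
    exact hfar _ (Or.inr ⟨b, hb, rfl⟩)
  have hy₁n : y₁ ∉ insert (h c₀) (insert c₀ W) := by
    rintro (e | e | e)
    · rcases hy₁' (h c₀) rfl with h' | ⟨b, rfl | hb, h'⟩
      · rw [e, dist_self] at h'
        norm_num at h'
      · rw [e, dist_self, hkc] at h'
        linarith [dist_nonneg (x := b) (y := h b)]
      · rw [e, dist_self, hkW b hb] at h'
        linarith [hhalf b hb, dist_nonneg (x := x) (y := b)]
    · rw [e, dist_self] at hy₁c
      norm_num at hy₁c
    · have := hy₁W y₁ e
      rw [dist_self] at this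
      rw [dist_eq_zero.1 this.symm] at hx
      exact hx e
  obtain ⟨y, hyy₁, hyx⟩ := hF.realize ((hW.insert c₀).insert (h c₀)) hW hy₁n hx
  have hyW : ∀ b ∈ W, dist y b = dist x b := fun b hb =>
    (hyy₁.dist_eq hU (Or.inr (Or.inr hb))).trans (hy₁W b hb)
  refine ⟨y, hF.typeEq_inf hW (typeEq_of_dist hU hW fun b hb => (hyW b hb).symm) hyx, ?_⟩
  have hyc : dist (h y) (h c₀) = 1 / 2 := by
    rw [hd, hyy₁.dist_eq hU (Or.inr (Or.inl rfl)), hy₁c]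
  have hyhc : dist y (h c₀) = dist y₁ (h c₀) := hyy₁.dist_eq hU (Or.inl rfl)
  have htri := dist_triangle y (h y) (h c₀)
  rw [hyc, hyhc] at htri
  -- The distance from `y₁` to `h c₀` is one, or realized through `c₀`, or through some `b` in `W`.
  -- The first two give an excess of at least `δ`.
  rcases hy₁' (h c₀) rfl with e | ⟨b, rfl | hb, e⟩
  · exact Or.inl ((min_le_left _ _).trans (by linarith))
  · rw [hkc] at e
    exact Or.inl ((min_le_left _ _).trans (by linarith))
  · rw [hkW b hb, hhc₀ b, hc₀ _ (Or.inr ⟨b, hb, rfl⟩)] at e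
    rcases he₀' _ ⟨b, hb, rfl⟩ with e' | ⟨b', hb', e'⟩
    · exact Or.inl ((min_le_left _ _).trans (by linarith [dist_nonneg (x := x) (y := b)]))
    · rcases min_choice (1 : ℝ) (1 / 2 + dist x b') with e'' | e''
      · have : f b' = 1 := e''
        exact Or.inl ((min_le_left _ _).trans (by
          linarith [dist_nonneg (x := x) (y := b), dist_nonneg (x := b') (y := h⁻¹ b)]))
      · have e3 : f b' = 1 / 2 + dist x b' := e''
        -- Here the excess is `dist x b + dist x b' + dist b' (h⁻¹ b)`. The last two summands are
        -- the length of a path from `h y` through `h b'` to `b`, so the distance of `y` and `h y`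
        -- is realized through `b`.
        refine Or.inr ⟨b, hb, le_antisymm (dist_triangle _ _ _) ?_⟩
        have h1 : dist (h b') b = dist b' (h⁻¹ b) := by rw [← hd b', perm_apply_inv]
        have h2 : dist (h y) (h b') = dist x b' := by rw [hd, hyW b' hb']
        have h3 := dist_triangle b (h b') (h y)
        rw [dist_comm b (h b'), h1, dist_comm (h b') (h y), h2] at h3
        rw [hyW b hb]
        linarith

end Metric

/-! ### Order and tournament expansions -/

section Expansions

variable {L : FirstOrder.Language.{u, v}} [L.IsRelational] {M : Type w} [L.Structure M]
  [binLang.Structure M] [Countable M] {I : Set M → Set M → Set M → Prop}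

theorem IsOrderExpansion.exists_compatible (hM : IsOrderExpansion L M)
    (hI : IsIndependence (autGroup L M) I)
    (hmove : ∀ f ∈ autGroup L M, f ≠ 1 → ∃ (E : Set M) (p : M), E.Finite ∧ p ∉ E ∧
      ∀ x, TypeEq (autGroup L M) E p x → f x ≠ x)
    (hch : IsFusionPair (autGroup L M) (autGroup binLang M) →
      ∀ f ∈ autGroup L M ⊓ autGroup binLang M, f ≠ 1 → (∀ x, f x ≠ x) →
        MoveChain (autGroup L M ⊓ autGroup binLang M) I f)
    {h : autGroup (L.sum binLang) M} (hne : h ≠ 1) :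
    ∃ g ∈ Subgroup.normalClosure {h}, MovesMaximally L binLang I g ∧
      IsCompatible L binLang I g ∧ IsUnboundedlyIncreasing (binRel M) g.1 := by
  obtain ⟨hf, ⟨θ₀⟩⟩ := hM
  let _ : LinearOrder M := LinearOrder.lift' θ₀ θ₀.injective
  let θ : M ≃o ℚ := ⟨θ₀.toEquiv, Iff.rfl⟩
  have hlt : binRel M = fun x y => x < y :=
    funext fun x => funext fun y => propext (θ₀.map_rel_iff.symm.trans θ.lt_iff_lt)
  have : DenselyOrdered M := ⟨fun a b h => by
    obtain ⟨c, hac, hcb⟩ := exists_between (θ.lt_iff_lt.2 h)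
    exact ⟨θ.symm c, (OrderIso.lt_symm_apply θ).2 hac, (OrderIso.symm_apply_lt θ).2 hcb⟩⟩
  have : NoMaxOrder M := ⟨fun a => by
    obtain ⟨c, hc⟩ := NoMaxOrder.exists_gt (θ a)
    exact ⟨θ.symm c, (OrderIso.lt_symm_apply θ).2 hc⟩⟩
  have : NoMinOrder M := ⟨fun a => by
    obtain ⟨c, hc⟩ := NoMinOrder.exists_lt (θ a)
    exact ⟨θ.symm c, (OrderIso.symm_apply_lt θ).2 hc⟩⟩
  have hr : IsHomogeneousTournament (autGroup binLang M) (binRel M) :=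
    isHomogeneousTournament_binLang hf.homogeneous₂ (by rw [hlt]; exact lt_irrefl)
      (by rw [hlt]; exact fun _ _ => lt_asymm) (by rw [hlt]; exact fun _ _ => lt_or_gt_of_ne)
  have hr' := hr
  rw [hlt] at hr'
  have hF := isFusionPair_of_isFreeFusion hf hI (exists_fresh_order hr')
  obtain ⟨E, p, hE, hp, hEp⟩ := hmove h.1 (mem_inf_of_aut h).1 fun e => hne (Subtype.ext e)
  exact exists_compatible_order θ hlt hF hI hr hE hp hEp fun f hf hfix =>
    hch hF f hf (fun e => hfix p (by rw [e, Equiv.Perm.one_apply])) hfix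

theorem IsTournamentExpansion.exists_compatible (hM : IsTournamentExpansion L M)
    (hI : IsIndependence (autGroup L M) I)
    (hch : IsFusionPair (autGroup L M) (autGroup binLang M) →
      IsHomogeneousTournament (autGroup binLang M) (binRel M) →
      HasTournamentExtension (binRel M) →
      ∀ f ∈ autGroup L M ⊓ autGroup binLang M, f ≠ 1 →
        MoveChain (autGroup L M ⊓ autGroup binLang M) I f)
    {h : autGroup (L.sum binLang) M} (hne : h ≠ 1) :
    ∃ g ∈ Subgroup.normalClosure {h}, MovesMaximally L binLang I g ∧
      IsCompatible L binLang I g := by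
  obtain ⟨hf, ht⟩ := hM
  have hr : IsHomogeneousTournament (autGroup binLang M) (binRel M) :=
    isHomogeneousTournament_binLang hf.homogeneous₂ ht.irrefl ht.asymm ht.total
  have hext : HasTournamentExtension (binRel M) := ht.extension
  have hF := isFusionPair_of_isFreeFusion hf hI (exists_fresh_tournament hr hext)
  exact exists_compatible_tournament hF hI hr hext
    (hch hF hr hext h.1 (mem_inf_of_aut h) fun e => hne (Subtype.ext e))

end Expansions

end Fusion

open Fusion

theorem proposition1p4 :
    -- limits of free, transitive, nontrivial amalgamation classes
    (∀ (L : FirstOrder.Language.{u, v}) [L.IsRelational] (M : Type w) [L.Structure M] [Countable M]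
        (K : Set (Bundled.{w} L.Structure)),
      IsFreeAmalgamationClass K → FirstOrder.Language.IsFraisseLimit K M →
      IsTransitive L M → ¬ IsIndiscernibleSet L M →
      ∀ [binLang.Structure M],
        (IsOrderExpansion L M →
          ∀ h : autGroup (L.sum binLang) M, h ≠ 1 →
            ∃ g ∈ Subgroup.normalClosure {h},
              MovesMaximally L binLang (FreeIndep L) g ∧
              IsCompatible L binLang (FreeIndep L) g ∧
              IsUnboundedlyIncreasing (binRel M) g.1) ∧
        (IsTournamentExpansion L M →
          ∀ h : autGroup (L.sum binLang) M, h ≠ 1 →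
            ∃ g ∈ Subgroup.normalClosure {h},
              MovesMaximally L binLang (FreeIndep L) g ∧
              IsCompatible L binLang (FreeIndep L) g)) ∧
    -- the bounded rational Urysohn space
    (∀ (M : Type w) [MetricSpace M], IsBoundedRationalUrysohn M →
      ∀ [binLang.Structure M],
        (IsOrderExpansion distLang M →
          ∀ h : autGroup (distLang.sum binLang) M, h ≠ 1 →
            ∃ g ∈ Subgroup.normalClosure {h},
              MovesMaximally distLang binLang MetricIndep g ∧
              IsCompatible distLang binLang MetricIndep g ∧
              IsUnboundedlyIncreasing (binRel M) g.1) ∧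
        (IsTournamentExpansion distLang M →
          ∀ h : autGroup (distLang.sum binLang) M, h ≠ 1 →
            ∃ g ∈ Subgroup.normalClosure {h},
              MovesMaximally distLang binLang MetricIndep g ∧
              IsCompatible distLang binLang MetricIndep g)) := by

  refine ⟨fun L _ M _ _ K hK hM htr hni _ => ?_, fun M _ hU _ => ?_⟩
  · have hI := freeIndep_isIndependence hK hM
    refine ⟨fun hO h hne => hO.exists_compatible hI
      (fun f hf hne => exists_moved_type_free hI hM.ultrahomogeneous htr hni hf hne)
      -- In the order case the chain starts from an element without fixed points, so every point is
      -- a witness for its own type.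
      (fun hF f hf _ hfix => freeIndep_moveChain hI fun W hW x hx =>
        ⟨x, TypeEq.refl _ _ _, fun e => absurd e.symm (hfix x)⟩) hne,
      fun hT h hne => hT.exists_compatible hI
        (fun hF hr hext f hf hne =>
          freeIndep_moveChain hI (exists_moved_tournament hF hI hr hext hf hne)) hne⟩
  · have := hU.countable
    have hI := metricIndep_isIndependence hU
    have hch : IsFusionPair (autGroup distLang M) (autGroup binLang M) →
        ∀ f ∈ autGroup distLang M ⊓ autGroup binLang M, f ≠ 1 →
          MoveChain (autGroup distLang M ⊓ autGroup binLang M) MetricIndep f :=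
      fun hF f hf hne => by
        obtain ⟨ε, hε, hm⟩ := exists_moves_farApart hU hF hf.1 hne
        exact metricIndep_moveChain hU hε hm
    exact ⟨fun hO h hne => hO.exists_compatible hI
      (fun f hf hne => exists_moved_type_metric hU hf hne)
      (fun hF f hf hne _ => hch hF f hf hne) hne,
      fun hT h hne => hT.exists_compatible hI (fun hF _ _ => hch hF) hne⟩
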